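/- Let $M$ be a connected (Hausdorff) smooth manifold of dimension $n\ge 2$ with a Finsler structure $F:TM\to[0,\infty)$, i.e. $F$ is $C^\infty$ on the slit tangent bundle $TM_0$, $F(x,\lambda y)=\lambda F(x,y)$ for $\lambda>0$, and $g_{ij}(x,y)=\tfrac12\,\partial^2F^2/\partial y^i\partial y^j$ is positive definite on $TM_0$. Let $d(p,q)$ be the infimum of the lengths $\int F(\gamma,\dot\gamma)\,dt$ of piecewise $C^\infty$ curves $\gamma$ from $p$ to $q$, and suppose that $(M,F)$ is complete: every sequence $(x_i)$ which is forward Cauchy (for every $\varepsilon>0$ there is $N$ with $d(x_i,x_j)<\varepsilon$ whenever $j\ge i\ge N$) converges. Let $G^i=\tfrac14 g^{ih}\big(\tfrac{\partial g_{hk}}{\partial x^j}+\tfrac{\partial g_{hj}}{\partial x^k}-\tfrac{\partial g_{jk}}{\partial x^h}\big)y^jy^k$ be the spray coefficients, $G^i_j=\partial G^i/\partial y^j$, $\tfrac{\delta}{\delta x^j}=\tfrac{\partial}{\partial x^j}-G^r_j\tfrac{\partial}{\partial y^r}$, and let $\Gamma^{*i}_{jk}=\tfrac12 g^{ih}\big(\tfrac{\delta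 g_{hk}}{\delta x^j}+\tfrac{\delta g_{hj}}{\delta x^k}-\tfrac{\delta g_{jk}}{\delta x^h}\big)$ be the horizontal coefficients of the Cartan connection. Let $\rho:M\to\mathbb R$ be a non-constant $C^\infty$ function and $\varphi:M\to\mathbb R$ a function such that $\nabla^H\nabla^H\rho=\varphi g$, i.e. in local coordinates $$\frac{\partial^2\rho}{\partial x^k\partial x^l}(x)-\Gamma^{*j}_{lk}(x,y)\,\frac{\partial\rho}{\partial x^j}(x)=\varphi(x)\,g_{kl}(x,y)\qquad\text{for all }(x,y)\in TM_0 .$$ Let $o\in M$ be a critical point of $\rho$, i.e. $d\rho(o)=0$. Then: 1. $o$ is isolated in the set of critical points of $\rho$: some neighbourhood of $o$ contains no other critical point. 2. Every level set $C$ of $\rho$, i.e. every connected component of a regular hypersurface $\{p\in M:\rho(p)=c,\ d\rho(p)\neq0\}$, is a geodesic hypersphere centered at $o$: there is $r>0$ such that $C=\{q\in M: d(o,q)=r\}$, and $C$ is also the set of end points $\gamma(r)$ of all unit speed geodesics $\gamma:[0,r]\to M$ with $\gamma(0)=o$ (curves with $F(\gamma,\dot\gamma)=1$ and $\ddot\gamma^i+2G^i(\gamma,\dot\gamma)=0$).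 -/

import Mathlib

open Set Filter Topology
open scoped Manifold ContDiff

namespace Finsler

/-! ### Tensor calculus in local coordinates

Below `L u v` is a Finsler function in local coordinates: `u = (xⁱ)` is the position and
`v = (yⁱ)` the direction of the line element `(x, y)`. -/

/-- The partial derivative `∂f/∂uⁱ` at `u`. -/
noncomputable def partialDeriv {n : ℕ} (f : EuclideanSpace ℝ (Fin n) → ℝ) (i : Fin n)
    (u : EuclideanSpace ℝ (Fin n)) : ℝ :=
  fderiv ℝ f u (EuclideanSpace.single i 1)

/-- The Finsler metric tensor `g_{ij}(x, y) = ½ ∂²(L²)/∂yⁱ∂yʲ`. -/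
noncomputable def metricTensor {n : ℕ}
    (L : EuclideanSpace ℝ (Fin n) → EuclideanSpace ℝ (Fin n) → ℝ)
    (u v : EuclideanSpace ℝ (Fin n)) : Matrix (Fin n) (Fin n) ℝ :=
  Matrix.of fun i j => (1 / 2) * partialDeriv (partialDeriv (fun w => L u w ^ 2) j) i v

/-- The formal Christoffel symbols of the second kind
`γⁱ_{jk} = ½ g^{ih} (∂g_{hk}/∂xʲ + ∂g_{hj}/∂xᵏ - ∂g_{jk}/∂xʰ)`. -/
noncomputable def formalChristoffel {n : ℕ}
    (L : EuclideanSpace ℝ (Fin n) → EuclideanSpace ℝ (Fin n) → ℝ)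
    (i j k : Fin n) (u v : EuclideanSpace ℝ (Fin n)) : ℝ :=
  (1 / 2) * ∑ h, (metricTensor L u v)⁻¹ i h *
    (partialDeriv (fun x => metricTensor L x v h k) j u
      + partialDeriv (fun x => metricTensor L x v h j) k u
      - partialDeriv (fun x => metricTensor L x v j k) h u)

/-- The spray coefficients `Gⁱ(x, y) = ½ γⁱ_{jk} yʲ yᵏ`. -/
noncomputable def sprayCoeff {n : ℕ}
    (L : EuclideanSpace ℝ (Fin n) → EuclideanSpace ℝ (Fin n) → ℝ)
    (i : Fin n) (u v : EuclideanSpace ℝ (Fin n)) : ℝ :=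
  (1 / 2) * ∑ j, ∑ k, formalChristoffel L i j k u v * v j * v k

/-- The coefficients `Gⁱ_j = ∂Gⁱ/∂yʲ` of the (Cartan) non-linear connection. -/
noncomputable def nonlinearConnection {n : ℕ}
    (L : EuclideanSpace ℝ (Fin n) → EuclideanSpace ℝ (Fin n) → ℝ)
    (i j : Fin n) (u v : EuclideanSpace ℝ (Fin n)) : ℝ :=
  partialDeriv (fun w => sprayCoeff L i u w) j v

/-- The horizontal derivative `δf/δxʲ = ∂f/∂xʲ - Gʳ_j ∂f/∂yʳ` of a function `f(x, y)`. -/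
noncomputable def horizontalDeriv {n : ℕ}
    (L f : EuclideanSpace ℝ (Fin n) → EuclideanSpace ℝ (Fin n) → ℝ)
    (j : Fin n) (u v : EuclideanSpace ℝ (Fin n)) : ℝ :=
  partialDeriv (fun x => f x v) j u
    - ∑ r, nonlinearConnection L r j u v * partialDeriv (fun w => f u w) r v

/-- The horizontal coefficients of the Cartan connection,
`Γ*ⁱ_{jk} = ½ g^{ih} (δg_{hk}/δxʲ + δg_{hj}/δxᵏ - δg_{jk}/δxʰ)`. -/
noncomputable def cartanCoeff {n : ℕ}
    (L : EuclideanSpace ℝ (Fin n) → EuclideanSpace ℝ (Fin n) → ℝ)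
    (i j k : Fin n) (u v : EuclideanSpace ℝ (Fin n)) : ℝ :=
  (1 / 2) * ∑ h, (metricTensor L u v)⁻¹ i h *
    (horizontalDeriv L (fun x y => metricTensor L x y h k) j u v
      + horizontalDeriv L (fun x y => metricTensor L x y h j) k u v
      - horizontalDeriv L (fun x y => metricTensor L x y j k) h u v)

/-- The components `∇ᴴ_k ∇ᴴ_l f = ∂_k ∂_l f - Γ*ʲ_{lk} ∂_j f` of the second Cartan horizontal
covariant derivative of a function `f` of the position alone. -/
noncomputable def horizontalHessian {n : ℕ}
    (L : EuclideanSpace ℝ (Fin n) → EuclideanSpace ℝ (Fin n) → ℝ)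
    (f : EuclideanSpace ℝ (Fin n) → ℝ) (k l : Fin n) (u v : EuclideanSpace ℝ (Fin n)) : ℝ :=
  partialDeriv (partialDeriv f l) k u - ∑ j, cartanCoeff L j l k u v * partialDeriv f j u

/-! ### Finsler manifolds -/

/-- The expression of a function on the tangent bundle in the natural coordinates `(x, y)` of `TM`
induced by the chart of `M` around `x₀`. -/
noncomputable def inChart {n : ℕ} {M : Type*} [TopologicalSpace M]
    [ChartedSpace (EuclideanSpace ℝ (Fin n)) M]
    (F : TangentBundle (𝓡 n) M → ℝ) (x₀ : M) (u v : EuclideanSpace ℝ (Fin n)) : ℝ :=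
  F ⟨(chartAt (EuclideanSpace ℝ (Fin n)) x₀).symm u,
    mfderiv (𝓡 n) (𝓡 n) (chartAt (EuclideanSpace ℝ (Fin n)) x₀).symm u v⟩

/-- A Finsler structure on a smooth `n`-manifold (not assumed reversible: only positive
homogeneity is required). -/
structure FinslerStructure (n : ℕ) (M : Type*) [TopologicalSpace M]
    [ChartedSpace (EuclideanSpace ℝ (Fin n)) M] [IsManifold (𝓡 n) ∞ M] where
  /-- the Finsler function `F : TM → [0, ∞)` -/
  toFun : TangentBundle (𝓡 n) M → ℝ
  nonneg : ∀ p, 0 ≤ toFun p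
  /-- `F` is smooth on the slit tangent bundle -/
  smooth : ContMDiffOn (𝓡 n).tangent 𝓘(ℝ, ℝ) ∞ toFun {p | p.2 ≠ 0}
  homogeneous : ∀ (x : M) (y : TangentSpace (𝓡 n) x) (c : ℝ), 0 < c →
    toFun ⟨x, c • y⟩ = c * toFun ⟨x, y⟩
  /-- in every chart, `(g_{ij})` is positive definite off the zero section -/
  posDef : ∀ (x₀ : M), ∀ u ∈ (chartAt (EuclideanSpace ℝ (Fin n)) x₀).target,
    ∀ v : EuclideanSpace ℝ (Fin n), v ≠ 0 → (metricTensor (inChart toFun x₀) u v).PosDef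

/-- The velocity `(γ(t), γ'(t)) ∈ TM` of a curve. -/
noncomputable def velocity {n : ℕ} {M : Type*} [TopologicalSpace M]
    [ChartedSpace (EuclideanSpace ℝ (Fin n)) M] (γ : ℝ → M) (t : ℝ) : TangentBundle (𝓡 n) M :=
  ⟨γ t, mfderiv 𝓘(ℝ, ℝ) (𝓡 n) γ t (1 : ℝ)⟩

/-- `γ : [a, b] → M` is a piecewise `C^∞` curve: there are `a = τ₀ ≤ τ₁ ≤ ⋯ ≤ τ_N = b` such that
`γ` is `C^∞` on each closed interval `[τ_i, τ_{i+1}]`. -/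
def IsPiecewiseSmooth (n : ℕ) {M : Type*} [TopologicalSpace M]
    [ChartedSpace (EuclideanSpace ℝ (Fin n)) M] (γ : ℝ → M) (a b : ℝ) : Prop :=
  ∃ (N : ℕ) (τ : ℕ → ℝ), Monotone τ ∧ τ 0 = a ∧ τ N = b ∧
    ∀ i < N, ContMDiffOn 𝓘(ℝ, ℝ) (𝓡 n) ∞ γ (Icc (τ i) (τ (i + 1)))

/-- `p` is a critical point of `ρ`: the differential of `ρ` (equivalently, as `(g_{ij})` is
invertible, the gradient `g^{ij}(x, y) ∂_j ρ`) vanishes at `p`. -/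
def IsCriticalPoint (n : ℕ) {M : Type*} [TopologicalSpace M]
    [ChartedSpace (EuclideanSpace ℝ (Fin n)) M] (ρ : M → ℝ) (p : M) : Prop :=
  mfderiv (𝓡 n) 𝓘(ℝ, ℝ) ρ p = 0

/-- The regular hypersurface `ρ = c`: the points of `{ρ = c}` that are not critical. -/
def regularHypersurface (n : ℕ) {M : Type*} [TopologicalSpace M]
    [ChartedSpace (EuclideanSpace ℝ (Fin n)) M] (ρ : M → ℝ) (c : ℝ) : Set M :=
  {p | ρ p = c ∧ ¬ IsCriticalPoint n ρ p}

/-- A level set (`t`-level) of `ρ`: a connected component of a regular hypersurface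
`ρ = constant`. -/
def IsLevelSet (n : ℕ) {M : Type*} [TopologicalSpace M]
    [ChartedSpace (EuclideanSpace ℝ (Fin n)) M] (ρ : M → ℝ) (C : Set M) : Prop :=
  ∃ c : ℝ, ∃ p ∈ regularHypersurface n ρ c,
    C = connectedComponentIn (regularHypersurface n ρ c) p

namespace FinslerStructure

/-- `∇ᴴ∇ᴴρ = φ g`: in every chart and for every line element `(x, y)`, `y ≠ 0`,
`∇ᴴ_k ∇ᴴ_l ρ (x, y) = φ(x) g_{kl}(x, y)`. -/
def IsSolution {n : ℕ} {M : Type*} [TopologicalSpace M]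
    [ChartedSpace (EuclideanSpace ℝ (Fin n)) M] [IsManifold (𝓡 n) ∞ M]
    (F : FinslerStructure n M) (ρ φ : M → ℝ) : Prop :=
  ∀ (x₀ : M), ∀ u ∈ (chartAt (EuclideanSpace ℝ (Fin n)) x₀).target,
    ∀ v : EuclideanSpace ℝ (Fin n), v ≠ 0 → ∀ k l : Fin n,
      horizontalHessian (inChart F.toFun x₀)
          (fun x => ρ ((chartAt (EuclideanSpace ℝ (Fin n)) x₀).symm x)) k l u v
        = φ ((chartAt (EuclideanSpace ℝ (Fin n)) x₀).symm u)
          * metricTensor (inChart F.toFun x₀) u v k l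

/-- The length `∫_a^b F(γ, γ') dt`. -/
noncomputable def length {n : ℕ} {M : Type*} [TopologicalSpace M]
    [ChartedSpace (EuclideanSpace ℝ (Fin n)) M] [IsManifold (𝓡 n) ∞ M]
    (F : FinslerStructure n M) (γ : ℝ → M) (a b : ℝ) : ℝ :=
  ∫ t in a..b, F.toFun (velocity γ t)

/-- The (in general non-symmetric) distance `d(p, q)` from `p` to `q`: the infimum of the lengths of
piecewise `C^∞` curves from `p` to `q`. -/
noncomputable def dist {n : ℕ} {M : Type*} [TopologicalSpace M]
    [ChartedSpace (EuclideanSpace ℝ (Fin n)) M] [IsManifold (𝓡 n) ∞ M]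
    (F : FinslerStructure n M) (p q : M) : ℝ :=
  sInf {ℓ | ∃ (γ : ℝ → M) (a b : ℝ), IsPiecewiseSmooth n γ a b ∧ γ a = p ∧ γ b = q ∧
    ℓ = F.length γ a b}

/-- Completeness: every (forward) Cauchy sequence converges. -/
def IsComplete {n : ℕ} {M : Type*} [TopologicalSpace M]
    [ChartedSpace (EuclideanSpace ℝ (Fin n)) M] [IsManifold (𝓡 n) ∞ M]
    (F : FinslerStructure n M) : Prop :=
  ∀ x : ℕ → M, (∀ ε > 0, ∃ N, ∀ i ≥ N, ∀ j ≥ i, F.dist (x i) (x j) < ε) →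
    ∃ p, Tendsto x atTop (𝓝 p)

/-- `γ : [0, r] → M` is a geodesic parametrized by arc length: it is `C²`, `F(γ, γ') = 1`, and in
every chart `d²γⁱ/dt² + 2 Gⁱ(γ, γ') = 0`.  (The conditions at the two end points follow by
continuity.) -/
def IsUnitSpeedGeodesic {n : ℕ} {M : Type*} [TopologicalSpace M]
    [ChartedSpace (EuclideanSpace ℝ (Fin n)) M] [IsManifold (𝓡 n) ∞ M]
    (F : FinslerStructure n M) (γ : ℝ → M) (r : ℝ) : Prop :=
  ContMDiffOn 𝓘(ℝ, ℝ) (𝓡 n) 2 γ (Icc 0 r) ∧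
  ∀ t ∈ Ioo 0 r, F.toFun (velocity γ t) = 1 ∧
    ∀ x₀ : M, γ t ∈ (chartAt (EuclideanSpace ℝ (Fin n)) x₀).source →
      let c : ℝ → EuclideanSpace ℝ (Fin n) :=
        fun s => chartAt (EuclideanSpace ℝ (Fin n)) x₀ (γ s)
      ∀ i : Fin n, deriv (deriv c) t i + 2 * sprayCoeff (inChart F.toFun x₀) i (c t) (deriv c t) = 0

/-- The sphere `{q | d(o, q) = r}` of the Finsler distance. -/
def distanceSphere {n : ℕ} {M : Type*} [TopologicalSpace M]
    [ChartedSpace (EuclideanSpace ℝ (Fin n)) M] [IsManifold (𝓡 n) ∞ M]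
    (F : FinslerStructure n M) (o : M) (r : ℝ) : Set M :=
  {q | F.dist o q = r}

/-- The set of end points of the geodesics of length `r` issuing from `o`, that is
`exp_o {v | F(v) = r}`. -/
def exponentialSphere {n : ℕ} {M : Type*} [TopologicalSpace M]
    [ChartedSpace (EuclideanSpace ℝ (Fin n)) M] [IsManifold (𝓡 n) ∞ M]
    (F : FinslerStructure n M) (o : M) (r : ℝ) : Set M :=
  {q | ∃ γ : ℝ → M, F.IsUnitSpeedGeodesic γ r ∧ γ 0 = o ∧ γ r = q}

/-- `S` is the geodesic hypersphere with center `o` and radius `r`: it consists of the points at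
distance `r` from `o`, and these are the end points of the geodesics of length `r` from `o`. -/
def IsGeodesicHypersphere {n : ℕ} {M : Type*} [TopologicalSpace M]
    [ChartedSpace (EuclideanSpace ℝ (Fin n)) M] [IsManifold (𝓡 n) ∞ M]
    (F : FinslerStructure n M) (o : M) (r : ℝ) (S : Set M) : Prop :=
  S = F.distanceSphere o r ∧ S = F.exponentialSphere o r

end FinslerStructure

end Finsler

/-! Let ∇ρ be the Legendre dual of dρ and W = F(∇ρ)²/2. Contracting the equation with y = ∇ρ gives
dW = φ dρ (`hasFDerivAt_localEnergy`, extended to critical points by `hasFDerivAt_energy`). So W is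
locally a function of ρ near regular points, and the gradient lines, parametrized by arc length,
satisfy the Euler–Lagrange equations of F: they are geodesics (`geodesic_of_grad`).

Critical points. Read in a fixed direction y, the equation and its first derivatives express the
derivatives of dρ and, since n ≥ 2, also those of φ linearly in (dρ, φ). By Grönwall and
connectedness a common zero of dρ and φ would make ρ constant (`eventually_critical`,
`factor_ne_zero`). Hence φ(o) ≠ 0. At o the Hessian is φ g, which is definite, so o is an isolated
strict extremum. The equation is linear in (ρ, φ), so passing to (-ρ, -φ) one may assume φ(o) > 0.

Gradient lines. They are parametrized by the value of ρ. Near o the sublevel sets of ρ are compact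
and every line comes from o. A punctured ball around o is connected because n ≥ 2, so W takes the
same value at a given level on all lines from o, as long as they all reach that level. The length of
a line is ∫ dρ/√(2W). If one line passes a level, then W is bounded below up to that level, so every
other line has finite length up to there, converges by forward completeness, and its limit is again
regular. Thus all lines from o reach the same levels (`Well.reach_all`). The points they sweep out
form an open and closed subset of the regular set, which is connected because only isolated points
are missing. So every regular point lies on a line from o (`Well.exists_linked_core`), each level is
the continuous image of a punctured ball and hence connected, and W is globally a function of ρ on
the regular set (`Well.radialFlow`).

Distances. Put R(t) = ∫ ds/√(2W(s)) from ρ(o) to t, which is finite because W grows at least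
linearly above ρ(o). Since R∘ρ has a gradient of norm one, a curve from o to the level t has length
at least R(t) (`radius_le_length`), and a gradient line attains it (`exists_geodesic`). Conversely,
along a unit speed geodesic γ from o the function f = ρ∘γ satisfies f'' = φ∘γ, so 2W∘γ - f'² is
constant, and it vanishes at o. Hence R∘f has slope one and γ(R(c)) lies on the level c
(`level_geodesic`). The other critical points lie at or above all regular levels, so none of them is
at distance R(c) (`dist_ne_radius`). -/

namespace Finsler

/-! ### Partial derivatives of functions of a line element -/

theorem two_le_infty : (2 : WithTop ℕ∞) ≤ ∞ :=
  (mod_cast le_top : ((2 : ℕ∞) : WithTop ℕ∞) ≤ ((⊤ : ℕ∞) : WithTop ℕ∞))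

/-- The coordinate space `ℝⁿ`. -/
abbrev Coord (n : ℕ) : Type := EuclideanSpace ℝ (Fin n)

/-- The `i`-th vector of the standard basis. -/
noncomputable abbrev basisVec {n : ℕ} (i : Fin n) : Coord n := EuclideanSpace.single i 1

theorem sum_smul_basisVec {n : ℕ} (v : Coord n) : ∑ i, v i • (basisVec i : Coord n) = v := by
  simpa using (EuclideanSpace.basisFun (Fin n) ℝ).sum_repr v

theorem linearMap_apply_eq_sum {n : ℕ} {V : Type*} [AddCommGroup V] [Module ℝ V]
    [TopologicalSpace V] (A : Coord n →L[ℝ] V) (v : Coord n) :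
    A v = ∑ i, v i • A (basisVec i) := by
  conv_lhs => rw [← sum_smul_basisVec v]
  simp [map_sum]

theorem fderiv_apply_eq_sum {n : ℕ} (f : Coord n → ℝ) (u v : Coord n) :
    fderiv ℝ f u v = ∑ i, v i * partialDeriv f i u := by
  rw [linearMap_apply_eq_sum]; simp [partialDeriv]

theorem partialDeriv_congr {n : ℕ} {f g : Coord n → ℝ} {u : Coord n} (h : f =ᶠ[𝓝 u] g)
    (i : Fin n) : partialDeriv f i u = partialDeriv g i u := by
  simp [partialDeriv, h.fderiv_eq]

/-- `f(x, y)` is smooth for `x ∈ U` and `y ≠ 0`. -/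
def SmoothOnSlit {n : ℕ} (U : Set (Coord n)) (f : Coord n → Coord n → ℝ) : Prop :=
  ContDiffOn ℝ ∞ (fun p : Coord n × Coord n => f p.1 p.2) (U ×ˢ {0}ᶜ)

/-- The derivative `∂f/∂yⁱ`. -/
noncomputable def vDeriv {n : ℕ} (f : Coord n → Coord n → ℝ) (i : Fin n) (u v : Coord n) : ℝ :=
  partialDeriv (fun w => f u w) i v

theorem partialDeriv_of_hasFDerivAt {n : ℕ} {f : Coord n → ℝ} {u : Coord n} {A : Coord n →L[ℝ] ℝ}
    (h : HasFDerivAt f A u) (i : Fin n) : partialDeriv f i u = A (basisVec i) := by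
  rw [partialDeriv, h.fderiv]

/-- The derivative `∂f/∂xⁱ`. -/
noncomputable def xDeriv {n : ℕ} (f : Coord n → Coord n → ℝ) (i : Fin n) (u v : Coord n) : ℝ :=
  partialDeriv (fun x => f x v) i u

theorem isOpen_slit {n : ℕ} {U : Set (Coord n)} (hU : IsOpen U) :
    IsOpen (U ×ˢ ({0}ᶜ : Set (Coord n))) :=
  hU.prod isOpen_compl_singleton

namespace SmoothOnSlit

variable {n : ℕ} {U : Set (Coord n)} {f g : Coord n → Coord n → ℝ} {u v : Coord n}

theorem contDiffAt (hf : SmoothOnSlit U f) (hU : IsOpen U) (hu : u ∈ U) (hv : v ≠ 0) :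
    ContDiffAt ℝ ∞ (fun p : Coord n × Coord n => f p.1 p.2) (u, v) :=
  ContDiffOn.contDiffAt hf ((isOpen_slit hU).mem_nhds ⟨hu, hv⟩)

theorem hasFDerivAt (hf : SmoothOnSlit U f) (hU : IsOpen U) (hu : u ∈ U) (hv : v ≠ 0) :
    HasFDerivAt (fun p : Coord n × Coord n => f p.1 p.2)
      (fderiv ℝ (fun p : Coord n × Coord n => f p.1 p.2) (u, v)) (u, v) :=
  ((hf.contDiffAt hU hu hv).differentiableAt (by simp)).hasFDerivAt

theorem contDiffAt_right (hf : SmoothOnSlit U f) (hU : IsOpen U) (hu : u ∈ U) (hv : v ≠ 0) :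
    ContDiffAt ℝ ∞ (f u) v :=
  (hf.contDiffAt hU hu hv).comp v (by fun_prop : ContDiffAt ℝ ∞ (fun w => (u, w)) v)

theorem contDiffAt_left (hf : SmoothOnSlit U f) (hU : IsOpen U) (hu : u ∈ U) (hv : v ≠ 0) :
    ContDiffAt ℝ ∞ (fun x => f x v) u :=
  ContDiffAt.comp (f := fun x => (x, v)) u (hf.contDiffAt hU hu hv) (by fun_prop)

theorem hasFDerivAt_right (hf : SmoothOnSlit U f) (hU : IsOpen U) (hu : u ∈ U) (hv : v ≠ 0) :
    HasFDerivAt (f u) ((fderiv ℝ (fun p : Coord n × Coord n => f p.1 p.2) (u, v)).comp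
      (ContinuousLinearMap.inr ℝ _ _)) v :=
  (hf.hasFDerivAt hU hu hv).comp v (hasFDerivAt_prodMk_right u v)

theorem hasFDerivAt_left (hf : SmoothOnSlit U f) (hU : IsOpen U) (hu : u ∈ U) (hv : v ≠ 0) :
    HasFDerivAt (fun x => f x v) ((fderiv ℝ (fun p : Coord n × Coord n => f p.1 p.2) (u, v)).comp
      (ContinuousLinearMap.inl ℝ _ _)) u :=
  HasFDerivAt.comp (f := fun x => (x, v)) u (hf.hasFDerivAt hU hu hv)
    (hasFDerivAt_prodMk_left u v)

theorem vDeriv_eq (hf : SmoothOnSlit U f) (hU : IsOpen U) (hu : u ∈ U) (hv : v ≠ 0) (i : Fin n) :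
    vDeriv f i u v = fderiv ℝ (fun p : Coord n × Coord n => f p.1 p.2) (u, v) (0, basisVec i) := by
  unfold vDeriv partialDeriv
  rw [(hf.hasFDerivAt_right hU hu hv).fderiv]; simp

theorem xDeriv_eq (hf : SmoothOnSlit U f) (hU : IsOpen U) (hu : u ∈ U) (hv : v ≠ 0) (i : Fin n) :
    xDeriv f i u v = fderiv ℝ (fun p : Coord n × Coord n => f p.1 p.2) (u, v) (basisVec i, 0) := by
  unfold xDeriv partialDeriv
  rw [(hf.hasFDerivAt_left hU hu hv).fderiv]; simp

theorem fderiv_apply (hU : IsOpen U) (hf : SmoothOnSlit U f) (w : Coord n × Coord n) :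
    ContDiffOn ℝ ∞ (fun p => fderiv ℝ (fun p : Coord n × Coord n => f p.1 p.2) p w)
      (U ×ˢ {0}ᶜ) :=
  (ContDiffOn.fderiv_of_isOpen hf (isOpen_slit hU) (m := ∞) (by simp)).clm_apply contDiffOn_const

protected theorem vDeriv (hf : SmoothOnSlit U f) (hU : IsOpen U) (i : Fin n) :
    SmoothOnSlit U (vDeriv f i) :=
  (hf.fderiv_apply hU (0, basisVec i)).congr fun _ hp => hf.vDeriv_eq hU hp.1 hp.2 i

protected theorem xDeriv (hf : SmoothOnSlit U f) (hU : IsOpen U) (i : Fin n) :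
    SmoothOnSlit U (xDeriv f i) :=
  (hf.fderiv_apply hU (basisVec i, 0)).congr fun _ hp => hf.xDeriv_eq hU hp.1 hp.2 i

theorem fderiv_fderiv_comm (hf : SmoothOnSlit U f) (hU : IsOpen U) (hu : u ∈ U) (hv : v ≠ 0)
    (a b : Coord n × Coord n) :
    fderiv ℝ (fun p => fderiv ℝ (fun p : Coord n × Coord n => f p.1 p.2) p a) (u, v) b =
    fderiv ℝ (fun p => fderiv ℝ (fun p : Coord n × Coord n => f p.1 p.2) p b) (u, v) a := by
  have h := hf.contDiffAt hU hu hv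
  have hd : DifferentiableAt ℝ (fderiv ℝ (fun p : Coord n × Coord n => f p.1 p.2)) (u, v) :=
    (h.fderiv_right (m := 1) two_le_infty).differentiableAt (by simp)
  have hs : IsSymmSndFDerivAt ℝ (fun p : Coord n × Coord n => f p.1 p.2) (u, v) :=
    h.isSymmSndFDerivAt (by simpa using two_le_infty)
  have key : ∀ a b, fderiv ℝ (fun p => fderiv ℝ (fun p : Coord n × Coord n => f p.1 p.2) p a)
      (u, v) b = fderiv ℝ (fderiv ℝ (fun p : Coord n × Coord n => f p.1 p.2)) (u, v) b a := by
    intro a b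
    rw [(hd.hasFDerivAt.clm_apply (hasFDerivAt_const a _)).fderiv]; simp
  rw [key, key]; exact hs b a

theorem eventuallyEq_slit (hU : IsOpen U) (hu : u ∈ U) (hv : v ≠ 0)
    {F G : Coord n × Coord n → ℝ} (h : EqOn F G (U ×ˢ {0}ᶜ)) : F =ᶠ[𝓝 (u, v)] G :=
  h.eventuallyEq_of_mem ((isOpen_slit hU).mem_nhds ⟨hu, hv⟩)

theorem vDeriv_vDeriv_comm (hf : SmoothOnSlit U f) (hU : IsOpen U) (hu : u ∈ U) (hv : v ≠ 0)
    (i j : Fin n) : vDeriv (vDeriv f i) j u v = vDeriv (vDeriv f j) i u v := by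
  rw [(hf.vDeriv hU i).vDeriv_eq hU hu hv, (hf.vDeriv hU j).vDeriv_eq hU hu hv,
    (eventuallyEq_slit hU hu hv fun _ hp => hf.vDeriv_eq hU hp.1 hp.2 i).fderiv_eq,
    (eventuallyEq_slit hU hu hv fun _ hp => hf.vDeriv_eq hU hp.1 hp.2 j).fderiv_eq]
  exact hf.fderiv_fderiv_comm hU hu hv _ _

/-- The chain rule along a curve of line elements. -/
theorem hasDerivAt_comp (hf : SmoothOnSlit U f) (hU : IsOpen U) {x y : ℝ → Coord n}
    {x' y' : Coord n} {t : ℝ} (hx : HasDerivAt x x' t) (hy : HasDerivAt y y' t)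
    (hu : x t ∈ U) (hv : y t ≠ 0) :
    HasDerivAt (fun t => f (x t) (y t))
      ((∑ i, x' i * xDeriv f i (x t) (y t)) + ∑ i, y' i * vDeriv f i (x t) (y t)) t := by
  have h := (hf.hasFDerivAt hU hu hv).comp_hasDerivAt t (hx.prodMk hy)
  refine h.congr_deriv ?_
  have e : (x', y') = ContinuousLinearMap.inl ℝ (Coord n) (Coord n) x'
      + ContinuousLinearMap.inr ℝ (Coord n) (Coord n) y' := by simp
  rw [e, map_add]
  congr 1
  · rw [← ContinuousLinearMap.comp_apply, linearMap_apply_eq_sum]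
    exact Finset.sum_congr rfl fun i _ => by rw [hf.xDeriv_eq hU hu hv]; simp
  · rw [← ContinuousLinearMap.comp_apply, linearMap_apply_eq_sum]
    exact Finset.sum_congr rfl fun i _ => by rw [hf.vDeriv_eq hU hu hv]; simp

protected theorem const (c : ℝ) : SmoothOnSlit U (fun _ _ => c) := contDiffOn_const

protected theorem coord (i : Fin n) : SmoothOnSlit U (fun _ v => v i) := by
  have : ContDiff ℝ ∞ (fun p : Coord n × Coord n => p.2 i) := by fun_prop
  exact this.contDiffOn

protected theorem add (hf : SmoothOnSlit U f) (hg : SmoothOnSlit U g) :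
    SmoothOnSlit U (fun u v => f u v + g u v) := ContDiffOn.add hf hg

protected theorem sub (hf : SmoothOnSlit U f) (hg : SmoothOnSlit U g) :
    SmoothOnSlit U (fun u v => f u v - g u v) := ContDiffOn.sub hf hg

protected theorem mul (hf : SmoothOnSlit U f) (hg : SmoothOnSlit U g) :
    SmoothOnSlit U (fun u v => f u v * g u v) := ContDiffOn.mul hf hg

protected theorem sum {ι : Type*} {s : Finset ι} {f : ι → Coord n → Coord n → ℝ}
    (hf : ∀ i ∈ s, SmoothOnSlit U (f i)) : SmoothOnSlit U (fun u v => ∑ i ∈ s, f i u v) :=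
  ContDiffOn.sum hf

protected theorem det {A : Coord n → Coord n → Matrix (Fin n) (Fin n) ℝ}
    (hA : ∀ i j, SmoothOnSlit U (fun u v => A u v i j)) :
    SmoothOnSlit U (fun u v => (A u v).det) := by
  simp_rw [Matrix.det_apply']
  refine SmoothOnSlit.sum fun σ _ => (SmoothOnSlit.const _).mul ?_
  exact contDiffOn_prod fun i _ => hA (σ i) i

/-- Cramer's rule: each entry is a cofactor divided by the determinant, and a cofactor is again a
determinant of smooth entries. -/
protected theorem inv {A : Coord n → Coord n → Matrix (Fin n) (Fin n) ℝ}
    (hA : ∀ i j, SmoothOnSlit U (fun u v => A u v i j))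
    (hdet : ∀ u ∈ U, ∀ v, v ≠ 0 → (A u v).det ≠ 0) (i j : Fin n) :
    SmoothOnSlit U (fun u v => (A u v)⁻¹ i j) := by
  simp_rw [Matrix.inv_def, Matrix.smul_apply, Ring.inverse_eq_inv', smul_eq_mul,
    Matrix.adjugate_apply]
  refine SmoothOnSlit.mul (ContDiffOn.inv (SmoothOnSlit.det hA) fun p hp => hdet _ hp.1 _ hp.2) ?_
  refine SmoothOnSlit.det fun k l => ?_
  by_cases hk : k = j
  · subst hk; simpa using SmoothOnSlit.const _
  · simpa [Matrix.updateRow_ne hk] using hA k l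

end SmoothOnSlit

/-! ### Finsler functions in local coordinates -/

/-- `L` is a Finsler function in local coordinates, over the open set `U`. -/
structure LocalFinsler {n : ℕ} (U : Set (Coord n)) (L : Coord n → Coord n → ℝ) : Prop where
  isOpen : IsOpen U
  nonneg : ∀ u v, 0 ≤ L u v
  smooth : SmoothOnSlit U L
  homog : ∀ u v, ∀ c : ℝ, 0 < c → L u (c • v) = c * L u v
  posDef : ∀ u ∈ U, ∀ v : Coord n, v ≠ 0 → (metricTensor L u v).PosDef

theorem hasDerivAt_add_smul {n : ℕ} (v w : Coord n) (t : ℝ) :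
    HasDerivAt (fun t : ℝ => v + t • w) w t := by
  simpa using ((hasDerivAt_id t).smul_const w).const_add v

/-- Euler's identity, from differentiating `c ↦ f u (c • v)` at `c = 1`. -/
theorem sum_mul_vDeriv_of_homog {n : ℕ} {U : Set (Coord n)} {f : Coord n → Coord n → ℝ}
    (hU : IsOpen U) (hf : SmoothOnSlit U f) {u v : Coord n} (hu : u ∈ U) (hv : v ≠ 0) (k : ℕ)
    (hom : ∀ c : ℝ, 0 < c → f u (c • v) = c ^ k * f u v) :
    ∑ i, v i * vDeriv f i u v = k * f u v := by
  have h1 := hf.hasDerivAt_comp hU (hasDerivAt_const (1 : ℝ) u)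
    ((hasDerivAt_id (1 : ℝ)).smul_const v) hu (by simpa using hv)
  have h2 : HasDerivAt (fun t : ℝ => t ^ k * f u v) (k * f u v) 1 := by
    simpa using (hasDerivAt_pow k (1 : ℝ)).mul_const (f u v)
  have h3 : (fun t : ℝ => f u (id t • v)) =ᶠ[𝓝 1] fun t => t ^ k * f u v := by
    filter_upwards [lt_mem_nhds (zero_lt_one' ℝ)] with t ht using hom t ht
  simpa using (h1.congr_of_eventuallyEq h3.symm).unique h2

namespace LocalFinsler

variable {n : ℕ} {U : Set (Coord n)} {L : Coord n → Coord n → ℝ} {u v : Coord n}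

theorem smooth_sq (h : LocalFinsler U L) : SmoothOnSlit U (fun u v => L u v ^ 2) := by
  simpa [pow_two] using h.smooth.mul h.smooth

theorem metricTensor_apply (L : Coord n → Coord n → ℝ) (i j : Fin n) (u v : Coord n) :
    metricTensor L u v i j = 1 / 2 * vDeriv (vDeriv (fun u v => L u v ^ 2) j) i u v := rfl

theorem smooth_metricTensor (h : LocalFinsler U L) (i j : Fin n) :
    SmoothOnSlit U (fun u v => metricTensor L u v i j) :=
  (SmoothOnSlit.const (1 / 2)).mul ((h.smooth_sq.vDeriv h.isOpen j).vDeriv h.isOpen i)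

theorem metricTensor_symm (h : LocalFinsler U L) (hu : u ∈ U) (hv : v ≠ 0) (i j : Fin n) :
    metricTensor L u v i j = metricTensor L u v j i := by
  rw [metricTensor_apply, metricTensor_apply, h.smooth_sq.vDeriv_vDeriv_comm h.isOpen hu hv]

theorem det_ne_zero (h : LocalFinsler U L) (hu : u ∈ U) (hv : v ≠ 0) :
    (metricTensor L u v).det ≠ 0 := (h.posDef u hu v hv).det_pos.ne'

theorem smooth_inv (h : LocalFinsler U L) (i j : Fin n) :
    SmoothOnSlit U (fun u v => (metricTensor L u v)⁻¹ i j) :=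
  SmoothOnSlit.inv h.smooth_metricTensor (fun _ hu _ hv => h.det_ne_zero hu hv) i j

theorem smooth_formalChristoffel (h : LocalFinsler U L) (i j k : Fin n) :
    SmoothOnSlit U (formalChristoffel L i j k) :=
  (SmoothOnSlit.const (1 / 2)).mul (SmoothOnSlit.sum fun l _ => (h.smooth_inv i l).mul
    ((((h.smooth_metricTensor l k).xDeriv h.isOpen j).add
      ((h.smooth_metricTensor l j).xDeriv h.isOpen k)).sub
      ((h.smooth_metricTensor j k).xDeriv h.isOpen l)))

theorem smooth_sprayCoeff (h : LocalFinsler U L) (i : Fin n) : SmoothOnSlit U (sprayCoeff L i) :=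
  (SmoothOnSlit.const (1 / 2)).mul (SmoothOnSlit.sum fun j _ => SmoothOnSlit.sum fun k _ =>
    ((h.smooth_formalChristoffel i j k).mul (SmoothOnSlit.coord j)).mul (SmoothOnSlit.coord k))

theorem smooth_horizontalDeriv (h : LocalFinsler U L) {f : Coord n → Coord n → ℝ}
    (hf : SmoothOnSlit U f) (j : Fin n) : SmoothOnSlit U (horizontalDeriv L f j) :=
  (hf.xDeriv h.isOpen j).sub (SmoothOnSlit.sum fun r _ =>
    ((h.smooth_sprayCoeff r).vDeriv h.isOpen j).mul (hf.vDeriv h.isOpen r))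

theorem smooth_cartanCoeff (h : LocalFinsler U L) (i j k : Fin n) :
    SmoothOnSlit U (cartanCoeff L i j k) :=
  (SmoothOnSlit.const (1 / 2)).mul (SmoothOnSlit.sum fun l _ => (h.smooth_inv i l).mul
    (((h.smooth_horizontalDeriv (h.smooth_metricTensor l k) j).add
      (h.smooth_horizontalDeriv (h.smooth_metricTensor l j) k)).sub
      (h.smooth_horizontalDeriv (h.smooth_metricTensor j k) l)))

theorem sum_mul_vDeriv_sq (h : LocalFinsler U L) (hu : u ∈ U) (hv : v ≠ 0) :
    ∑ i, v i * vDeriv (fun u v => L u v ^ 2) i u v = 2 * L u v ^ 2 := by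
  simpa using sum_mul_vDeriv_of_homog h.isOpen h.smooth_sq hu hv 2
    fun c hc => by simp only [h.homog u v c hc]; ring

/-- Differentiate Euler's identity for L² with respect to yⁱ; one of the two copies of the first
derivative cancels. -/
theorem sum_metricTensor_mul (h : LocalFinsler U L) (hu : u ∈ U) (hv : v ≠ 0) (i : Fin n) :
    ∑ j, metricTensor L u v i j * v j = 1 / 2 * vDeriv (fun u v => L u v ^ 2) i u v := by
  set e : Coord n → Coord n → ℝ := fun u v => L u v ^ 2 with he
  have hs := h.smooth_sq
  have h1 : SmoothOnSlit U (fun u v => ∑ j, v j * vDeriv e j u v) :=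
    SmoothOnSlit.sum fun j _ => (SmoothOnSlit.coord j).mul (hs.vDeriv h.isOpen j)
  have e1 : vDeriv (fun u v => ∑ j, v j * vDeriv e j u v) i u v
      = vDeriv (fun u v => 2 * e u v) i u v := by
    refine partialDeriv_congr ?_ i
    filter_upwards [isOpen_compl_singleton.mem_nhds hv] with w hw
    exact h.sum_mul_vDeriv_sq hu hw
  have e2 : vDeriv (fun u v => 2 * e u v) i u v = 2 * vDeriv e i u v := by
    have := ((hs.contDiffAt_right h.isOpen hu hv).differentiableAt (by simp)).hasFDerivAt.const_mul 2
    exact (partialDeriv_of_hasFDerivAt this i).trans (by simp [vDeriv, partialDeriv, he])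
  have e3 : vDeriv (fun u v => ∑ j, v j * vDeriv e j u v) i u v
      = vDeriv e i u v + ∑ j, v j * vDeriv (vDeriv e j) i u v := by
    have hd : ∀ j : Fin n, HasFDerivAt (fun w : Coord n => w j * vDeriv e j u w)
        (v j • fderiv ℝ (vDeriv e j u) v + vDeriv e j u v • (EuclideanSpace.proj j)) v := by
      intro j
      have a := (EuclideanSpace.proj j : Coord n →L[ℝ] ℝ).hasFDerivAt (x := v)
      exact a.mul (((hs.vDeriv h.isOpen j).contDiffAt_right h.isOpen hu hv).differentiableAt
        (by simp)).hasFDerivAt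
    have := HasFDerivAt.fun_sum (u := Finset.univ) (fun j _ => hd j)
    refine (partialDeriv_of_hasFDerivAt this _).trans ?_
    simp only [_root_.sum_apply, _root_.add_apply,
      _root_.smul_apply, smul_eq_mul, Finset.sum_add_distrib]
    rw [add_comm]
    congr 1
    · rw [Finset.sum_eq_single i] <;> simp +contextual [eq_comm]
  have e4 : ∑ j, v j * vDeriv (vDeriv e j) i u v = vDeriv e i u v := by linarith
  rw [← e4, Finset.mul_sum]
  refine Finset.sum_congr rfl fun j _ => ?_
  rw [metricTensor_apply]; ring

theorem sum_sum_metricTensor (h : LocalFinsler U L) (hu : u ∈ U) (hv : v ≠ 0) :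
    ∑ i, ∑ j, metricTensor L u v i j * v i * v j = L u v ^ 2 := by
  have := h.sum_mul_vDeriv_sq hu hv
  calc _ = ∑ i, v i * ∑ j, metricTensor L u v i j * v j := by
        refine Finset.sum_congr rfl fun i _ => ?_
        rw [Finset.mul_sum]; exact Finset.sum_congr rfl fun j _ => by ring
    _ = 1 / 2 * ∑ i, v i * vDeriv (fun u v => L u v ^ 2) i u v := by
        rw [Finset.mul_sum]
        refine Finset.sum_congr rfl fun i _ => ?_
        rw [h.sum_metricTensor_mul hu hv]; ring
    _ = _ := by rw [this]; ring

theorem quadForm_pos (h : LocalFinsler U L) (hu : u ∈ U) (hv : v ≠ 0) {w : Coord n}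
    (hw : w ≠ 0) : 0 < ∑ i, ∑ j, metricTensor L u v i j * w i * w j := by
  have h1 := (h.posDef u hu v hv).dotProduct_mulVec_pos (x := w.ofLp) (by simpa using hw)
  refine h1.trans_eq ?_
  change ∑ i, star (w i) * ∑ j, metricTensor L u v i j * w j = _
  refine Finset.sum_congr rfl fun i _ => ?_
  rw [Finset.mul_sum]
  exact Finset.sum_congr rfl fun j _ => by simp; ring

theorem pos (h : LocalFinsler U L) (hu : u ∈ U) (hv : v ≠ 0) : 0 < L u v := by
  have h3 : 0 < L u v ^ 2 := by
    rw [← h.sum_sum_metricTensor hu hv]; exact h.quadForm_pos hu hv hv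
  exact lt_of_le_of_ne (h.nonneg u v) fun h0 => by simp [← h0] at h3

/-- `yˡ ∂g_{hl}/∂yʳ = 0`. -/
theorem sum_vDeriv_metricTensor_mul (h : LocalFinsler U L) (hu : u ∈ U) (hv : v ≠ 0)
    (i r : Fin n) : ∑ j, vDeriv (fun u v => metricTensor L u v i j) r u v * v j = 0 := by
  set e : Coord n → Coord n → ℝ := fun u v => L u v ^ 2 with he
  have e1 : vDeriv (fun u v => ∑ j, metricTensor L u v i j * v j) r u v
      = vDeriv (fun u v => 1 / 2 * vDeriv e i u v) r u v := by
    refine partialDeriv_congr ?_ r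
    filter_upwards [isOpen_compl_singleton.mem_nhds hv] with w hw
    exact h.sum_metricTensor_mul hu hw i
  have e2 : vDeriv (fun u v => 1 / 2 * vDeriv e i u v) r u v = metricTensor L u v r i := by
    have := (((h.smooth_sq.vDeriv h.isOpen i).contDiffAt_right h.isOpen hu hv).differentiableAt
      (by simp)).hasFDerivAt.const_mul (1 / 2)
    exact (partialDeriv_of_hasFDerivAt this r).trans rfl
  have e3 : vDeriv (fun u v => ∑ j, metricTensor L u v i j * v j) r u v
      = (∑ j, vDeriv (fun u v => metricTensor L u v i j) r u v * v j) + metricTensor L u v i r := by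
    have hd : ∀ j : Fin n, HasFDerivAt (fun w : Coord n => metricTensor L u w i j * w j)
        (metricTensor L u v i j • (EuclideanSpace.proj j)
          + v j • fderiv ℝ (fun w => metricTensor L u w i j) v) v := by
      intro j
      have a := (EuclideanSpace.proj j : Coord n →L[ℝ] ℝ).hasFDerivAt (x := v)
      exact (((h.smooth_metricTensor i j).contDiffAt_right h.isOpen hu hv).differentiableAt
        (by simp)).hasFDerivAt.mul a
    have := HasFDerivAt.fun_sum (u := Finset.univ) (fun j _ => hd j)
    refine (partialDeriv_of_hasFDerivAt this _).trans ?_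
    simp only [_root_.sum_apply, _root_.add_apply,
      _root_.smul_apply, smul_eq_mul, Finset.sum_add_distrib]
    rw [add_comm]
    congr 1
    · exact Finset.sum_congr rfl fun j _ => mul_comm _ _
    · rw [Finset.sum_eq_single r] <;> simp +contextual [eq_comm]
  rw [e1, e2, h.metricTensor_symm hu hv] at e3
  linarith

theorem xDeriv_const_mul_sum (hU : IsOpen U) (hu : u ∈ U) (hv : v ≠ 0) {ι : Type*} [Fintype ι]
    (c : ι → ℝ) (f : ι → Coord n → Coord n → ℝ) (hf : ∀ i, SmoothOnSlit U (f i)) (l : Fin n) :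
    xDeriv (fun u v => ∑ j, f j u v * c j) l u v = ∑ j, xDeriv (f j) l u v * c j := by
  have hd : ∀ j, HasFDerivAt (fun x : Coord n => f j x v * c j)
      (c j • fderiv ℝ (fun x => f j x v) u) u := fun j =>
    (((hf j).contDiffAt_left hU hu hv).differentiableAt (by simp)).hasFDerivAt.mul_const (c j)
  have := HasFDerivAt.fun_sum (u := Finset.univ) (fun j _ => hd j)
  refine (partialDeriv_of_hasFDerivAt this _).trans ?_
  simp only [_root_.sum_apply, _root_.smul_apply, smul_eq_mul]
  exact Finset.sum_congr rfl fun j _ => mul_comm _ _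

/-- The homogeneity identities hold at every position with `v` held fixed, so they may be
differentiated in x. -/
theorem sum_xDeriv_metricTensor_mul (h : LocalFinsler U L) (hu : u ∈ U) (hv : v ≠ 0)
    (i l : Fin n) : ∑ j, xDeriv (fun u v => metricTensor L u v i j) l u v * v j
      = 1 / 2 * xDeriv (vDeriv (fun u v => L u v ^ 2) i) l u v := by
  rw [← xDeriv_const_mul_sum h.isOpen hu hv (fun j => v j) _ (h.smooth_metricTensor i) l]
  have e1 : xDeriv (fun x _ => ∑ j, metricTensor L x v i j * v j) l u v
      = xDeriv (fun u v => 1 / 2 * vDeriv (fun u v => L u v ^ 2) i u v) l u v := by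
    refine partialDeriv_congr ?_ l
    filter_upwards [h.isOpen.mem_nhds hu] with x hx
    exact h.sum_metricTensor_mul hx hv i
  have e2 := (((h.smooth_sq.vDeriv h.isOpen i).contDiffAt_left h.isOpen hu hv).differentiableAt
      (by simp)).hasFDerivAt.const_mul (1 / 2)
  have e3 : xDeriv (fun u v => 1 / 2 * vDeriv (fun u v => L u v ^ 2) i u v) l u v
      = 1 / 2 * xDeriv (vDeriv (fun u v => L u v ^ 2) i) l u v := by
    exact (partialDeriv_of_hasFDerivAt e2 l).trans rfl
  rw [← e3, ← e1]; rfl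

theorem sum_sum_xDeriv_metricTensor (h : LocalFinsler U L) (hu : u ∈ U) (hv : v ≠ 0)
    (l : Fin n) : ∑ i, ∑ j, xDeriv (fun u v => metricTensor L u v i j) l u v * v i * v j
      = xDeriv (fun u v => L u v ^ 2) l u v := by
  have e1 : xDeriv (fun x _ => ∑ p : Fin n × Fin n, metricTensor L x v p.1 p.2 * (v p.1 * v p.2))
      l u v = xDeriv (fun u v => L u v ^ 2) l u v := by
    refine partialDeriv_congr ?_ l
    filter_upwards [h.isOpen.mem_nhds hu] with x hx
    rw [← h.sum_sum_metricTensor hx hv, Fintype.sum_prod_type]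
    exact Finset.sum_congr rfl fun i _ => Finset.sum_congr rfl fun j _ => by ring
  have e2 := xDeriv_const_mul_sum h.isOpen hu hv (fun p : Fin n × Fin n => v p.1 * v p.2) _
    (fun p => h.smooth_metricTensor p.1 p.2) l
  rw [← e1]
  refine Eq.trans ?_ e2.symm
  rw [Fintype.sum_prod_type]
  exact Finset.sum_congr rfl fun i _ => Finset.sum_congr rfl fun j _ => by ring

theorem inv_mul_metricTensor (h : LocalFinsler U L) (hu : u ∈ U) (hv : v ≠ 0) (a : Fin n → ℝ)
    (m : Fin n) : ∑ i, metricTensor L u v m i * ∑ k, (metricTensor L u v)⁻¹ i k * a k = a m := by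
  have h1 := Matrix.mul_nonsing_inv (metricTensor L u v) (isUnit_iff_ne_zero.2 (h.det_ne_zero hu hv))
  have h2 : (metricTensor L u v).mulVec ((metricTensor L u v)⁻¹.mulVec a) = a := by
    rw [Matrix.mulVec_mulVec, h1, Matrix.one_mulVec]
  exact congrFun h2 m

theorem inv_metricTensor_mul (h : LocalFinsler U L) (hu : u ∈ U) (hv : v ≠ 0) (a : Fin n → ℝ)
    (m : Fin n) : ∑ i, (metricTensor L u v)⁻¹ m i * ∑ k, metricTensor L u v i k * a k = a m := by
  have h1 := Matrix.nonsing_inv_mul (metricTensor L u v) (isUnit_iff_ne_zero.2 (h.det_ne_zero hu hv))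
  have h2 : (metricTensor L u v)⁻¹.mulVec ((metricTensor L u v).mulVec a) = a := by
    rw [Matrix.mulVec_mulVec, h1, Matrix.one_mulVec]
  exact congrFun h2 m

/-- `g_{hk|j} yᵏ` only involves the derivative in the position. -/
theorem sum_horizontalDeriv_mul (h : LocalFinsler U L) (hu : u ∈ U) (hv : v ≠ 0) (i j : Fin n) :
    ∑ k, horizontalDeriv L (fun x y => metricTensor L x y i k) j u v * v k
      = ∑ k, xDeriv (fun x y => metricTensor L x y i k) j u v * v k := by
  have e : ∀ k, horizontalDeriv L (fun x y => metricTensor L x y i k) j u v * v k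
      = xDeriv (fun x y => metricTensor L x y i k) j u v * v k
        - ∑ r, nonlinearConnection L r j u v
          * (vDeriv (fun x y => metricTensor L x y i k) r u v * v k) := by
    intro k
    change (xDeriv (fun x y => metricTensor L x y i k) j u v - ∑ r, nonlinearConnection L r j u v
      * vDeriv (fun x y => metricTensor L x y i k) r u v) * v k = _
    rw [sub_mul, Finset.sum_mul]
    congr 1
    exact Finset.sum_congr rfl fun r _ => by ring
  simp_rw [e, Finset.sum_sub_distrib]
  rw [Finset.sum_comm]
  simp_rw [← Finset.mul_sum, h.sum_vDeriv_metricTensor_mul hu hv]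
  simp

theorem horizontalDeriv_symm (h : LocalFinsler U L) (hu : u ∈ U) (hv : v ≠ 0) (i k j : Fin n) :
    horizontalDeriv L (fun x y => metricTensor L x y i k) j u v
      = horizontalDeriv L (fun x y => metricTensor L x y k i) j u v := by
  unfold horizontalDeriv
  congr 1
  · refine partialDeriv_congr ?_ j
    filter_upwards [h.isOpen.mem_nhds hu] with x hx using h.metricTensor_symm hx hv i k
  · refine Finset.sum_congr rfl fun r _ => ?_
    congr 1
    refine partialDeriv_congr ?_ r
    filter_upwards [isOpen_compl_singleton.mem_nhds hv] with w hw using h.metricTensor_symm hu hw i k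

/-- Contraction with the symmetric yʲyᵏ merges the first two Christoffel terms. The array `T` is
arbitrary so that the same computation serves for ∂g/∂x and for δg/δx. -/
theorem contract_christoffel (T : Fin n → Fin n → Fin n → ℝ) (v : Coord n) (l : Fin n) :
    ∑ j, ∑ k, (T l k j + T l j k - T j k l) * v j * v k
      = 2 * (∑ j, v j * ∑ k, T l k j * v k) - ∑ j, v j * ∑ k, T j k l * v k := by
  have e1 : ∑ j, ∑ k, (T l k j + T l j k - T j k l) * v j * v k
      = (∑ j, ∑ k, T l k j * v j * v k) + (∑ j, ∑ k, T l j k * v j * v k)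
        - ∑ j, ∑ k, T j k l * v j * v k := by
    simp_rw [← Finset.sum_add_distrib, ← Finset.sum_sub_distrib]
    exact Finset.sum_congr rfl fun j _ => Finset.sum_congr rfl fun k _ => by ring
  have e2 : ∑ j, ∑ k, T l j k * v j * v k = ∑ j, ∑ k, T l k j * v j * v k := by
    rw [Finset.sum_comm]
    exact Finset.sum_congr rfl fun j _ => Finset.sum_congr rfl fun k _ => by ring
  have e3 : ∀ S : Fin n → Fin n → ℝ, ∑ j, v j * ∑ k, S k j * v k = ∑ j, ∑ k, S k j * v j * v k := by
    intro S
    refine Finset.sum_congr rfl fun j _ => ?_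
    rw [Finset.mul_sum]; exact Finset.sum_congr rfl fun k _ => by ring
  rw [e1, e2, e3 (fun k j => T l k j), e3 (fun k j => T j k l)]; ring

/-- `Γ*ⁱ_{jk} yʲ yᵏ = 2 Gⁱ`. -/
theorem sum_sum_cartanCoeff (h : LocalFinsler U L) (hu : u ∈ U) (hv : v ≠ 0) (i : Fin n) :
    ∑ j, ∑ k, cartanCoeff L i j k u v * v j * v k = 2 * sprayCoeff L i u v := by
  -- In each term at least one index of g is contracted with y, and there δ/δx may be replaced by
  -- ∂/∂x: the vertical derivatives of g are annihilated by y.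
  have key : ∀ l : Fin n, ∑ j, ∑ k, (horizontalDeriv L (fun x y => metricTensor L x y l k) j u v
      + horizontalDeriv L (fun x y => metricTensor L x y l j) k u v
      - horizontalDeriv L (fun x y => metricTensor L x y j k) l u v) * v j * v k
      = ∑ j, ∑ k, (xDeriv (fun x y => metricTensor L x y l k) j u v
      + xDeriv (fun x y => metricTensor L x y l j) k u v
      - xDeriv (fun x y => metricTensor L x y j k) l u v) * v j * v k := by
    intro l
    rw [contract_christoffel (fun a b c => horizontalDeriv L (fun x y => metricTensor L x y a b) c u v),
      contract_christoffel (fun a b c => xDeriv (fun x y => metricTensor L x y a b) c u v)]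
    simp_rw [h.sum_horizontalDeriv_mul hu hv]
  have a2 : ∀ (T : Fin n → Fin n → Fin n → ℝ) (g : Fin n → ℝ),
      ∑ j, ∑ k, (1 / 2 * ∑ l, g l * T l j k) * v j * v k
        = 1 / 2 * ∑ l, g l * ∑ j, ∑ k, T l j k * v j * v k := by
    intro T g
    simp_rw [Finset.mul_sum, Finset.sum_mul]
    refine (Finset.sum_congr rfl fun j _ => Finset.sum_comm).trans ?_
    rw [Finset.sum_comm]
    refine Finset.sum_congr rfl fun l _ => ?_
    exact Finset.sum_congr rfl fun j _ => Finset.sum_congr rfl fun k _ => by ring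
  unfold sprayCoeff
  refine (a2 (fun l j k => horizontalDeriv L (fun x y => metricTensor L x y l k) j u v
      + horizontalDeriv L (fun x y => metricTensor L x y l j) k u v
      - horizontalDeriv L (fun x y => metricTensor L x y j k) l u v) _).trans ?_
  simp_rw [key]
  rw [← a2]
  simp only [xDeriv, formalChristoffel]
  ring

/-- `2 g_{ml} Gˡ = yᵏ ∂²e/∂xᵏ∂yᵐ / 2 - ∂e/∂xᵐ / 2`, where `e = L²`. -/
theorem sum_metricTensor_mul_sprayCoeff (h : LocalFinsler U L) (hu : u ∈ U) (hv : v ≠ 0)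
    (m : Fin n) : ∑ i, metricTensor L u v m i * (2 * sprayCoeff L i u v)
      = 1 / 2 * (∑ k, v k * xDeriv (vDeriv (fun u v => L u v ^ 2) m) k u v)
        - 1 / 2 * xDeriv (fun u v => L u v ^ 2) m u v := by
  set T : Fin n → Fin n → Fin n → ℝ := fun a b c => xDeriv (fun x y => metricTensor L x y a b) c u v
    with hT
  have e1 : ∀ i, 2 * sprayCoeff L i u v = ∑ l, (metricTensor L u v)⁻¹ i l *
      (1 / 2 * ∑ j, ∑ k, (T l k j + T l j k - T j k l) * v j * v k) := by
    intro i
    have : 2 * sprayCoeff L i u v = ∑ j, ∑ k, formalChristoffel L i j k u v * v j * v k := by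
      unfold sprayCoeff; ring
    rw [this]
    have : ∀ j k, formalChristoffel L i j k u v = 1 / 2 * ∑ l, (metricTensor L u v)⁻¹ i l *
      (T l k j + T l j k - T j k l) := fun j k => rfl
    simp_rw [this, Finset.mul_sum, Finset.sum_mul]
    refine (Finset.sum_congr rfl fun j _ => Finset.sum_comm).trans ?_
    rw [Finset.sum_comm]
    exact Finset.sum_congr rfl fun l _ => Finset.sum_congr rfl fun j _ =>
      Finset.sum_congr rfl fun k _ => by ring
  simp_rw [e1]
  rw [h.inv_mul_metricTensor hu hv
    (fun l => 1 / 2 * ∑ j, ∑ k, (T l k j + T l j k - T j k l) * v j * v k) m]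
  have e2 : ∀ j, ∑ k, T m k j * v k = 1 / 2 * xDeriv (vDeriv (fun u v => L u v ^ 2) m) j u v :=
    fun j => h.sum_xDeriv_metricTensor_mul hu hv m j
  have e3 : ∑ j, ∑ k, T j k m * v j * v k = xDeriv (fun u v => L u v ^ 2) m u v :=
    h.sum_sum_xDeriv_metricTensor hu hv m
  have e4 : ∑ j, v j * ∑ k, T j k m * v k = ∑ j, ∑ k, T j k m * v j * v k := by
    refine Finset.sum_congr rfl fun j _ => ?_
    rw [Finset.mul_sum]; exact Finset.sum_congr rfl fun k _ => by ring
  rw [contract_christoffel, e4, e3]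
  simp_rw [e2]
  have e5 : ∑ k, v k * (1 / 2 * xDeriv (vDeriv (fun u v => L u v ^ 2) m) k u v)
      = 1 / 2 * ∑ k, v k * xDeriv (vDeriv (fun u v => L u v ^ 2) m) k u v := by
    rw [Finset.mul_sum]; exact Finset.sum_congr rfl fun k _ => by ring
  rw [e5]; ring

/-- `Γ*ⁱ_{lk} yᵏ y_i = ∂e/∂xˡ / 2`, where `e = L²` and `y_i = g_{im} yᵐ`. -/
theorem sum_sum_cartanCoeff_mul (h : LocalFinsler U L) (hu : u ∈ U) (hv : v ≠ 0) (l : Fin n) :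
    ∑ k, (∑ i, cartanCoeff L i l k u v * (∑ m, metricTensor L u v i m * v m)) * v k
      = 1 / 2 * xDeriv (fun u v => L u v ^ 2) l u v := by
  set D : Fin n → Fin n → Fin n → ℝ :=
    fun a b c => horizontalDeriv L (fun x y => metricTensor L x y a b) c u v with hD
  have e1 : ∀ k, ∑ i, cartanCoeff L i l k u v * (∑ m, metricTensor L u v i m * v m)
      = ∑ m, v m * (1 / 2 * (D m k l + D m l k - D l k m)) := by
    intro k
    have : ∀ i, cartanCoeff L i l k u v = ∑ a, (metricTensor L u v)⁻¹ i a *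
        (1 / 2 * (D a k l + D a l k - D l k a)) := by
      intro i
      change 1 / 2 * ∑ a, (metricTensor L u v)⁻¹ i a * (D a k l + D a l k - D l k a) = _
      rw [Finset.mul_sum]; exact Finset.sum_congr rfl fun a _ => by ring
    simp_rw [this, Finset.mul_sum]
    rw [Finset.sum_comm]
    refine Finset.sum_congr rfl fun m _ => ?_
    rw [← h.inv_mul_metricTensor hu hv (fun a => 1 / 2 * (D a k l + D a l k - D l k a)) m,
      Finset.mul_sum]
    refine Finset.sum_congr rfl fun i _ => ?_
    rw [h.metricTensor_symm hu hv i m]; ring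
  simp_rw [e1]
  have e2 : ∑ k, (∑ m, v m * (1 / 2 * (D m k l + D m l k - D l k m))) * v k
      = 1 / 2 * ∑ m, v m * ∑ k, D m k l * v k := by
    -- Two of the three Christoffel terms cancel, since exchanging the summation indices turns one
    -- into the other by the symmetry of g.
    have sw : ∑ k, ∑ m, v m * v k * D m l k = ∑ k, ∑ m, v m * v k * D l k m := by
      rw [Finset.sum_comm]
      refine Finset.sum_congr rfl fun m _ => Finset.sum_congr rfl fun k _ => ?_
      rw [show D m l k = D l m k from h.horizontalDeriv_symm hu hv m l k]; ring
    have : ∑ k, (∑ m, v m * (1 / 2 * (D m k l + D m l k - D l k m))) * v k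
      = 1 / 2 * (∑ k, ∑ m, v m * v k * D m k l) + 1 / 2 * (∑ k, ∑ m, v m * v k * D m l k)
        - 1 / 2 * ∑ k, ∑ m, v m * v k * D l k m := by
      simp_rw [Finset.mul_sum, ← Finset.sum_add_distrib, ← Finset.sum_sub_distrib, Finset.sum_mul]
      exact Finset.sum_congr rfl fun j _ => Finset.sum_congr rfl fun k _ => by ring
    rw [this, sw, add_sub_cancel_right, Finset.sum_comm]
    congr 1
    refine Finset.sum_congr rfl fun m _ => ?_
    rw [Finset.mul_sum]; exact Finset.sum_congr rfl fun k _ => by ring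
  rw [e2]
  have e3 : ∀ m, ∑ k, D m k l * v k
      = ∑ k, xDeriv (fun x y => metricTensor L x y m k) l u v * v k :=
    fun m => h.sum_horizontalDeriv_mul hu hv m l
  simp_rw [e3]
  rw [← h.sum_sum_xDeriv_metricTensor hu hv l]
  congr 1
  refine Finset.sum_congr rfl fun m _ => ?_
  rw [Finset.mul_sum]; exact Finset.sum_congr rfl fun k _ => by ring

end LocalFinsler


/-! ### The Legendre transformation -/

/-- `y` is the Legendre dual (the gradient) of the covector `p` with respect to the norm `f`: it
maximizes `p - f² / 2`. -/
def IsGrad {V : Type*} (f p : V → ℝ) (y : V) : Prop :=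
  ∀ z, p z - f z ^ 2 / 2 ≤ p y - f y ^ 2 / 2

namespace LocalFinsler

variable {n : ℕ} {U : Set (Coord n)} {L : Coord n → Coord n → ℝ} {u v : Coord n}

theorem map_zero (h : LocalFinsler U L) (u : Coord n) : L u 0 = 0 := by
  have := h.homog u 0 2 two_pos
  rw [smul_zero] at this; linarith

theorem homog_norm (h : LocalFinsler U L) (hv : v ≠ 0) : L u v = ‖v‖ * L u (‖v‖⁻¹ • v) := by
  rw [← h.homog u _ _ (norm_pos_iff.2 hv), smul_smul, mul_inv_cancel₀ (norm_ne_zero_iff.2 hv),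
    one_smul]

/-- Locally uniformly, `L u` is equivalent to the Euclidean norm. -/
theorem exists_bounds (h : LocalFinsler U L) {u₀ : Coord n} (hu : u₀ ∈ U) :
    ∃ a C : ℝ, 0 < a ∧ 0 < C ∧ ∀ᶠ u in 𝓝 u₀, ∀ v, a * ‖v‖ ≤ L u v ∧ L u v ≤ C * ‖v‖ := by
  obtain ⟨r, hr, hrU⟩ := Metric.nhds_basis_closedBall.mem_iff.1 (h.isOpen.mem_nhds hu)
  set K : Set (Coord n × Coord n) := Metric.closedBall u₀ r ×ˢ Metric.sphere 0 1
  have hK : IsCompact K := (isCompact_closedBall _ _).prod (isCompact_sphere _ _)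
  have hsub : K ⊆ U ×ˢ {0}ᶜ := prod_mono hrU fun x hx => by
    rintro rfl; simp at hx
  have hc : ContinuousOn (fun p : Coord n × Coord n => L p.1 p.2) K :=
    (ContDiffOn.continuousOn h.smooth).mono hsub
  have hc' : ContinuousOn (fun p : Coord n × Coord n => (L p.1 p.2)⁻¹) K :=
    hc.inv₀ fun p hp => (h.pos (hsub hp).1 (hsub hp).2).ne'
  obtain ⟨C, hC⟩ := hK.bddAbove_image hc
  obtain ⟨A, hA⟩ := hK.bddAbove_image hc'
  refine ⟨(max A 1)⁻¹, max C 1, by positivity, by positivity, ?_⟩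
  filter_upwards [Metric.closedBall_mem_nhds u₀ hr] with u hu' v
  by_cases hv : v = 0
  · simp [hv, h.map_zero]
  have hm : (u, ‖v‖⁻¹ • v) ∈ K := by
    refine ⟨hu', ?_⟩
    simp [norm_smul, inv_mul_cancel₀ (norm_ne_zero_iff.2 hv)]
  have h1 : L u (‖v‖⁻¹ • v) ≤ C := hC (mem_image_of_mem _ hm)
  have h2 : (L u (‖v‖⁻¹ • v))⁻¹ ≤ A := hA (mem_image_of_mem _ hm)
  have h3 : 0 < L u (‖v‖⁻¹ • v) := h.pos (hsub hm).1 (hsub hm).2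
  rw [h.homog_norm hv]
  constructor
  · rw [mul_comm]
    refine mul_le_mul_of_nonneg_left ?_ (norm_nonneg v)
    rw [inv_le_comm₀ (by positivity) h3]
    exact h2.trans (le_max_left _ _)
  · rw [mul_comm]
    exact mul_le_mul_of_nonneg_right (h1.trans (le_max_left _ _)) (norm_nonneg v)

/-- Only the zero section needs an argument: there L is squeezed between 0 and C‖y‖, locally
uniformly in the position. -/
theorem continuousAt (h : LocalFinsler U L) (hu : u ∈ U) (v : Coord n) :
    ContinuousAt (fun p : Coord n × Coord n => L p.1 p.2) (u, v) := by
  by_cases hv : v = 0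
  · subst hv
    obtain ⟨a, C, ha, hC, hb⟩ := h.exists_bounds hu
    rw [ContinuousAt, h.map_zero]
    have h2 : Tendsto (fun p : Coord n × Coord n => C * ‖p.2‖) (𝓝 (u, 0)) (𝓝 0) := by
      have : Continuous fun p : Coord n × Coord n => C * ‖p.2‖ := by fun_prop
      simpa using this.tendsto (u, 0)
    refine tendsto_of_tendsto_of_tendsto_of_le_of_le' tendsto_const_nhds h2
      (Eventually.of_forall fun p => h.nonneg _ _) ?_
    have := (continuous_fst.tendsto (u, (0 : Coord n))).eventually hb
    filter_upwards [this] with p hp using (hp p.2).2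
  · exact (h.smooth.contDiffAt h.isOpen hu hv).continuousAt

theorem continuous_fiber (h : LocalFinsler U L) (hu : u ∈ U) : Continuous (L u) :=
  continuous_iff_continuousAt.2 fun v =>
    ContinuousAt.comp (f := fun w => (u, w)) (h.continuousAt hu v) (by fun_prop)

theorem lineDeriv_sq (h : LocalFinsler U L) (hu : u ∈ U) {y w : Coord n} {t : ℝ}
    (hne : y + t • w ≠ 0) : HasDerivAt (fun t : ℝ => L u (y + t • w) ^ 2)
      (∑ i, w i * vDeriv (fun u v => L u v ^ 2) i u (y + t • w)) t := by
  simpa using h.smooth_sq.hasDerivAt_comp h.isOpen (hasDerivAt_const t u)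
    (hasDerivAt_add_smul y w t) hu hne

/-- Strict convexity of `L²`. -/
theorem sq_lt_sq (h : LocalFinsler U L) (hu : u ∈ U) {y z : Coord n} (hy : y ≠ 0) (hz : z ≠ y) :
    L u y ^ 2 + ∑ i, (z - y) i * vDeriv (fun u v => L u v ^ 2) i u y < L u z ^ 2 := by
  set e : Coord n → Coord n → ℝ := fun u v => L u v ^ 2 with he
  obtain ⟨w, rfl⟩ : ∃ w, z = y + w := ⟨z - y, by abel⟩
  have hw : w ≠ 0 := by rintro rfl; simp at hz
  simp only [add_sub_cancel_left]
  -- L² is twice differentiable only off the origin, so the usual convexity argument along the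
  -- segment from `y` to `z` requires that the segment avoid 0.
  by_cases hseg : ∀ t ∈ Icc (0 : ℝ) 1, y + t • w ≠ 0
  · have d1 : ∀ t ∈ Icc (0 : ℝ) 1, HasDerivAt (fun t : ℝ => e u (y + t • w))
        (∑ i, w i * vDeriv e i u (y + t • w)) t := fun t ht => h.lineDeriv_sq hu (hseg t ht)
    have d2 : ∀ t ∈ Icc (0 : ℝ) 1, HasDerivAt (fun t : ℝ => ∑ i, w i * vDeriv e i u (y + t • w))
        (2 * ∑ i, ∑ j, metricTensor L u (y + t • w) i j * w i * w j) t := by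
      intro t ht
      have := HasDerivAt.fun_sum (u := Finset.univ) fun i _ =>
        (((h.smooth_sq.vDeriv h.isOpen i).hasDerivAt_comp h.isOpen (hasDerivAt_const t u)
          (hasDerivAt_add_smul y w t) hu (hseg t ht)).const_mul (w i))
      refine this.congr_deriv ?_
      rw [Finset.mul_sum]
      refine Finset.sum_congr rfl fun i _ => ?_
      simp only [PiLp.zero_apply, zero_mul, Finset.sum_const_zero, zero_add, Finset.mul_sum]
      refine Finset.sum_congr rfl fun j _ => ?_
      rw [h.metricTensor_symm hu (hseg t ht), metricTensor_apply]; ring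
    have hmono : StrictMonoOn (fun t : ℝ => ∑ i, w i * vDeriv e i u (y + t • w)) (Icc 0 1) := by
      refine strictMonoOn_of_deriv_pos (convex_Icc _ _)
        (fun t ht => (d2 t ht).continuousAt.continuousWithinAt) fun t ht => ?_
      rw [interior_Icc] at ht
      rw [(d2 t (Ioo_subset_Icc_self ht)).deriv]
      exact mul_pos two_pos (h.quadForm_pos hu (hseg t (Ioo_subset_Icc_self ht)) hw)
    obtain ⟨c, hc, hc'⟩ := exists_hasDerivAt_eq_slope (fun t : ℝ => e u (y + t • w)) _
      (zero_lt_one' ℝ) (fun t ht => (d1 t ht).continuousAt.continuousWithinAt)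
      (fun t ht => d1 t (Ioo_subset_Icc_self ht))
    have := hmono (left_mem_Icc.2 zero_le_one) (Ioo_subset_Icc_self hc) hc.1
    simp only [zero_smul, add_zero, one_smul, sub_zero, div_one] at this hc'
    change e u y + _ < e u (y + w)
    linarith
  -- If the segment meets 0, then `z - y` is a multiple `-t⁻¹ • y` with `0 < t ≤ 1`. By Euler's
  -- identity the left side equals `(1 - 2 / t) L(y)²`, which is negative.
  · push Not at hseg
    obtain ⟨t, ht, h0⟩ := hseg
    have ht0 : t ≠ 0 := by rintro rfl; simp at h0; exact hy h0
    have htp : 0 < t := lt_of_le_of_ne ht.1 ht0.symm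
    have hwy : w = (-t⁻¹) • y := by
      have : t • w = -y := by rw [eq_neg_iff_add_eq_zero, add_comm]; exact h0
      rw [neg_smul, ← smul_neg, ← this, smul_smul, inv_mul_cancel₀ ht0, one_smul]
    have hs : ∑ i, w i * vDeriv e i u y = -t⁻¹ * (2 * e u y) := by
      rw [← h.sum_mul_vDeriv_sq hu hy, Finset.mul_sum]
      refine Finset.sum_congr rfl fun i _ => ?_
      rw [hwy]; simp; ring
    have h1 : 1 ≤ t⁻¹ := (one_le_inv₀ htp).2 ht.2
    have h2 : 0 < e u y := pow_pos (h.pos hu hy) 2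
    have h3 : 0 ≤ L u (y + w) ^ 2 := sq_nonneg _
    change e u y + _ < _
    rw [hs]; nlinarith

section Grad

variable {p : Coord n →L[ℝ] ℝ} {y z : Coord n}

/-- By strict convexity the graph of L²/2 lies above its tangent hyperplane at `y`, whose slope is
`p`. -/
theorem isGrad_lt (h : LocalFinsler U L) (hu : u ∈ U) (hy : y ≠ 0)
    (hd : ∀ i, 1 / 2 * vDeriv (fun u v => L u v ^ 2) i u y = p (basisVec i)) (hz : z ≠ y) :
    p z - L u z ^ 2 / 2 < p y - L u y ^ 2 / 2 := by
  have h1 := h.sq_lt_sq hu hy hz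
  have h2 : ∑ i, (z - y) i * vDeriv (fun u v => L u v ^ 2) i u y = 2 * (p z - p y) := by
    rw [← map_sub, linearMap_apply_eq_sum p, Finset.mul_sum]
    refine Finset.sum_congr rfl fun i _ => ?_
    rw [← hd]; simp; ring
  linarith

theorem isGrad_of_vDeriv (h : LocalFinsler U L) (hu : u ∈ U) (hy : y ≠ 0)
    (hd : ∀ i, 1 / 2 * vDeriv (fun u v => L u v ^ 2) i u y = p (basisVec i)) :
    IsGrad (L u) p y := fun z => by
  by_cases hz : z = y
  · rw [hz]
  · exact (h.isGrad_lt hu hy hd hz).le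

/-- The first order condition at the maximum, available only where L² is known to be smooth. -/
theorem _root_.Finsler.IsGrad.vDeriv_eq (hg : IsGrad (L u) p y) (h : LocalFinsler U L) (hu : u ∈ U)
    (hy : y ≠ 0) (i : Fin n) :
    1 / 2 * vDeriv (fun u v => L u v ^ 2) i u y = p (basisVec i) := by
  have h1 : HasDerivAt (fun t : ℝ => p (y + t • basisVec i) - L u (y + t • basisVec i) ^ 2 / 2)
      (p (basisVec i) - vDeriv (fun u v => L u v ^ 2) i u y / 2) 0 := by
    have a := (p.hasFDerivAt.comp_hasDerivAt (0 : ℝ) (hasDerivAt_add_smul y (basisVec i) 0))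
    have b := (h.lineDeriv_sq hu (y := y) (w := basisVec i) (t := 0) (by simpa using hy)).div_const 2
    refine (a.sub b).congr_deriv ?_
    congr 2
    rw [Finset.sum_eq_single i] <;> simp +contextual [eq_comm]
  have h2 : IsLocalMax (fun t : ℝ => p (y + t • basisVec i) - L u (y + t • basisVec i) ^ 2 / 2) 0 :=
    Eventually.of_forall fun t => by simpa using hg (y + t • basisVec i)
  have := h2.hasDerivAt_eq_zero h1
  linarith

/-- Near the origin a nonzero linear form beats the quadratic L², so 0 cannot maximize `p - L²/2`
unless `p` vanishes. This replaces the first order condition at the origin. -/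
theorem _root_.Finsler.IsGrad.eq_zero (hg : IsGrad (L u) p 0) (h : LocalFinsler U L)
    (z : Coord n) : p z = 0 := by
  have key : ∀ z, p z ≤ 0 := by
    intro z
    by_contra hz
    push Not at hz
    have h0 : ∀ c : ℝ, 0 < c → p z ≤ c * (L u z ^ 2 / 2) := by
      intro c hc
      have := hg (c • z)
      rw [h.homog u z c hc, h.map_zero, map_smul, smul_eq_mul, _root_.map_zero] at this
      have : c * p z ≤ c * (c * (L u z ^ 2 / 2)) := by nlinarith
      exact le_of_mul_le_mul_left this hc
    have h1 : 0 ≤ L u z ^ 2 / 2 := by positivity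
    -- The scale is chosen so that the quadratic term is at most half of `p z`; adding 1 keeps the
    -- denominator positive.
    have := h0 (p z / (2 * (L u z ^ 2 / 2 + 1))) (by positivity)
    rw [div_mul_eq_mul_div, le_div_iff₀ (by positivity)] at this
    nlinarith
  have := key (-z)
  rw [map_neg] at this
  linarith [key z]

theorem _root_.Finsler.IsGrad.apply_self (hg : IsGrad (L u) p y) (h : LocalFinsler U L)
    (hu : u ∈ U) : p y = L u y ^ 2 := by
  by_cases hy : y = 0
  · rw [hy, h.map_zero]; simp
  · rw [linearMap_apply_eq_sum p]
    simp_rw [← hg.vDeriv_eq h hu hy]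
    have := h.sum_mul_vDeriv_sq hu hy
    calc _ = 1 / 2 * ∑ i, y i * Finsler.vDeriv (fun u v => L u v ^ 2) i u y := by
          rw [Finset.mul_sum]; exact Finset.sum_congr rfl fun i _ => by simp; ring
      _ = _ := by rw [this]; ring

theorem isGrad_unique (h : LocalFinsler U L) (hu : u ∈ U) (hy : IsGrad (L u) p y)
    (hz : IsGrad (L u) p z) : z = y := by
  by_cases h0 : y = 0
  · subst h0
    by_contra hz0
    have h1 := hz.apply_self h hu
    rw [hy.eq_zero h z] at h1
    exact (pow_pos (h.pos hu hz0) 2).ne h1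
  · by_contra hne
    exact (h.isGrad_lt hu h0 (hy.vDeriv_eq h hu h0) hne).not_ge (hz y)

theorem exists_isGrad (h : LocalFinsler U L) (hu : u ∈ U) (p : Coord n →L[ℝ] ℝ) :
    ∃ y, IsGrad (L u) p y := by
  obtain ⟨a, C, ha, hC, hb⟩ := h.exists_bounds hu
  have hb := hb.self_of_nhds
  have hcont : Continuous fun z => p z - L u z ^ 2 / 2 := by
    have := h.continuous_fiber hu
    fun_prop
  -- Outside this ball the bound `a * ‖z‖ ≤ L u z` makes `p - L²/2` negative, hence smaller than its
  -- value 0 at the origin. A maximum over the ball is therefore global.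
  obtain ⟨y, hy, hmax⟩ := (isCompact_closedBall (0 : Coord n) (2 * ‖p‖ / a ^ 2)).exists_isMaxOn
    ⟨0, by simp; positivity⟩ hcont.continuousOn
  refine ⟨y, fun z => ?_⟩
  by_cases hz : z ∈ Metric.closedBall (0 : Coord n) (2 * ‖p‖ / a ^ 2)
  · exact hmax hz
  · have h0 : p 0 - L u 0 ^ 2 / 2 ≤ p y - L u y ^ 2 / 2 :=
      hmax (Metric.mem_closedBall_self (by positivity))
    rw [h.map_zero, _root_.map_zero] at h0
    rw [mem_closedBall_zero_iff, not_le, div_lt_iff₀ (by positivity)] at hz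
    have h1 : p z ≤ ‖p‖ * ‖z‖ := (le_abs_self _).trans (p.le_opNorm z)
    have h2 : (a * ‖z‖) ^ 2 ≤ L u z ^ 2 := pow_le_pow_left₀ (by positivity) (hb z).1 2
    have h3 : 0 ≤ ‖z‖ := norm_nonneg z
    nlinarith

/-- The Cauchy–Schwarz inequality for the dual norm. The maximality of `y` is tested at the point of
the ray through `z` where `p - L²/2` is largest. -/
theorem _root_.Finsler.IsGrad.le (hg : IsGrad (L u) p y) (h : LocalFinsler U L) (hu : u ∈ U)
    (z : Coord n) : p z ≤ L u y * L u z := by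
  rcases le_or_gt (p z) 0 with hp | hp
  · exact hp.trans (mul_nonneg (h.nonneg _ _) (h.nonneg _ _))
  have hz : z ≠ 0 := by rintro rfl; simp at hp
  have hL := h.pos hu hz
  have h1 := hg ((p z / L u z ^ 2) • z)
  rw [h.homog u z _ (by positivity), map_smul, smul_eq_mul, hg.apply_self h hu] at h1
  have h2 : p z / L u z ^ 2 * p z - (p z / L u z ^ 2 * L u z) ^ 2 / 2 = (p z / L u z) ^ 2 / 2 := by
    field_simp; ring
  rw [h2] at h1
  have h3 : p z / L u z ≤ L u y := abs_le_of_sq_le_sq' (by linarith) (h.nonneg u y) |>.2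
  rwa [div_le_iff₀ hL] at h3

end Grad

/-- The gradient of `ρ` at `u`. -/
noncomputable def _root_.Finsler.localGrad {n : ℕ} (L : Coord n → Coord n → ℝ) (ρ : Coord n → ℝ)
    (u : Coord n) : Coord n := Classical.epsilon (IsGrad (L u) (fderiv ℝ ρ u))

theorem isGrad_localGrad (h : LocalFinsler U L) (hu : u ∈ U) (ρ : Coord n → ℝ) :
    IsGrad (L u) (fderiv ℝ ρ u) (localGrad L ρ u) :=
  Classical.epsilon_spec (h.exists_isGrad hu _)

theorem localGrad_ne_zero (h : LocalFinsler U L) (hu : u ∈ U) {ρ : Coord n → ℝ}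
    (hρ : fderiv ℝ ρ u ≠ 0) : localGrad L ρ u ≠ 0 := by
  intro h0
  have := h.isGrad_localGrad hu ρ
  rw [h0] at this
  exact hρ (ContinuousLinearMap.ext fun z => this.eq_zero h z)

/-- The Legendre map (x, y) ↦ (x, ½ ∂L²/∂y) has an invertible differential because g is positive
definite. By the inverse function theorem it has a smooth local inverse, and by uniqueness of the
Legendre dual that inverse, applied to (x, dρ(x)), yields the gradient. -/
theorem contDiffAt_localGrad (h : LocalFinsler U L) (hu : u ∈ U) {ρ : Coord n → ℝ}
    (hρs : ContDiffOn ℝ ∞ ρ U) (hρ : fderiv ℝ ρ u ≠ 0) : ContDiffAt ℝ ∞ (localGrad L ρ) u := by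
  set e : Coord n → Coord n → ℝ := fun u v => L u v ^ 2 with he
  set y₀ := localGrad L ρ u with hy₀
  have hy0 : y₀ ≠ 0 := h.localGrad_ne_zero hu hρ
  set A : Coord n × Coord n → Coord n :=
    fun q => WithLp.toLp 2 fun i => 1 / 2 * vDeriv e i q.1 q.2 with hA
  set Θ : Coord n × Coord n → Coord n × Coord n := fun q => (q.1, A q) with hΘ
  have hAs : ContDiffAt ℝ ∞ A (u, y₀) := by
    rw [contDiffAt_euclidean]
    intro i
    exact contDiffAt_const.mul ((h.smooth_sq.vDeriv h.isOpen i).contDiffAt h.isOpen hu hy0)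
  have hΘs : ContDiffAt ℝ ∞ Θ (u, y₀) := contDiffAt_fst.prodMk hAs
  set D := fderiv ℝ Θ (u, y₀) with hD
  have hΘd : HasFDerivAt Θ D (u, y₀) := (hΘs.differentiableAt (by simp)).hasFDerivAt
  have hAd : HasFDerivAt A (fderiv ℝ A (u, y₀)) (u, y₀) :=
    (hAs.differentiableAt (by simp)).hasFDerivAt
  have hD' : D = (ContinuousLinearMap.fst ℝ _ _).prod (fderiv ℝ A (u, y₀)) :=
    hΘd.unique (hasFDerivAt_fst.prodMk hAd)
  -- A vector of the kernel has the form (0, b) with g b = 0, so positive definiteness forces b = 0.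
  have hinj : Function.Injective (D : Coord n × Coord n →ₗ[ℝ] Coord n × Coord n) := by
    rw [← LinearMap.ker_eq_bot, LinearMap.ker_eq_bot']
    rintro ⟨a, b⟩ hab
    have hab' : D (a, b) = 0 := hab
    rw [hD', ContinuousLinearMap.prod_apply] at hab'
    have ha : a = 0 := congrArg Prod.fst hab'
    subst ha
    have hb : fderiv ℝ A (u, y₀) (0, b) = 0 := congrArg Prod.snd hab'
    by_contra hne
    have hb0 : b ≠ 0 := by rintro rfl; exact hne rfl
    have hc := hAd.comp_hasDerivAt_of_eq (0 : ℝ)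
      ((hasDerivAt_const (0 : ℝ) u).prodMk (hasDerivAt_add_smul y₀ b 0)) (by simp)
    rw [hb] at hc
    have h1 : ∀ i, ∑ j, metricTensor L u y₀ i j * b j = 0 := by
      intro i
      have c1 := ((EuclideanSpace.proj i : Coord n →L[ℝ] ℝ).hasFDerivAt.comp_hasDerivAt (0 : ℝ) hc)
      have c2 := ((h.smooth_sq.vDeriv h.isOpen i).hasDerivAt_comp h.isOpen
        (hasDerivAt_const (0 : ℝ) u) (hasDerivAt_add_smul y₀ b 0) hu
        (by simpa using hy0)).const_mul (1 / 2)
      have := c1.unique c2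
      simp only [_root_.map_zero, PiLp.zero_apply, zero_mul, Finset.sum_const_zero, zero_add,
        zero_smul, add_zero, Finset.mul_sum] at this
      rw [this]
      refine Finset.sum_congr rfl fun j _ => ?_
      rw [h.metricTensor_symm hu hy0, metricTensor_apply]; ring
    have h2 := h.quadForm_pos hu hy0 hb0
    refine h2.ne' (Finset.sum_eq_zero fun i _ => ?_)
    rw [← mul_zero (b i), ← h1 i, Finset.mul_sum]
    exact Finset.sum_congr rfl fun j _ => by ring
  let D' : (Coord n × Coord n) ≃L[ℝ] (Coord n × Coord n) :=
    (LinearEquiv.ofInjectiveEndo _ hinj).toContinuousLinearEquiv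
  have hDD : (D' : (Coord n × Coord n) →L[ℝ] (Coord n × Coord n)) = D := by
    ext x <;> rfl
  have hΘd' : HasFDerivAt Θ (D' : (Coord n × Coord n) →L[ℝ] (Coord n × Coord n)) (u, y₀) := by
    rw [hDD]; exact hΘd
  set H := hΘs.toOpenPartialHomeomorph Θ hΘd' (by simp) with hH
  have hHs : ContDiffAt ℝ ∞ H.symm (Θ (u, y₀)) := hΘs.to_localInverse hΘd' (by simp)
  set dρ : Coord n → Coord n := fun x => WithLp.toLp 2 fun i => partialDeriv ρ i x with hdρ
  have hdρs : ContDiffAt ℝ ∞ dρ u := by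
    rw [contDiffAt_euclidean]
    intro i
    exact ((hρs.contDiffAt (h.isOpen.mem_nhds hu)).fderiv_right (m := ∞) (by simp)).clm_apply
      contDiffAt_const
  have hg0 := h.isGrad_localGrad hu ρ
  have hΘ0 : Θ (u, y₀) = (u, dρ u) := by
    refine Prod.ext rfl ?_
    ext i
    exact hg0.vDeriv_eq h hu hy0 i
  set Y : Coord n → Coord n := fun x => (H.symm (x, dρ x)).2 with hY
  have hYs : ContDiffAt ℝ ∞ (fun x => H.symm (x, dρ x)) u := by
    rw [hΘ0] at hHs
    exact ContDiffAt.comp (f := fun x => (x, dρ x)) u hHs (contDiffAt_id.prodMk hdρs)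
  have hYs' : ContDiffAt ℝ ∞ Y u := contDiffAt_snd.comp u hYs
  refine hYs'.congr_of_eventuallyEq ?_
  have hsrc : (u, y₀) ∈ H.source := hΘs.mem_toOpenPartialHomeomorph_source hΘd' (by simp)
  have htgt : (u, dρ u) ∈ H.target := by rw [← hΘ0]; exact H.map_source hsrc
  have hYu : H.symm (u, dρ u) = (u, y₀) := by rw [← hΘ0]; exact H.left_inv hsrc
  have e1 : ∀ᶠ x in 𝓝 u, (x, dρ x) ∈ H.target :=
    (continuousAt_id.prodMk hdρs.continuousAt).eventually (H.open_target.mem_nhds htgt)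
  have e2 : ∀ᶠ x in 𝓝 u, Y x ≠ 0 := hYs'.continuousAt.eventually_ne (by
    simp only [hY, hYu]; exact hy0)
  filter_upwards [e1, e2, h.isOpen.mem_nhds hu] with x hx1 hx2 hxU
  have h3 : Θ (H.symm (x, dρ x)) = (x, dρ x) := H.right_inv hx1
  have h4 : (H.symm (x, dρ x)).1 = x := congrArg Prod.fst h3
  have h5 : A (H.symm (x, dρ x)) = dρ x := congrArg Prod.snd h3
  refine h.isGrad_unique hxU ?_ (h.isGrad_localGrad hxU ρ)
  refine h.isGrad_of_vDeriv hxU hx2 fun i => ?_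
  have := congrArg (fun w : Coord n => w i) h5
  simp only [hA, h4] at this
  exact this

end LocalFinsler


/-! ### The equation `∇ᴴ∇ᴴρ = φ g` in local coordinates -/

section PartialDeriv

variable {n : ℕ} {U : Set (Coord n)} {f : Coord n → ℝ} {u : Coord n}

theorem contDiffOn_partialDeriv (hU : IsOpen U) (hf : ContDiffOn ℝ ∞ f U) (i : Fin n) :
    ContDiffOn ℝ ∞ (partialDeriv f i) U :=
  (hf.fderiv_of_isOpen hU (m := ∞) (by simp)).clm_apply contDiffOn_const

theorem ContDiffOn.hasFDerivAt_of_isOpen (hU : IsOpen U) (hf : ContDiffOn ℝ ∞ f U) (hu : u ∈ U) :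
    HasFDerivAt f (fderiv ℝ f u) u :=
  ((hf.contDiffAt (hU.mem_nhds hu)).differentiableAt (by simp)).hasFDerivAt

theorem partialDeriv_comm (hU : IsOpen U) (hf : ContDiffOn ℝ ∞ f U) (hu : u ∈ U) (i j : Fin n) :
    partialDeriv (partialDeriv f i) j u = partialDeriv (partialDeriv f j) i u := by
  have h := hf.contDiffAt (hU.mem_nhds hu)
  have hd : DifferentiableAt ℝ (fderiv ℝ f) u :=
    (h.fderiv_right (m := 1) two_le_infty).differentiableAt (by simp)
  have hs : IsSymmSndFDerivAt ℝ f u := h.isSymmSndFDerivAt (by simpa using two_le_infty)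
  have key : ∀ i j, partialDeriv (partialDeriv f i) j u
      = fderiv ℝ (fderiv ℝ f) u (basisVec j) (basisVec i) := by
    intro i j
    refine (partialDeriv_of_hasFDerivAt (hd.hasFDerivAt.clm_apply
      (hasFDerivAt_const (basisVec i) u)) j).trans ?_
    simp
  rw [key, key]; exact hs _ _

theorem hasDerivAt_comp_curve (hU : IsOpen U) (hf : ContDiffOn ℝ ∞ f U) {x : ℝ → Coord n}
    {x' : Coord n} {t : ℝ} (hx : HasDerivAt x x' t) (hu : x t ∈ U) :
    HasDerivAt (fun t => f (x t)) (∑ i, x' i * partialDeriv f i (x t)) t := by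
  rw [← fderiv_apply_eq_sum]
  exact (ContDiffOn.hasFDerivAt_of_isOpen hU hf hu).comp_hasDerivAt t hx

end PartialDeriv

/-- `∇ᴴ∇ᴴρ = φ g` in local coordinates, over the open set `U`. -/
structure LocalSolution {n : ℕ} (U : Set (Coord n)) (L : Coord n → Coord n → ℝ)
    (ρ φ : Coord n → ℝ) : Prop where
  finsler : LocalFinsler U L
  smooth : ContDiffOn ℝ ∞ ρ U
  eq : ∀ u ∈ U, ∀ v : Coord n, v ≠ 0 → ∀ k l : Fin n,
    horizontalHessian L ρ k l u v = φ u * metricTensor L u v k l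

/-- Allows the unit vector λ⁻¹∇ρ to be treated as the Legendre dual of the covector λ⁻¹dρ. -/
theorem IsGrad.smul {V : Type*} [AddCommGroup V] [Module ℝ V] {f p : V → ℝ} {y : V}
    (hg : IsGrad f p y) (hf : ∀ (v : V) (c : ℝ), 0 < c → f (c • v) = c * f v)
    (hp : ∀ (v : V) (c : ℝ), p (c • v) = c * p v) {c : ℝ} (hc : 0 < c) :
    IsGrad f (fun z => c * p z) (c • y) := by
  intro z
  have h := mul_le_mul_of_nonneg_left (hg (c⁻¹ • z)) (sq_nonneg c)
  rw [hf _ _ (inv_pos.2 hc), hp] at h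
  change c * p z - f z ^ 2 / 2 ≤ c * p (c • y) - f (c • y) ^ 2 / 2
  rw [hf _ _ hc, hp]
  have e1 : c ^ 2 * (c⁻¹ * p z - (c⁻¹ * f z) ^ 2 / 2) = c * p z - f z ^ 2 / 2 := by
    field_simp
  rw [e1] at h
  refine h.trans (le_of_eq (by ring))

namespace LocalSolution

variable {n : ℕ} {U : Set (Coord n)} {L : Coord n → Coord n → ℝ} {ρ φ : Coord n → ℝ}
  {u v : Coord n}

theorem isOpen (h : LocalSolution U L ρ φ) : IsOpen U := h.finsler.isOpen

theorem partialDeriv_partialDeriv (h : LocalSolution U L ρ φ) (hu : u ∈ U) (hv : v ≠ 0)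
    (k l : Fin n) : partialDeriv (partialDeriv ρ l) k u
      = ∑ j, cartanCoeff L j l k u v * partialDeriv ρ j u + φ u * metricTensor L u v k l := by
  have := h.eq u hu v hv k l
  unfold horizontalHessian at this
  linarith

/-- `ρ_{lk} yᵏ = ∂e/∂xˡ / 2 + φ ρ_l` at the gradient `y` of `ρ`. -/
theorem sum_hessian_mul_grad (h : LocalSolution U L ρ φ) (hu : u ∈ U) (hρ : fderiv ℝ ρ u ≠ 0)
    (l : Fin n) : ∑ k, localGrad L ρ u k * partialDeriv (partialDeriv ρ l) k u
      = 1 / 2 * xDeriv (fun u v => L u v ^ 2) l u (localGrad L ρ u) + φ u * partialDeriv ρ l u := by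
  set y := localGrad L ρ u with hy
  have hF := h.finsler
  have hy0 : y ≠ 0 := hF.localGrad_ne_zero hu hρ
  have hg := hF.isGrad_localGrad hu ρ
  -- At y = ∇ρ the components of dρ are the lowered components g_{jm} yᵐ, so the contraction
  -- identity for Γ* applies.
  have hp : ∀ j, partialDeriv ρ j u = ∑ m, metricTensor L u y j m * y m := fun j => by
    rw [hF.sum_metricTensor_mul hu hy0, hg.vDeriv_eq hF hu hy0]; rfl
  have e : ∀ k, y k * partialDeriv (partialDeriv ρ l) k u
      = (∑ j, cartanCoeff L j l k u y * ∑ m, metricTensor L u y j m * y m) * y k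
        + φ u * (metricTensor L u y l k * y k) := by
    intro k
    rw [h.partialDeriv_partialDeriv hu hy0 k l, hF.metricTensor_symm hu hy0 k l]
    simp_rw [hp]; ring
  simp_rw [e, Finset.sum_add_distrib, hF.sum_sum_cartanCoeff_mul hu hy0 l, ← Finset.mul_sum, ← hp]

/-- Half the square of the norm of the gradient of `ρ`. -/
noncomputable def _root_.Finsler.localEnergy {n : ℕ} (L : Coord n → Coord n → ℝ)
    (ρ : Coord n → ℝ) (u : Coord n) : ℝ := L u (localGrad L ρ u) ^ 2 / 2

theorem contDiffAt_localEnergy (h : LocalSolution U L ρ φ) (hu : u ∈ U) (hρ : fderiv ℝ ρ u ≠ 0) :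
    ContDiffAt ℝ ∞ (localEnergy L ρ) u := by
  have h1 := h.finsler.contDiffAt_localGrad hu h.smooth hρ
  have h2 := h.finsler.smooth_sq.contDiffAt h.isOpen hu (h.finsler.localGrad_ne_zero hu hρ)
  exact (ContDiffAt.comp (f := fun x => (x, localGrad L ρ x)) u h2
    (contDiffAt_id.prodMk h1)).div_const 2

/-- `dW = φ dρ`. -/
theorem hasFDerivAt_localEnergy (h : LocalSolution U L ρ φ) (hu : u ∈ U)
    (hρ : fderiv ℝ ρ u ≠ 0) : HasFDerivAt (localEnergy L ρ) (φ u • fderiv ℝ ρ u) u := by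
  have hF := h.finsler
  have hW := ((h.contDiffAt_localEnergy hu hρ).differentiableAt (by simp)).hasFDerivAt
  refine hW.congr_fderiv (ContinuousLinearMap.ext fun w => ?_)
  have hG := ((hF.contDiffAt_localGrad hu h.smooth hρ).differentiableAt (by simp)).hasFDerivAt
  have hy0 := hF.localGrad_ne_zero hu hρ
  have hl := hasDerivAt_add_smul u w 0
  have hGl := hG.comp_hasDerivAt_of_eq (0 : ℝ) hl (by simp)
  have hWl := hW.comp_hasDerivAt_of_eq (0 : ℝ) hl (by simp)
  set y' := fderiv ℝ (localGrad L ρ) u w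
  -- Along the line `u + t • w` the derivative of W is computed twice: from L(∇ρ)²/2 by the chain
  -- rule, and from 2W = dρ(∇ρ). Comparing the two eliminates the unknown derivative `y'` of the
  -- gradient.
  have d1 := (hF.smooth_sq.hasDerivAt_comp h.isOpen hl hGl (by simpa using hu)
    (by simpa using hy0)).div_const 2
  have d2 : HasDerivAt (fun t : ℝ => ∑ i, localGrad L ρ (u + t • w) i *
      partialDeriv ρ i (u + t • w)) (∑ i, (y' i * partialDeriv ρ i u + localGrad L ρ u i *
      ∑ k, w k * partialDeriv (partialDeriv ρ i) k u)) 0 := by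
    refine HasDerivAt.fun_sum fun i _ => ?_
    have a := (EuclideanSpace.proj i : Coord n →L[ℝ] ℝ).hasFDerivAt.comp_hasDerivAt (0 : ℝ) hGl
    have b := hasDerivAt_comp_curve h.isOpen (contDiffOn_partialDeriv h.isOpen h.smooth i) hl
      (by simpa using hu)
    exact (a.mul b).congr_deriv (by simp)
  have hev : ∀ᶠ t : ℝ in 𝓝 0, u + t • w ∈ U := by
    have : ContinuousAt (fun t : ℝ => u + t • w) 0 := hl.continuousAt
    exact this.eventually (by simpa using h.isOpen.mem_nhds hu)
  have d2' := d2.congr_of_eventuallyEq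
    (f₁ := fun t : ℝ => L (u + t • w) (localGrad L ρ (u + t • w)) ^ 2) (by
      filter_upwards [hev] with t ht
      rw [← (hF.isGrad_localGrad ht ρ).apply_self hF ht, fderiv_apply_eq_sum])
  have e1 := hWl.unique d1
  have e2 := (d2'.div_const 2).unique d1
  simp only [zero_smul, add_zero, Function.comp_apply] at e1 e2
  have hv : ∀ i, vDeriv (fun u v => L u v ^ 2) i u (localGrad L ρ u) = 2 * partialDeriv ρ i u := by
    intro i
    have := (hF.isGrad_localGrad hu ρ).vDeriv_eq hF hu hy0 i
    unfold partialDeriv; linarith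
  simp_rw [hv] at e1 e2
  have e3 : ∑ i, localGrad L ρ u i * ∑ k, w k * partialDeriv (partialDeriv ρ i) k u
      = ∑ k, w k * (1 / 2 * xDeriv (fun u v => L u v ^ 2) k u (localGrad L ρ u))
        + φ u * ∑ k, w k * partialDeriv ρ k u := by
    simp_rw [Finset.mul_sum]
    rw [Finset.sum_comm, ← Finset.sum_add_distrib]
    refine Finset.sum_congr rfl fun k _ => ?_
    have := h.sum_hessian_mul_grad hu hρ k
    calc _ = w k * ∑ i, localGrad L ρ u i * partialDeriv (partialDeriv ρ k) i u := by
          rw [Finset.mul_sum]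
          refine Finset.sum_congr rfl fun i _ => ?_
          rw [partialDeriv_comm h.isOpen h.smooth hu]; ring
      _ = _ := by rw [this]; ring
  have e4 : ∑ k, w k * (1 / 2 * xDeriv (fun u v => L u v ^ 2) k u (localGrad L ρ u))
      = 1 / 2 * ∑ k, w k * xDeriv (fun u v => L u v ^ 2) k u (localGrad L ρ u) := by
    rw [Finset.mul_sum]; exact Finset.sum_congr rfl fun k _ => by ring
  have e5 : ∑ i, y' i * (2 * partialDeriv ρ i u) = 2 * ∑ i, y' i * partialDeriv ρ i u := by
    rw [Finset.mul_sum]; exact Finset.sum_congr rfl fun k _ => by ring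
  rw [Finset.sum_add_distrib, e3, e4] at e2
  rw [e5] at e1 e2
  rw [_root_.smul_apply, fderiv_apply_eq_sum ρ, smul_eq_mul, e1]
  linarith

/-- Unit speed integral curves of the gradient are geodesics. -/
theorem geodesic_of_grad (h : LocalSolution U L ρ φ) {γ : ℝ → Coord n} {t : ℝ} (hu : γ t ∈ U)
    (hρ : fderiv ℝ ρ (γ t) ≠ 0)
    (hγ : ∀ᶠ s in 𝓝 t, HasDerivAt γ ((L (γ s) (localGrad L ρ (γ s)))⁻¹ • localGrad L ρ (γ s)) s)
    (i : Fin n) :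
    deriv (deriv γ) t i + 2 * sprayCoeff L i (γ t) (deriv γ t) = 0 := by
  have hF := h.finsler
  set e : Coord n → Coord n → ℝ := fun u v => L u v ^ 2 with he
  set lam : ℝ → ℝ := fun s => L (γ s) (localGrad L ρ (γ s)) with hlam
  set y : ℝ → Coord n := fun s => (lam s)⁻¹ • localGrad L ρ (γ s) with hy
  have hγt := hγ.self_of_nhds
  have hG0 := hF.localGrad_ne_zero hu hρ
  have hl0 : 0 < lam t := hF.pos hu hG0
  have hGd := ((hF.contDiffAt_localGrad hu h.smooth hρ).differentiableAt
    (by simp)).hasFDerivAt.comp_hasDerivAt t hγt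
  obtain ⟨D, hld⟩ : ∃ D, HasDerivAt lam D t :=
    ⟨_, hF.smooth.hasDerivAt_comp h.isOpen hγt hGd hu hG0⟩
  have hWd := (h.hasFDerivAt_localEnergy hu hρ).comp_hasDerivAt t hγt
  have hpG : fderiv ℝ ρ (γ t) (localGrad L ρ (γ t)) = lam t ^ 2 :=
    (hF.isGrad_localGrad hu ρ).apply_self hF hu
  -- W = λ²/2, dW = φ dρ and dρ(γ') = λ give λλ' = φλ.
  have hld' : HasDerivAt lam (φ (γ t)) t := by
    refine hld.congr_deriv ?_
    have a := ((hld.pow 2).div_const 2).unique hWd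
    simp only [_root_.smul_apply, map_smul, smul_eq_mul, hpG] at a
    have : lam t * D = lam t * φ (γ t) := by
      refine Eq.trans ?_ (a.trans ?_)
      · push_cast; ring
      · change (lam t)⁻¹ * (φ (γ t) * lam t ^ 2) = _
        field_simp
    exact mul_left_cancel₀ hl0.ne' this
  have hyd : HasDerivAt y _ t := (hld'.inv hl0.ne').smul hGd
  set y' := deriv y t with hy'
  have hyd' : HasDerivAt y y' t := hyd.differentiableAt.hasDerivAt
  have hdd : deriv γ =ᶠ[𝓝 t] y := hγ.mono fun s hs => hs.deriv
  have hdt : deriv γ t = y t := hγt.deriv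
  have hdd' : deriv (deriv γ) t = y' := hdd.deriv_eq
  have hyt0 : y t ≠ 0 := smul_ne_zero (inv_ne_zero hl0.ne') hG0
  have hc := hγt.continuousAt
  have hevU : ∀ᶠ s in 𝓝 t, γ s ∈ U := hc.eventually (h.isOpen.mem_nhds hu)
  have hevρ : ∀ᶠ s in 𝓝 t, fderiv ℝ ρ (γ s) ≠ 0 := by
    have : ContinuousAt (fderiv ℝ ρ) (γ t) :=
      ((h.smooth.contDiffAt (h.isOpen.mem_nhds hu)).fderiv_right (m := ∞) (by simp)).continuousAt
    exact (this.comp hc).eventually_ne hρ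
  -- The Euler–Lagrange equation with lowered index. Both sides of ½ ∂L²/∂yᵐ(γ, y) = λ⁻¹ ∂ρ/∂xᵐ are
  -- differentiated along γ; on the right the term coming from λ' cancels the φ-term of the
  -- contracted Hessian.
  have EL : ∀ m, ∑ k, metricTensor L (γ t) (y t) m k * y' k
      = -∑ k, metricTensor L (γ t) (y t) m k * (2 * sprayCoeff L k (γ t) (y t)) := by
    intro m
    have a := ((hF.smooth_sq.vDeriv h.isOpen m).hasDerivAt_comp h.isOpen hγt hyd' hu
      hyt0).const_mul (1 / 2)
    have b := (hld'.inv hl0.ne').mul (hasDerivAt_comp_curve h.isOpen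
      (contDiffOn_partialDeriv h.isOpen h.smooth m) hγt hu)
    have b' := b.congr_of_eventuallyEq
        (f₁ := fun s => 1 / 2 * vDeriv (fun u v => L u v ^ 2) m (γ s) (y s)) (by
      filter_upwards [hevU, hevρ] with s hs hs'
      have hG := hF.localGrad_ne_zero hs hs'
      have hlp : 0 < lam s := hF.pos hs hG
      have g1 := (hF.isGrad_localGrad hs ρ).smul (fun v c hc => hF.homog _ v c hc)
        (fun v c => by simp) (inv_pos.2 hlp)
      have g2 : IsGrad (L (γ s)) ((lam s)⁻¹ • fderiv ℝ ρ (γ s) : Coord n →L[ℝ] ℝ) (y s) := g1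
      exact g2.vDeriv_eq hF hs (smul_ne_zero (inv_ne_zero hlp.ne') hG) m)
    have c := a.unique b'
    have s1 : ∑ k, y' k * vDeriv (vDeriv (fun u v => L u v ^ 2) m) k (γ t) (y t)
        = 2 * ∑ k, metricTensor L (γ t) (y t) m k * y' k := by
      rw [Finset.mul_sum]
      refine Finset.sum_congr rfl fun k _ => ?_
      rw [hF.metricTensor_symm hu hyt0, LocalFinsler.metricTensor_apply]; ring
    have s2 : ∑ k, ((lam t)⁻¹ • localGrad L ρ (γ t)) k *
          partialDeriv (partialDeriv ρ m) k (γ t)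
        = (lam t)⁻¹ * (1 / 2 * xDeriv (fun u v => L u v ^ 2) m (γ t) (localGrad L ρ (γ t))
          + φ (γ t) * partialDeriv ρ m (γ t)) := by
      rw [← h.sum_hessian_mul_grad hu hρ m, Finset.mul_sum]
      exact Finset.sum_congr rfl fun k _ => by simp; ring
    have s3 : xDeriv (fun u v => L u v ^ 2) m (γ t) (y t)
        = (lam t)⁻¹ ^ 2 * xDeriv (fun u v => L u v ^ 2) m (γ t) (localGrad L ρ (γ t)) := by
      have f1 := ((hF.smooth_sq.contDiffAt_left h.isOpen hu hG0).differentiableAt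
        (by simp)).hasFDerivAt.const_mul ((lam t)⁻¹ ^ 2)
      refine Eq.trans ?_ ((partialDeriv_of_hasFDerivAt f1 m).trans (by simp [xDeriv, partialDeriv]))
      refine partialDeriv_congr (Eventually.of_forall fun x => ?_) m
      simp only [hy]
      rw [hF.homog x _ _ (inv_pos.2 hl0)]; ring
    rw [hF.sum_metricTensor_mul_sprayCoeff hu hyt0 m, s3]
    change 1 / 2 * (∑ k, y t k * _ + _) = _ at c
    rw [s1, s2] at c
    have hl := hl0.ne'
    have : -φ (γ t) / lam t ^ 2 * partialDeriv ρ m (γ t) + (lam t)⁻¹ * ((lam t)⁻¹ *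
        (1 / 2 * xDeriv (fun u v => L u v ^ 2) m (γ t) (localGrad L ρ (γ t))
          + φ (γ t) * partialDeriv ρ m (γ t)))
        = 1 / 2 * ((lam t)⁻¹ ^ 2 *
          xDeriv (fun u v => L u v ^ 2) m (γ t) (localGrad L ρ (γ t))) := by
      field_simp; ring
    rw [Pi.inv_apply, this] at c
    linarith
  rw [hdd', hdt]
  have inv := hF.inv_metricTensor_mul hu hyt0
    (fun k => y' k + 2 * sprayCoeff L k (γ t) (y t)) i
  rw [← inv]
  refine Finset.sum_eq_zero fun m _ => ?_
  simp_rw [mul_add, Finset.sum_add_distrib]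
  rw [EL m]; ring

/-- Along a geodesic, `(ρ ∘ γ)'' = φ F²`. -/
theorem hasDerivAt_along_geodesic (h : LocalSolution U L ρ φ) {γ γ' : ℝ → Coord n}
    {γ'' : Coord n} {t : ℝ} (hγ : HasDerivAt γ (γ' t) t) (hγ' : HasDerivAt γ' γ'' t)
    (hu : γ t ∈ U) (hv : γ' t ≠ 0)
    (hgeo : ∀ i, γ'' i + 2 * sprayCoeff L i (γ t) (γ' t) = 0) :
    HasDerivAt (fun s => fderiv ℝ ρ (γ s) (γ' s)) (φ (γ t) * L (γ t) (γ' t) ^ 2) t := by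
  have hF := h.finsler
  have d2 : HasDerivAt (fun s : ℝ => ∑ i, γ' s i * partialDeriv ρ i (γ s))
      (∑ i, (γ'' i * partialDeriv ρ i (γ t) + γ' t i *
      ∑ k, γ' t k * partialDeriv (partialDeriv ρ i) k (γ t))) t := by
    refine HasDerivAt.fun_sum fun i _ => ?_
    have a := (EuclideanSpace.proj i : Coord n →L[ℝ] ℝ).hasFDerivAt.comp_hasDerivAt t hγ'
    exact a.mul (hasDerivAt_comp_curve h.isOpen (contDiffOn_partialDeriv h.isOpen h.smooth i) hγ hu)
  simp_rw [fderiv_apply_eq_sum ρ]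
  refine d2.congr_deriv ?_
  have e1 : ∀ i, γ'' i = -(2 * sprayCoeff L i (γ t) (γ' t)) := fun i => by linarith [hgeo i]
  have e2 : ∑ i, γ' t i * ∑ k, γ' t k * partialDeriv (partialDeriv ρ i) k (γ t)
      = ∑ j, (∑ i, ∑ k, cartanCoeff L j i k (γ t) (γ' t) * γ' t i * γ' t k)
          * partialDeriv ρ j (γ t)
        + φ (γ t) * ∑ i, ∑ k, metricTensor L (γ t) (γ' t) i k * γ' t i * γ' t k := by
    simp_rw [Finset.sum_mul]
    rw [Finset.sum_comm, Finset.mul_sum, ← Finset.sum_add_distrib]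
    refine Finset.sum_congr rfl fun i _ => ?_
    rw [Finset.sum_comm, Finset.mul_sum, Finset.mul_sum, ← Finset.sum_add_distrib]
    refine Finset.sum_congr rfl fun k _ => ?_
    rw [h.partialDeriv_partialDeriv hu hv, hF.metricTensor_symm hu hv k i, mul_add, mul_add,
      Finset.mul_sum, Finset.mul_sum]
    congr 1
    · exact Finset.sum_congr rfl fun j _ => by ring
    · ring
  rw [Finset.sum_add_distrib, e2, hF.sum_sum_metricTensor hu hv]
  simp_rw [e1, hF.sum_sum_cartanCoeff hu hv]
  have : ∑ i, -(2 * sprayCoeff L i (γ t) (γ' t)) * partialDeriv ρ i (γ t)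
      = -∑ i, 2 * sprayCoeff L i (γ t) (γ' t) * partialDeriv ρ i (γ t) := by
    rw [← Finset.sum_neg_distrib]; exact Finset.sum_congr rfl fun i _ => by ring
  rw [this]; ring

end LocalSolution


/-! ### Critical points of a solution -/

/-- Grönwall's inequality along the segments issuing from `x₀`. -/
theorem eventually_eq_zero_of_norm_fderiv_le {E G : Type*} [NormedAddCommGroup E] [NormedSpace ℝ E]
    [NormedAddCommGroup G] [NormedSpace ℝ G] {f : E → G} {x₀ : E} {C : ℝ}
    (h : ∀ᶠ x in 𝓝 x₀, DifferentiableAt ℝ f x ∧ ∀ w, ‖fderiv ℝ f x w‖ ≤ C * ‖w‖ * ‖f x‖)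
    (h0 : f x₀ = 0) : ∀ᶠ x in 𝓝 x₀, f x = 0 := by
  obtain ⟨δ, hδ, hb⟩ := Metric.eventually_nhds_iff_ball.1 h
  filter_upwards [Metric.ball_mem_nhds x₀ hδ] with x hx
  set w := x - x₀ with hw
  have hmem : ∀ t ∈ Icc (0 : ℝ) 1, x₀ + t • w ∈ Metric.ball x₀ δ := by
    intro t ht
    have hx' : ‖w‖ < δ := by rwa [hw, ← dist_eq_norm]
    rw [Metric.mem_ball, dist_eq_norm, add_sub_cancel_left, norm_smul, Real.norm_of_nonneg ht.1]
    nlinarith [ht.2, norm_nonneg w]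
  have hd : ∀ t ∈ Icc (0 : ℝ) 1, HasDerivAt (fun t : ℝ => f (x₀ + t • w))
      (fderiv ℝ f (x₀ + t • w) w) t := fun t ht => by
    have hl : HasDerivAt (fun t : ℝ => x₀ + t • w) w t := by
      simpa using ((hasDerivAt_id t).smul_const w).const_add x₀
    exact (hb _ (hmem t ht)).1.hasFDerivAt.comp_hasDerivAt t hl
  have := norm_le_gronwallBound_of_norm_deriv_right_le (δ := 0) (K := C * ‖w‖) (ε := 0)
    (fun t ht => (hd t ht).continuousAt.continuousWithinAt)
    (fun t ht => (hd t (Ico_subset_Icc_self ht)).hasDerivWithinAt) (by simp [h0])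
    (fun t ht => by
      simpa using (hb _ (hmem t (Ico_subset_Icc_self ht))).2 w) 1 (right_mem_Icc.2 zero_le_one)
  simpa [gronwallBound_ε0, hw] using this

namespace LocalSolution

variable {n : ℕ} {U : Set (Coord n)} {L : Coord n → Coord n → ℝ} {ρ φ : Coord n → ℝ}
  {u v : Coord n}

theorem contDiffAt_snd_fixed (h : LocalSolution U L ρ φ) {f : Coord n → Coord n → ℝ}
    (hf : SmoothOnSlit U f) (hv : v ≠ 0) : ContDiffOn ℝ ∞ (fun x => f x v) U := fun _ hu =>
  (hf.contDiffAt_left h.isOpen hu hv).contDiffWithinAt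

theorem basisVec_ne_zero (i : Fin n) : (basisVec i : Coord n) ≠ 0 := by
  intro h
  simpa using congrArg (fun w : Coord n => w i) h

/-- No regularity of φ is assumed. It is recovered by solving one diagonal component of the
equation, in a fixed direction, for φ, since the diagonal entries of g are positive. -/
theorem contDiffOn_factor (h : LocalSolution U L ρ φ) (hn : 0 < n) : ContDiffOn ℝ ∞ φ U := by
  set i : Fin n := ⟨0, hn⟩
  have hi := basisVec_ne_zero i
  have h1 : ContDiffOn ℝ ∞ (fun u => (partialDeriv (partialDeriv ρ i) i u
      - ∑ j, cartanCoeff L j i i u (basisVec i) * partialDeriv ρ j u)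
        / metricTensor L u (basisVec i) i i) U := by
    refine ContDiffOn.div ?_ (h.contDiffAt_snd_fixed (h.finsler.smooth_metricTensor i i) hi) ?_
    · refine (contDiffOn_partialDeriv h.isOpen (contDiffOn_partialDeriv h.isOpen h.smooth i) i).sub
        (ContDiffOn.sum fun j _ => ?_)
      exact (h.contDiffAt_snd_fixed (h.finsler.smooth_cartanCoeff j i i) hi).mul
        (contDiffOn_partialDeriv h.isOpen h.smooth j)
    · exact fun u hu => ((h.finsler.posDef u hu _ hi).diag_pos).ne'
  refine h1.congr fun u hu => ?_
  rw [eq_div_iff ((h.finsler.posDef u hu _ hi).diag_pos).ne', ← h.eq u hu _ hi i i]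
  rfl

/-- At a critical point of `ρ` the Hessian is `φ g`. -/
theorem hessian_of_critical (h : LocalSolution U L ρ φ) (hu : u ∈ U) (hv : v ≠ 0)
    (hρ : fderiv ℝ ρ u = 0) (k l : Fin n) :
    partialDeriv (partialDeriv ρ l) k u = φ u * metricTensor L u v k l := by
  rw [h.partialDeriv_partialDeriv hu hv k l]
  simp [partialDeriv, hρ]

open Asymptotics in
/-- Where `dρ` and `φ` vanish simultaneously, `ρ` is locally constant. -/
theorem eventually_critical (h : LocalSolution U L ρ φ) (hn : 2 ≤ n) (hu : u ∈ U)
    (hρ : fderiv ℝ ρ u = 0) (hφ : φ u = 0) : ∀ᶠ x in 𝓝 u, fderiv ℝ ρ x = 0 ∧ φ x = 0 := by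
  have hU := h.isOpen
  have hφs := h.contDiffOn_factor (by omega)
  -- With the direction frozen, the equation becomes a system for functions of the position alone.
  -- The goal is a bound |df| ≤ C|f| for f = (dρ, φ), to which Grönwall applies.
  set v : Coord n := basisVec ⟨0, by omega⟩ with hv
  have hv0 : v ≠ 0 := basisVec_ne_zero _
  set a : Fin n → Coord n → ℝ := fun l => partialDeriv ρ l with ha
  have has : ∀ l, ContDiffOn ℝ ∞ (a l) U := contDiffOn_partialDeriv hU h.smooth
  set f : Coord n → (Fin n → ℝ) × ℝ := fun x => (fun l => a l x, φ x) with hf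
  set Γ : Fin n → Fin n → Fin n → Coord n → ℝ := fun j l k x => cartanCoeff L j l k x v with hΓ
  set g : Fin n → Fin n → Coord n → ℝ := fun k l x => metricTensor L x v k l with hg
  have hΓs : ∀ j l k, ContDiffOn ℝ ∞ (Γ j l k) U := fun j l k =>
    h.contDiffAt_snd_fixed (h.finsler.smooth_cartanCoeff j l k) hv0
  have hgs : ∀ k l, ContDiffOn ℝ ∞ (g k l) U := fun k l =>
    h.contDiffAt_snd_fixed (h.finsler.smooth_metricTensor k l) hv0
  have hO1 : ∀ {q : Coord n → ℝ}, ContDiffOn ℝ ∞ q U → q =O[𝓝 u] (fun _ => (1 : ℝ)) :=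
    fun hq => (hq.contDiffAt (hU.mem_nhds hu)).continuousAt.isBigO_one ℝ
  set N : Coord n → ℝ := fun x => ‖f x‖ with hN
  have hmul : ∀ {p q : Coord n → ℝ}, ContDiffOn ℝ ∞ p U → q =O[𝓝 u] N →
      (fun x => p x * q x) =O[𝓝 u] N := fun hp hq => by simpa using (hO1 hp).mul hq
  have haN : ∀ l, a l =O[𝓝 u] N := fun l => IsBigO.of_bound 1 (Eventually.of_forall fun x => by
    rw [one_mul, hN, norm_norm]
    exact (norm_le_pi_norm (fun l => a l x) l).trans (le_max_left _ _))
  have hφN : φ =O[𝓝 u] N := IsBigO.of_bound 1 (Eventually.of_forall fun x => by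
    rw [one_mul, hN, norm_norm]; exact le_max_right _ _)
  have eqa : ∀ k l, ∀ x ∈ U, partialDeriv (a l) k x = ∑ j, Γ j l k x * a j x + g k l x * φ x :=
    fun k l x hx => by
      rw [mul_comm (g k l x)]; exact h.partialDeriv_partialDeriv hx hv0 k l
  have hda : ∀ k l, partialDeriv (a l) k =O[𝓝 u] N := by
    intro k l
    have : (fun x => ∑ j, Γ j l k x * a j x + g k l x * φ x) =O[𝓝 u] N :=
      (IsBigO.fun_sum fun j _ => hmul (hΓs j l k) (haN j)).add (hmul (hgs k l) hφN)
    refine this.congr' ?_ EventuallyEq.rfl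
    filter_upwards [hU.mem_nhds hu] with x hx using (eqa k l x hx).symm
  -- Differentiating the equation once more: every term without ∂φ is a bounded multiple of dρ, of
  -- φ, or of second derivatives of ρ, which are already O(|f|).
  have hmix : ∀ m k l, (fun x => partialDeriv (partialDeriv (a l) k) m x
      - g k l x * partialDeriv φ m x) =O[𝓝 u] N := by
    intro m k l
    have : (fun x => ∑ j, (Γ j l k x * partialDeriv (a j) m x + partialDeriv (Γ j l k) m x * a j x)
        + partialDeriv (g k l) m x * φ x) =O[𝓝 u] N :=
      (IsBigO.fun_sum fun j _ => (hmul (hΓs j l k) (hda m j)).add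
        (hmul (contDiffOn_partialDeriv hU (hΓs j l k) m) (haN j))).add
        (hmul (contDiffOn_partialDeriv hU (hgs k l) m) hφN)
    refine this.congr' ?_ EventuallyEq.rfl
    filter_upwards [hU.mem_nhds hu] with x hx
    have hd : ∀ {q : Coord n → ℝ}, ContDiffOn ℝ ∞ q U → HasFDerivAt q (fderiv ℝ q x) x :=
      fun hq => ContDiffOn.hasFDerivAt_of_isOpen hU hq hx
    have d := (HasFDerivAt.fun_sum (u := Finset.univ) fun j _ =>
      (hd (hΓs j l k)).mul (hd (has j))).add ((hd (hgs k l)).mul (hd hφs))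
    have e1 : partialDeriv (partialDeriv (a l) k) m x
        = partialDeriv (fun x => ∑ j, Γ j l k x * a j x + g k l x * φ x) m x := by
      refine partialDeriv_congr ?_ m
      filter_upwards [hU.mem_nhds hx] with z hz using eqa k l z hz
    have e2 := partialDeriv_of_hasFDerivAt d m
    rw [e1]
    refine (sub_eq_of_eq_add (e2.trans ?_)).symm
    simp only [_root_.add_apply, _root_.sum_apply, _root_.smul_apply, smul_eq_mul]
    change ∑ j, (Γ j l k x * partialDeriv (a j) m x + a j x * partialDeriv (Γ j l k) m x)
      + (g k l x * partialDeriv φ m x + φ x * partialDeriv (g k l) m x) = _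
    simp_rw [mul_comm (a _ x)]
    ring
  -- Symmetry of the third derivatives of ρ removes them and leaves g_{kl} ∂_mφ - g_{ml} ∂_kφ =
  -- O(|f|). Contraction with the inverse metric turns this into (n - 1) ∂_mφ, so n ≥ 2 is needed.
  have hdφ : ∀ m, partialDeriv φ m =O[𝓝 u] N := by
    intro m
    have hQ : ∀ k l, (fun x => g k l x * partialDeriv φ m x - g m l x * partialDeriv φ k x)
        =O[𝓝 u] N := by
      intro k l
      refine ((hmix k m l).sub (hmix m k l)).congr' ?_ EventuallyEq.rfl
      filter_upwards [hU.mem_nhds hu] with x hx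
      rw [partialDeriv_comm hU (has l) hx k m]; ring
    have hinv : ∀ k l, ContDiffOn ℝ ∞ (fun x => (metricTensor L x v)⁻¹ l k) U := fun k l =>
      h.contDiffAt_snd_fixed (h.finsler.smooth_inv l k) hv0
    have hS : (fun x => ∑ k, ∑ l, (metricTensor L x v)⁻¹ l k *
        (g k l x * partialDeriv φ m x - g m l x * partialDeriv φ k x)) =O[𝓝 u] N :=
      IsBigO.fun_sum fun k _ => IsBigO.fun_sum fun l _ => hmul (hinv k l) (hQ k l)
    have hS' := hS.const_mul_left (((n : ℝ) - 1)⁻¹)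
    refine hS'.congr' ?_ EventuallyEq.rfl
    filter_upwards [hU.mem_nhds hu] with x hx
    have hdet := isUnit_iff_ne_zero.2 (h.finsler.det_ne_zero hx hv0)
    have i1 : ∀ l, ∑ k, (metricTensor L x v)⁻¹ l k * g k l x = 1 := fun l => by
      have := congrFun (congrFun (Matrix.nonsing_inv_mul (metricTensor L x v) hdet) l) l
      rwa [Matrix.mul_apply, Matrix.one_apply_eq] at this
    have i2 : ∀ k, ∑ l, g m l x * (metricTensor L x v)⁻¹ l k = (1 : Matrix (Fin n) (Fin n) ℝ) m k :=
      fun k => by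
        have := congrFun (congrFun (Matrix.mul_nonsing_inv (metricTensor L x v) hdet) m) k
        rwa [Matrix.mul_apply] at this
    have i3 : ∑ k, ∑ l, (metricTensor L x v)⁻¹ l k *
        (g k l x * partialDeriv φ m x - g m l x * partialDeriv φ k x)
        = (∑ l, (∑ k, (metricTensor L x v)⁻¹ l k * g k l x)) * partialDeriv φ m x
          - ∑ k, (∑ l, g m l x * (metricTensor L x v)⁻¹ l k) * partialDeriv φ k x := by
      rw [Finset.sum_comm (f := fun l k => (metricTensor L x v)⁻¹ l k * g k l x)]
      simp_rw [Finset.sum_mul, ← Finset.sum_sub_distrib]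
      exact Finset.sum_congr rfl fun k _ => Finset.sum_congr rfl fun l _ => by ring
    rw [i3]
    simp_rw [i1, i2, Matrix.one_apply]
    have hn' : (n : ℝ) - 1 ≠ 0 := by
      have : (2 : ℝ) ≤ n := by exact_mod_cast hn
      linarith
    simp
    field_simp
  have bound : ∀ {ι : Type} [Fintype ι] (q : ι → Coord n → ℝ), (∀ i, q i =O[𝓝 u] N) →
      ∃ C : ℝ, 0 ≤ C ∧ ∀ᶠ x in 𝓝 u, ∀ i, |q i x| ≤ C * N x := by
    intro ι _ q hq
    choose c hc0 hc using fun i => (hq i).exists_nonneg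
    refine ⟨∑ i, c i, Finset.sum_nonneg fun i _ => hc0 i, ?_⟩
    filter_upwards [eventually_all.2 fun i => (hc i).bound] with x hx i
    refine (hx i).trans ?_
    rw [hN, norm_norm]
    exact mul_le_mul_of_nonneg_right
      (Finset.single_le_sum (fun i _ => hc0 i) (Finset.mem_univ i)) (norm_nonneg _)
  obtain ⟨C₁, hC₁, hb₁⟩ := bound (fun p : Fin n × Fin n => partialDeriv (a p.1) p.2)
    fun p => hda p.2 p.1
  obtain ⟨C₂, hC₂, hb₂⟩ := bound (fun m : Fin n => partialDeriv φ m) hdφ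
  have comp : ∀ {q : Coord n → ℝ} {x : Coord n} {C : ℝ}, 0 ≤ C →
      (∀ m, |partialDeriv q m x| ≤ C * N x) → ∀ w, |fderiv ℝ q x w| ≤ n * C * ‖w‖ * N x := by
    intro q x C hC hq w
    rw [fderiv_apply_eq_sum]
    refine (Finset.abs_sum_le_sum_abs _ _).trans ?_
    calc _ ≤ ∑ _i : Fin n, ‖w‖ * (C * N x) := Finset.sum_le_sum fun i _ => by
          rw [abs_mul]
          exact mul_le_mul (by simpa using PiLp.norm_apply_le w i) (hq i) (abs_nonneg _)
            (norm_nonneg _)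
      _ = _ := by simp; ring
  have main : ∀ᶠ x in 𝓝 u, f x = 0 := by
    refine eventually_eq_zero_of_norm_fderiv_le (C := n * (C₁ + C₂)) ?_ ?_
    · filter_upwards [hU.mem_nhds hu, hb₁, hb₂] with x hx h1 h2
      have hd : HasFDerivAt f ((ContinuousLinearMap.pi fun l => fderiv ℝ (a l) x).prod
          (fderiv ℝ φ x)) x :=
        (hasFDerivAt_pi.2 fun l => ContDiffOn.hasFDerivAt_of_isOpen hU (has l) hx).prodMk
          (ContDiffOn.hasFDerivAt_of_isOpen hU hφs hx)
      refine ⟨hd.differentiableAt, fun w => ?_⟩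
      rw [hd.fderiv]
      have hw := norm_nonneg w
      have hNx : 0 ≤ N x := norm_nonneg _
      have h0 : 0 ≤ n * (C₁ + C₂) * ‖w‖ * ‖f x‖ := by positivity
      refine max_le ((pi_norm_le_iff_of_nonneg h0).2 fun l => ?_) ?_
      · refine (comp hC₁ (fun m => h1 (l, m)) w).trans ?_
        change n * C₁ * ‖w‖ * N x ≤ n * (C₁ + C₂) * ‖w‖ * N x
        gcongr; linarith
      · refine (comp hC₂ h2 w).trans ?_
        change n * C₂ * ‖w‖ * N x ≤ n * (C₁ + C₂) * ‖w‖ * N x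
        gcongr; linarith
    · refine Prod.ext (funext fun l => ?_) hφ
      change fderiv ℝ ρ u _ = 0
      rw [hρ]; rfl
  filter_upwards [main] with x hx
  refine ⟨ContinuousLinearMap.ext fun w => ?_, congrArg Prod.snd hx⟩
  rw [fderiv_apply_eq_sum]
  refine Finset.sum_eq_zero fun l _ => ?_
  have : a l x = 0 := congrFun (congrArg Prod.fst hx) l
  change w l * a l x = 0
  rw [this, mul_zero]

end LocalSolution


/-! ### Local flows parametrized by the values of a function -/

/-- `P c t` expresses that the curve `c` solves, at time `t`, a differential equation on the open set
`S` along whose solutions `ρ` grows with unit speed. -/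
structure LevelFlow {M : Type*} [TopologicalSpace M] (S : Set M) (ρ : M → ℝ)
    (P : (ℝ → M) → ℝ → Prop) : Prop where
  congr : ∀ {c c' : ℝ → M} {t : ℝ}, c =ᶠ[𝓝 t] c' → P c t → P c' t
  mem : ∀ {c : ℝ → M} {t : ℝ}, P c t → c t ∈ S
  continuousAt : ∀ {c : ℝ → M} {t : ℝ}, P c t → ContinuousAt c t
  level : ∀ {c : ℝ → M} {t : ℝ}, P c t → HasDerivAt (fun s => ρ (c s)) 1 t
  unique : ∀ {c c' : ℝ → M} {t : ℝ}, (∀ᶠ s in 𝓝 t, P c s) → (∀ᶠ s in 𝓝 t, P c' s) →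
    c t = c' t → c =ᶠ[𝓝 t] c'
  box : ∀ z ∈ S, ∃ V : Set M, IsOpen V ∧ z ∈ V ∧ ∃ ε > 0, ∃ α : M → ℝ → M,
    (∀ x ∈ V, α x (ρ x) = x ∧ |ρ x - ρ z| < ε ∧ ∀ t ∈ Ioo (ρ z - ε) (ρ z + ε), P (α x) t) ∧
    ∀ t ∈ Ioo (ρ z - ε) (ρ z + ε), ContinuousOn (fun x => α x t) V

/-- `x` and `y` lie on a common trajectory. -/
def Linked {M : Type*} (ρ : M → ℝ) (P : (ℝ → M) → ℝ → Prop) (x y : M) : Prop :=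
  ∃ (c : ℝ → M) (a b : ℝ), (∀ t ∈ Ioo a b, P c t) ∧ ρ x ∈ Ioo a b ∧ ρ y ∈ Ioo a b ∧
    c (ρ x) = x ∧ c (ρ y) = y

namespace Linked

variable {M : Type*} {ρ : M → ℝ} {P : (ℝ → M) → ℝ → Prop} {x y : M}

theorem symm (hxy : Linked ρ P x y) : Linked ρ P y x := by
  obtain ⟨c, a, b, hc, hx, hy, hcx, hcy⟩ := hxy
  exact ⟨c, a, b, hc, hy, hx, hcy, hcx⟩

/-- Time along a trajectory is the value of ρ, so a trajectory meets each level at most once. -/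
theorem eq (hxy : Linked ρ P x y) (hρ : ρ x = ρ y) : x = y := by
  obtain ⟨c, a, b, hc, hx, hy, hcx, hcy⟩ := hxy
  rw [← hcx, ← hcy, hρ]

end Linked

namespace LevelFlow

variable {M : Type*} [TopologicalSpace M] {S : Set M} {ρ : M → ℝ}
  {P : (ℝ → M) → ℝ → Prop} {x y z : M}

theorem _root_.Finsler.Linked.mem_left (hxy : Linked ρ P x y) (h : LevelFlow S ρ P) : x ∈ S := by
  obtain ⟨c, a, b, hc, hx, hy, hcx, hcy⟩ := hxy
  rw [← hcx]; exact h.mem (hc _ hx)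

theorem _root_.Finsler.Linked.mem_right (hxy : Linked ρ P x y) (h : LevelFlow S ρ P) : y ∈ S :=
  hxy.symm.mem_left h

theorem level_eq (h : LevelFlow S ρ P) {c : ℝ → M} {a b t₀ t : ℝ} (hc : ∀ t ∈ Ioo a b, P c t)
    (ht₀ : t₀ ∈ Ioo a b) (ht : t ∈ Ioo a b) : ρ (c t) = ρ (c t₀) + (t - t₀) := by
  have hd : ∀ s ∈ Ioo a b, HasDerivAt (fun s => ρ (c s) - s) 0 s := fun s hs => by
    exact ((h.level (hc s hs)).sub (hasDerivAt_id s)).congr_deriv (sub_self 1)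
  have := isOpen_Ioo.is_const_of_deriv_eq_zero isPreconnected_Ioo
    (fun s hs => (hd s hs).differentiableAt.differentiableWithinAt)
    (fun s hs => (hd s hs).deriv) ht ht₀
  linarith

theorem level_curve (h : LevelFlow S ρ P) {c : ℝ → M} {a b t : ℝ} (hc : ∀ t ∈ Ioo a b, P c t)
    (hx : ρ x ∈ Ioo a b) (hcx : c (ρ x) = x) (ht : t ∈ Ioo a b) : ρ (c t) = t := by
  rw [h.level_eq hc hx ht, hcx]; ring

theorem linked_curve (h : LevelFlow S ρ P) {c : ℝ → M} {a b t : ℝ} (hc : ∀ t ∈ Ioo a b, P c t)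
    (hx : ρ x ∈ Ioo a b) (hcx : c (ρ x) = x) (ht : t ∈ Ioo a b) : Linked ρ P x (c t) := by
  have := h.level_curve hc hx hcx ht
  exact ⟨c, a, b, hc, hx, by rwa [this], hcx, by rw [this]⟩

/-- The trajectory of a point reaches all the levels between two levels that it reaches. -/
theorem _root_.Finsler.Linked.exists_between (hxy : Linked ρ P x y) (h : LevelFlow S ρ P) {t : ℝ}
    (ht : t ∈ uIcc (ρ x) (ρ y)) : ∃ z, Linked ρ P x z ∧ ρ z = t := by
  obtain ⟨c, a, b, hc, hx, hy, hcx, hcy⟩ := hxy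
  have ht' : t ∈ Ioo a b := (ordConnected_Ioo.uIcc_subset hx hy) ht
  exact ⟨c t, h.linked_curve hc hx hcx ht', h.level_curve hc hx hcx ht'⟩

/-- The flow box in terms of `Linked` alone; the local flow itself does not appear in later
arguments. -/
theorem exists_box (h : LevelFlow S ρ P) (hz : z ∈ S) : ∃ V ∈ 𝓝 z, ∃ ε > 0, ∀ x ∈ V,
    |ρ x - ρ z| < ε ∧ ∀ t, |t - ρ z| < ε → ∃ y, Linked ρ P x y ∧ ρ y = t ∧
      ∀ O ∈ 𝓝 y, ∀ᶠ x' in 𝓝 x, ∃ y' ∈ O, Linked ρ P x' y' ∧ ρ y' = t := by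
  obtain ⟨V, hV, hzV, ε, hε, α, hα, hcont⟩ := h.box z hz
  have hmem : ∀ t, |t - ρ z| < ε → t ∈ Ioo (ρ z - ε) (ρ z + ε) := fun t ht => by
    rw [abs_sub_lt_iff] at ht
    constructor <;> linarith
  have key : ∀ x ∈ V, ∀ t, |t - ρ z| < ε → Linked ρ P x (α x t) ∧ ρ (α x t) = t := by
    intro x hx t ht
    obtain ⟨h1, h2, h3⟩ := hα x hx
    exact ⟨h.linked_curve h3 (hmem _ h2) h1 (hmem t ht), h.level_curve h3 (hmem _ h2) h1 (hmem t ht)⟩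
  refine ⟨V, hV.mem_nhds hzV, ε, hε, fun x hx => ⟨(hα x hx).2.1, fun t ht =>
    ⟨α x t, (key x hx t ht).1, (key x hx t ht).2, fun O hO => ?_⟩⟩⟩
  have := ((hcont t (hmem t ht)).continuousAt (hV.mem_nhds hx)).eventually hO
  filter_upwards [this, hV.mem_nhds hx] with x' hx' hxV'
  exact ⟨_, hx', key x' hxV' t ht⟩

variable [T2Space M]

/-- The times at which the germs agree form an open set by local uniqueness, and this set is
relatively closed because the space is Hausdorff. -/
theorem eqOn (h : LevelFlow S ρ P) {c c' : ℝ → M} {a b t₀ : ℝ} (hc : ∀ t ∈ Ioo a b, P c t)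
    (hc' : ∀ t ∈ Ioo a b, P c' t) (ht₀ : t₀ ∈ Ioo a b) (h0 : c t₀ = c' t₀) :
    EqOn c c' (Ioo a b) := by
  have hev : ∀ {c : ℝ → M}, (∀ t ∈ Ioo a b, P c t) → ∀ t ∈ Ioo a b, ∀ᶠ s in 𝓝 t, P c s :=
    fun hc t ht => by
      filter_upwards [isOpen_Ioo.mem_nhds ht] with s hs using hc s hs
  have hsub : Ioo a b ⊆ {t | c =ᶠ[𝓝 t] c'} := by
    refine isPreconnected_Ioo.subset_of_closure_inter_subset isOpen_setOfPred_eventually_nhds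
      ⟨t₀, ht₀, h.unique (hev hc t₀ ht₀) (hev hc' t₀ ht₀) h0⟩ ?_
    rintro t ⟨ht, htI⟩
    refine h.unique (hev hc t htI) (hev hc' t htI) ?_
    by_contra hne
    have hne' : ∀ᶠ s in 𝓝 t, c s ≠ c' s := by
      obtain ⟨A, B, hA, hB, hcA, hcB, hd⟩ := t2_separation hne
      filter_upwards [(h.continuousAt (hc t htI)).eventually (hA.mem_nhds hcA),
        (h.continuousAt (hc' t htI)).eventually (hB.mem_nhds hcB)] with s hs hs' he
      exact disjoint_left.1 hd hs (he ▸ hs')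
    obtain ⟨s, hs, hs'⟩ := mem_closure_iff_nhds.1 ht _ hne'
    exact hs hs'.self_of_nhds
  exact fun t ht => (hsub ht).self_of_nhds

/-- Both time intervals contain `ρ y`, so their union is an interval. The two curves agree on the
overlap and can be glued. -/
theorem _root_.Finsler.Linked.trans (hxy : Linked ρ P x y) (hyz : Linked ρ P y z)
    (h : LevelFlow S ρ P) : Linked ρ P x z := by
  obtain ⟨c, a, b, hc, hx, hy, hcx, hcy⟩ := hxy
  obtain ⟨c', a', b', hc', hy', hz, hcy', hcz⟩ := hyz
  have hagree : EqOn c c' (Ioo (max a a') (min b b')) :=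
    h.eqOn (fun t ht => hc t ⟨(le_max_left _ _).trans_lt ht.1, ht.2.trans_le (min_le_left _ _)⟩)
      (fun t ht => hc' t ⟨(le_max_right _ _).trans_lt ht.1, ht.2.trans_le (min_le_right _ _)⟩)
      (t₀ := ρ y) ⟨max_lt hy.1 hy'.1, lt_min hy.2 hy'.2⟩ (by rw [hcy, hcy'])
  have hin : ∀ t, t ∈ Ioo a b → t ∈ Ioo a' b' → c t = c' t := fun t ht ht' =>
    hagree ⟨max_lt ht.1 ht'.1, lt_min ht.2 ht'.2⟩
  classical
  let d : ℝ → M := fun t => if t ∈ Ioo a b then c t else c' t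
  have hd1 : ∀ t ∈ Ioo a b, d t = c t := fun t ht => if_pos ht
  have hd2 : ∀ t ∈ Ioo a' b', d t = c' t := fun t ht => by
    by_cases h' : t ∈ Ioo a b
    · rw [hd1 t h', hin t h' ht]
    · exact if_neg h'
  have hun : ∀ t ∈ Ioo (min a a') (max b b'), t ∈ Ioo a b ∨ t ∈ Ioo a' b' := by
    rintro t ⟨ht1, ht2⟩
    rw [min_lt_iff] at ht1
    rw [lt_max_iff] at ht2
    have := hy.1; have := hy.2; have := hy'.1; have := hy'.2
    by_contra hcon
    simp only [mem_Ioo, not_or, not_and, not_lt] at hcon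
    rcases lt_or_ge t (ρ y) with hlt | hge
    · rcases ht1 with h1 | h1
      · linarith [hcon.1 h1]
      · linarith [hcon.2 h1]
    · rcases ht2 with h1 | h1
      · linarith [hcon.1 (by linarith)]
      · linarith [hcon.2 (by linarith)]
  have hlift : ∀ t, t ∈ Ioo a b ∨ t ∈ Ioo a' b' → t ∈ Ioo (min a a') (max b b') := by
    rintro t (ht | ht)
    · exact ⟨(min_le_left _ _).trans_lt ht.1, ht.2.trans_le (le_max_left _ _)⟩
    · exact ⟨(min_le_right _ _).trans_lt ht.1, ht.2.trans_le (le_max_right _ _)⟩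
  refine ⟨d, min a a', max b b', fun t ht => ?_, hlift _ (Or.inl hx), hlift _ (Or.inr hz),
    by rw [hd1 _ hx, hcx], by rw [hd2 _ hz, hcz]⟩
  rcases hun t ht with h1 | h1
  · refine h.congr ?_ (hc t h1)
    filter_upwards [isOpen_Ioo.mem_nhds h1] with s hs using (hd1 s hs).symm
  · refine h.congr ?_ (hc' t h1)
    filter_upwards [isOpen_Ioo.mem_nhds h1] with s hs using (hd2 s hs).symm

theorem linked_refl (h : LevelFlow S ρ P) (hx : x ∈ S) : Linked ρ P x x := by
  obtain ⟨V, hV, ε, hε, hb⟩ := h.exists_box hx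
  obtain ⟨y, hy, -⟩ := (hb x (mem_of_mem_nhds hV)).2 (ρ x) (by simpa)
  exact hy.trans hy.symm h

/-- Trajectories depend continuously on the initial point. -/
theorem _root_.Finsler.Linked.eventually (hxy : Linked ρ P x y) (h : LevelFlow S ρ P) {O : Set M}
    (hO : O ∈ 𝓝 y) : ∀ᶠ x' in 𝓝 x, ∃ y' ∈ O, Linked ρ P x' y' ∧ ρ y' = ρ y := by
  obtain ⟨c, a, b, hc, hx, hy, hcx, hcy⟩ := hxy
  -- Continuity of the passage from time t to time t' is a relation on pairs of times. It holds for
  -- nearby times by the flow box and is transitive, so it holds for all pairs in the connected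
  -- interval.
  have main := isPreconnected_Ioo.induction₂' (fun t t' => ∀ O ∈ 𝓝 (c t'), ∀ᶠ x' in 𝓝 (c t),
    ∃ y' ∈ O, Linked ρ P x' y' ∧ ρ y' = t') (s := Ioo a b) ?_ ?_ hx hy
  · rw [hcx, hcy] at main
    exact main O hO
  · intro t ht
    have hlev : ∀ s ∈ Ioo a b, ρ (c s) = s := fun s hs => h.level_curve hc hx hcx hs
    have hj : ∀ s ∈ Ioo a b, ∀ s' ∈ Ioo a b, Linked ρ P (c s) (c s') := fun s hs s' hs' =>
      (h.linked_curve hc hx hcx hs).symm.trans (h.linked_curve hc hx hcx hs') h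
    obtain ⟨V, hV, ε, hε, hb⟩ := h.exists_box (h.mem (hc t ht))
    rw [hlev t ht] at hb
    have e1 : ∀ᶠ s in 𝓝 t, c s ∈ V := (h.continuousAt (hc t ht)).eventually hV
    have e2 : ∀ᶠ s in 𝓝 t, |s - t| < ε := by
      exact Metric.ball_mem_nhds t hε
    refine eventually_nhdsWithin_of_eventually_nhds ?_
    filter_upwards [e1, e2, isOpen_Ioo.mem_nhds ht] with s hs hs' hsI
    have key : ∀ r ∈ Ioo a b, ∀ r' ∈ Ioo a b, c r ∈ V → |r' - t| < ε → ∀ O ∈ 𝓝 (c r'),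
        ∀ᶠ x' in 𝓝 (c r), ∃ y' ∈ O, Linked ρ P x' y' ∧ ρ y' = r' := by
      intro r hr r' hr' hrV hr't
      obtain ⟨y, hy1, hy2, hy3⟩ := (hb (c r) hrV).2 r' hr't
      have : y = c r' := (hy1.symm.trans (hj r hr r' hr') h).eq (by rw [hy2, hlev r' hr'])
      rwa [this] at hy3
    exact ⟨key t ht s hsI (mem_of_mem_nhds hV) hs', key s hsI t ht hs (by simpa)⟩
  · intro t t' t'' _ _ _ h1 h2 O hO
    filter_upwards [h1 _ (h2 O hO)] with x' ⟨y', hy', hj, _⟩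
    obtain ⟨y'', hy'', hj', hρ⟩ := hy'
    exact ⟨y'', hy'', hj.trans hj' h, hρ⟩

/-- Trajectories are closed in `S`. -/
theorem linked_of_mem_closure (h : LevelFlow S ρ P) (hz : z ∈ S)
    (hcl : z ∈ closure {y | Linked ρ P x y}) : Linked ρ P x z := by
  obtain ⟨V, hV, ε, hε, hb⟩ := h.exists_box hz
  obtain ⟨y, hyV, hxy⟩ := mem_closure_iff_nhds.1 hcl V hV
  obtain ⟨z', hz', hρz', -⟩ := (hb y hyV).2 (ρ z) (by simpa)
  obtain ⟨w, hw, hρw, hcont⟩ := (hb z (mem_of_mem_nhds hV)).2 (ρ z) (by simpa)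
  obtain rfl : z = w := hw.eq hρw.symm
  -- `z'` is the point of the trajectory of `x` on the level of `z`. Points `q` of this trajectory
  -- near `z` flow to that level close to `z`, yet they must arrive at `z'`; the Hausdorff property
  -- then gives `z' = z`.
  suffices z' = z by rw [← this]; exact hxy.trans hz' h
  by_contra hne
  obtain ⟨A, B, hA, hB, hzA, hzB, hd⟩ := t2_separation hne
  obtain ⟨q, hq, hxq⟩ := mem_closure_iff_nhds.1 hcl _ (hcont B (hB.mem_nhds hzB))
  obtain ⟨q', hqB, hqq', hρq'⟩ := hq
  have : z' = q' := ((hxy.trans hz' h).symm.trans (Linked.trans hxq hqq' h) h).eq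
    (by rw [hρz', hρq'])
  exact disjoint_left.1 hd hzA (this ▸ hqB)

end LevelFlow


/-! ### Flows issuing from an isolated minimum -/

/-- A neighbourhood `O` of an isolated minimum `o` of `ρ` whose sublevel sets are compact, together
with a smaller neighbourhood `N` that is still connected after removing `o`. -/
structure Well {M : Type*} [TopologicalSpace M] (S : Set M) (ρ : M → ℝ) (o : M) (O N : Set M)
    (s₁ : ℝ) : Prop where
  isOpen : IsOpen O
  notMem : o ∉ S
  lt_level : ρ o < s₁
  regular : ∀ x ∈ O, x ≠ o → x ∈ S
  lt : ∀ x ∈ O, x ≠ o → ρ o < ρ x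
  isCompact : IsCompact (O ∩ {x | ρ x ≤ s₁})
  isOpen_core : IsOpen N
  mem_core : o ∈ N
  core_subset : N ⊆ O
  core_lt : ∀ x ∈ N, ρ x < s₁
  isPreconnected : IsPreconnected (N \ {o})
  nonempty : (N \ {o}).Nonempty

namespace Well

variable {M : Type*} [TopologicalSpace M] {S : Set M} {ρ W : M → ℝ}
  {P : (ℝ → M) → ℝ → Prop} {o : M} {O N : Set M} {s₁ : ℝ} {x y p : M}

theorem exists_eventually_linked (h : LevelFlow S ρ P) (hxy : Linked ρ P x y) {O : Set M}
    (hO : O ∈ 𝓝 y) : ∀ᶠ t in 𝓝 (ρ y), ∃ z ∈ O, Linked ρ P x z ∧ ρ z = t := by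
  obtain ⟨c, a, b, hc, hx, hy, hcx, hcy⟩ := hxy
  have hcont := h.continuousAt (hc _ hy)
  rw [ContinuousAt, hcy] at hcont
  filter_upwards [hcont hO, Ioo_mem_nhds hy.1 hy.2] with t ht hab
  exact ⟨c t, ht, h.linked_curve hc hx hcx hab, h.level_curve hc hx hcx hab⟩

/-- On the compact sublevel set minus the interior of `O'`, ρ attains a minimum, which exceeds `ρ
o`. The low sublevel sets of the well therefore form a neighbourhood basis at `o`. -/
theorem shrink (w : Well S ρ o O N s₁) (hρ : Continuous ρ) {O' : Set M} (hO' : O' ∈ 𝓝 o) :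
    ∃ ε > 0, ρ o + ε ≤ s₁ ∧ ∀ y ∈ O, ρ y < ρ o + ε → y ∈ O' := by
  have hK : IsCompact ((O ∩ {x | ρ x ≤ s₁}) \ interior O') := w.isCompact.diff isOpen_interior
  rcases ((O ∩ {x | ρ x ≤ s₁}) \ interior O').eq_empty_or_nonempty with he | hne
  · refine ⟨s₁ - ρ o, sub_pos.2 w.lt_level, by linarith, fun y hy hlt => ?_⟩
    by_contra hyO
    have : y ∈ (O ∩ {x | ρ x ≤ s₁}) \ interior O' :=
      ⟨⟨hy, by simp only [mem_ofPred_eq]; linarith⟩, fun hi => hyO (interior_subset hi)⟩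
    rw [he] at this
    exact this
  · obtain ⟨z, hz, hmin⟩ := hK.exists_isMinOn hne hρ.continuousOn
    have hzo : z ≠ o := by
      rintro rfl
      exact hz.2 (mem_interior_iff_mem_nhds.2 hO')
    have h1 := w.lt z hz.1.1 hzo
    have h2 : ρ z ≤ s₁ := hz.1.2
    refine ⟨ρ z - ρ o, sub_pos.2 h1, by linarith, fun y hy hlt => ?_⟩
    by_contra hyO
    have := hmin (show y ∈ (O ∩ {x | ρ x ≤ s₁}) \ interior O' from
      ⟨⟨hy, by simp only [mem_ofPred_eq]; linarith⟩, fun hi => hyO (interior_subset hi)⟩)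
    simp only [mem_ofPred_eq] at this
    linarith

theorem core_regular (w : Well S ρ o O N s₁) {q : M} (hq : q ∈ N \ {o}) : q ∈ S :=
  w.regular q (w.core_subset hq.1) hq.2

variable [T2Space M]

/-- In the well, trajectories reach all levels. -/
theorem reach (w : Well S ρ o O N s₁) (h : LevelFlow S ρ P) (hρ : Continuous ρ) (hx : x ∈ O)
    (hxo : x ≠ o) (hx₁ : ρ x < s₁) {t : ℝ} (ht : t ∈ Ioo (ρ o) s₁) :
    ∃ y ∈ O, Linked ρ P x y ∧ ρ y = t := by
  set A : Set ℝ := {t | ∃ y ∈ O, Linked ρ P x y ∧ ρ y = t} with hA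
  have hAo : IsOpen A := by
    rw [isOpen_iff_mem_nhds]
    rintro _ ⟨y, hyO, hxy, rfl⟩
    exact exists_eventually_linked h hxy (w.isOpen.mem_nhds hyO)
  -- The bound `a > ρ o` keeps limits away from `o`. They are thus regular and stay on the
  -- trajectory, and compactness of the sublevel set makes the set of attained levels closed.
  have hclosed : ∀ a > ρ o, IsClosed (ρ '' {y | y ∈ O ∩ {x | ρ x ≤ s₁} ∧ a ≤ ρ y ∧ Linked ρ P x y}) := by
    intro a ha
    refine (IsCompact.image ?_ hρ).isClosed
    refine w.isCompact.of_isClosed_subset ?_ fun y hy => hy.1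
    refine isClosed_of_closure_subset fun z hz => ?_
    have h1 : z ∈ O ∩ {x | ρ x ≤ s₁} :=
      closure_minimal (fun y hy => hy.1) w.isCompact.isClosed hz
    have h2 : a ≤ ρ z :=
      closure_minimal (t := {y | a ≤ ρ y}) (fun y hy => hy.2.1)
        (isClosed_le continuous_const hρ) hz
    refine ⟨h1, h2, h.linked_of_mem_closure (w.regular z h1.1 ?_) (closure_mono (fun y hy => hy.2.2) hz)⟩
    rintro rfl
    exact absurd ha (not_lt.2 h2)
  refine isPreconnected_Ioo.subset_of_closure_inter_subset hAo
    ⟨ρ x, ⟨w.lt x hx hxo, hx₁⟩, x, hx, h.linked_refl (w.regular x hx hxo), rfl⟩ ?_ ht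
  rintro t ⟨htA, ht⟩
  obtain ⟨a, ha, hat⟩ := exists_between ht.1
  have h1 := isOpen_Ioo.inter_closure (show t ∈ Ioo a s₁ ∩ closure A from ⟨⟨hat, ht.2⟩, htA⟩)
  have h2 : Ioo a s₁ ∩ A ⊆ ρ '' {y | y ∈ O ∩ {x | ρ x ≤ s₁} ∧ a ≤ ρ y ∧ Linked ρ P x y} := by
    rintro _ ⟨hτ, y, hyO, hxy, rfl⟩
    exact ⟨y, ⟨⟨hyO, hτ.2.le⟩, hτ.1.le, hxy⟩, rfl⟩
  obtain ⟨y, hy, hyt⟩ := closure_minimal h2 (hclosed a ha) h1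
  exact ⟨y, hy.1.1, hy.2.2, hyt⟩

/-- Every point of the well lies on a trajectory that comes from the core. -/
theorem exists_core (w : Well S ρ o O N s₁) (h : LevelFlow S ρ P) (hρ : Continuous ρ) (hx : x ∈ O)
    (hxo : x ≠ o) (hx₁ : ρ x < s₁) : ∃ q ∈ N \ {o}, Linked ρ P x q := by
  obtain ⟨ε, hε, hε₁, hN⟩ := w.shrink hρ (w.isOpen_core.mem_nhds w.mem_core)
  obtain ⟨y, hy, hxy, hyt⟩ := w.reach h hρ hx hxo hx₁ (t := ρ o + ε / 2) ⟨by linarith, by linarith⟩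
  refine ⟨y, ⟨hN y hy (by linarith), ?_⟩, hxy⟩
  rintro rfl
  linarith

theorem reach_core (w : Well S ρ o O N s₁) (h : LevelFlow S ρ P) (hρ : Continuous ρ) {q : M}
    (hq : q ∈ N \ {o}) {t : ℝ} (ht : t ∈ Ioo (ρ o) s₁) : ∃ y ∈ O, Linked ρ P q y ∧ ρ y = t :=
  w.reach h hρ (w.core_subset hq.1) hq.2 (w.core_lt q hq.1) ht

/-- A trajectory from the core that reached the level `ρ o` would, just above it, pass through
points of the well arbitrarily close to `o`. Its point on that level would then be `o` by the
Hausdorff property, but `o` is not regular. -/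
theorem lt_of_linked (w : Well S ρ o O N s₁) (h : LevelFlow S ρ P) (hρ : Continuous ρ) {q : M}
    (hq : q ∈ N \ {o}) (hqy : Linked ρ P q y) : ρ o < ρ y := by
  by_contra! hle
  have hqo := w.lt q (w.core_subset hq.1) hq.2
  obtain ⟨c, a, b, hc, hx, hy, hcx, hcy⟩ := hqy
  have hmem : ρ o ∈ Ioo a b := ⟨hy.1.trans_le hle, hqo.trans hx.2⟩
  have hS : c (ρ o) ∈ S := h.mem (hc _ hmem)
  have hne : c (ρ o) ≠ o := fun he => w.notMem (he ▸ hS)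
  obtain ⟨u, v, hu, hv, hcu, hov, huv⟩ := t2_separation hne
  obtain ⟨ε, hε, hε₁, hN⟩ := w.shrink hρ (hv.mem_nhds hov)
  have hcont := h.continuousAt (hc _ hmem)
  obtain ⟨t, ⟨htu, htb⟩, ht⟩ := (((hcont.eventually (hu.mem_nhds hcu)).and
    (Ioo_mem_nhds hmem.1 hmem.2)).filter_mono nhdsWithin_le_nhds |>.and
      (Ioo_mem_nhdsGT (show ρ o < ρ o + ε by linarith))).exists
  obtain ⟨y', hy', hqy', hyt⟩ := w.reach_core h hρ hq (t := t) ⟨ht.1, ht.2.trans_le hε₁⟩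
  have h3 : Linked ρ P (c t) y' :=
    (h.linked_curve hc hx hcx htb).symm.trans hqy' h
  have h4 : c t = y' := h3.eq ((h.level_curve hc hx hcx htb).trans hyt.symm)
  refine disjoint_left.1 huv htu ?_
  rw [h4]
  exact hN y' hy' (by rw [hyt]; exact ht.2)

/-- A function that locally depends on `ρ` only takes a single value at the ends, on a given level,
of the trajectories from the core. -/
theorem energy_eq (w : Well S ρ o O N s₁) (h : LevelFlow S ρ P)
    (hW : ∀ z ∈ S, ∃ V ∈ 𝓝 z, ∀ x ∈ V, ∀ x' ∈ V, ρ x = ρ x' → W x = W x') {t : ℝ}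
    (ht : ∀ q ∈ N \ {o}, ∃ y, Linked ρ P q y ∧ ρ y = t) {q q' y y' : M} (hq : q ∈ N \ {o})
    (hq' : q' ∈ N \ {o}) (hy : Linked ρ P q y) (hy' : Linked ρ P q' y') (hyt : ρ y = t)
    (hyt' : ρ y' = t) : W y = W y' := by
  -- Nearby core points have nearby end points, where W is a function of ρ. So the value of W at the
  -- end points is locally constant on the connected core.
  refine w.isPreconnected.induction₂ (fun q q' => ∀ y y', Linked ρ P q y → Linked ρ P q' y' →
    ρ y = t → ρ y' = t → W y = W y') ?_ ?_ ?_ hq hq' y y' hy hy' hyt hyt'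
  · intro q hq
    obtain ⟨y, hy, hyt⟩ := ht q hq
    obtain ⟨V, hV, hVW⟩ := hW y (hy.mem_right h)
    refine nhdsWithin_le_nhds ?_
    filter_upwards [hy.eventually h hV] with q' ⟨y', hy'V, hqy', hyy'⟩ z z' hz hz' hzt hzt'
    rw [← (hy.symm.trans hz h).eq (hyt.trans hzt.symm),
      ← (hqy'.symm.trans hz' h).eq (by linarith)]
    exact hVW y (mem_of_mem_nhds hV) y' hy'V hyy'.symm
  · intro q₁ q₂ q₃ _ h2 _ h12 h23 y y' hy hy' hyt hyt'
    obtain ⟨z, hz, hzt⟩ := ht q₂ h2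
    exact (h12 y z hy hz hyt hzt).trans (h23 z y' hz hy' hzt hyt')
  · intro q₁ q₂ _ _ h12 y y' hy hy' hyt hyt'
    exact (h12 y' y hy' hy hyt' hyt).symm

/-- Trajectories along which `W` stays away from zero have a limit. -/
def ForwardComplete (ρ W : M → ℝ) (P : (ℝ → M) → ℝ → Prop) : Prop :=
  ∀ (x : M) (y : ℕ → M) (m b : ℝ), 0 < m → (∀ k, Linked ρ P x (y k)) → Monotone (fun k => ρ (y k)) →
    (∀ k, ρ (y k) ≤ b) → (∀ k l z, k ≤ l → Linked ρ P x z → ρ z ∈ Icc (ρ (y k)) (ρ (y l)) → m ≤ W z) →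
    ∃ p, Tendsto y atTop (𝓝 p)

/-- All trajectories from the core reach the same levels. -/
theorem reach_all (w : Well S ρ o O N s₁) (h : LevelFlow S ρ P) (hρ : Continuous ρ)
    (hW : ∀ z ∈ S, ∃ V ∈ 𝓝 z, ∀ x ∈ V, ∀ x' ∈ V, ρ x = ρ x' → W x = W x') (hWc : Continuous W)
    (hWS : ∀ z, z ∈ S ↔ 0 < W z) (hcomp : ForwardComplete ρ W P) {q q' : M}
    (hq : q ∈ N \ {o}) (hq' : q' ∈ N \ {o}) (hqy : Linked ρ P q y) :
    ∃ y', Linked ρ P q' y' ∧ ρ y' = ρ y := by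
  have hoy := w.lt_of_linked h hρ hq hqy
  rcases lt_or_ge (ρ y) s₁ with hlt | hge
  · obtain ⟨y', -, h1, h2⟩ := w.reach_core h hρ hq' ⟨hoy, hlt⟩
    exact ⟨y', h1, h2⟩
  obtain ⟨b, hob, hb₁⟩ := exists_between w.lt_level
  have hby : b < ρ y := hb₁.trans_le hge
  -- The levels reached by all core trajectories simultaneously. It is shown that `A` is closed and
  -- can be continued to the right inside `[b, ρ y]`, where `b` is a level within the well.
  set A : Set ℝ := {σ | ∀ q' ∈ N \ {o}, ∃ y', Linked ρ P q' y' ∧ ρ y' = σ} with hAdef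
  have hbA : b ∈ A := fun q' hq' => by
    obtain ⟨y', -, h1, h2⟩ := w.reach_core h hρ hq' ⟨hob, hb₁⟩
    exact ⟨y', h1, h2⟩
  have hbetween : ∀ σ ∈ A, ∀ τ, b ≤ τ → τ ≤ σ → τ ∈ A := by
    intro σ hσ τ hbτ hτσ q' hq'
    obtain ⟨y₁, h1, h1b⟩ := hbA q' hq'
    obtain ⟨y₂, h2, h2σ⟩ := hσ q' hq'
    obtain ⟨z, hz, hzτ⟩ := (h1.symm.trans h2 h).exists_between h (t := τ)
      (by rw [h1b, h2σ, uIcc_of_le (hbτ.trans hτσ)]; exact ⟨hbτ, hτσ⟩)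
    exact ⟨z, h1.trans hz h, hzτ⟩
  suffices hsub : Icc b (ρ y) ⊆ A from hsub ⟨hby.le, le_rfl⟩ q' hq'
  refine IsClosed.Icc_subset_of_forall_exists_gt ?_ hbA ?_
  · refine isClosed_of_closure_subset fun σ hσ => ?_
    have hσI : σ ∈ Icc b (ρ y) := closure_minimal inter_subset_right isClosed_Icc hσ
    refine ⟨?_, hσI⟩
    by_cases hex : ∃ τ ∈ A, σ ≤ τ
    · obtain ⟨τ, hτ, hστ⟩ := hex
      exact hbetween τ hτ σ hσI.1 hστ
    push Not at hex
    have hbσ : b < σ := hex b hbA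
    have hlt : ∀ τ, b ≤ τ → τ < σ → τ ∈ A := by
      intro τ hbτ hτσ
      obtain ⟨τ', h1, h2⟩ := mem_closure_iff.1 hσ (Ioi τ) isOpen_Ioi hτσ
      exact hbetween τ' h2.1 τ hbτ (le_of_lt h1)
    obtain ⟨c, α, β, hc, hx, hy, hcx, hcy⟩ := hqy
    obtain ⟨yb, hqyb, hybb⟩ := hbA q hq
    have hαq : ∀ τ ∈ Icc b σ, ∃ z, Linked ρ P q z ∧ ρ z = τ := by
      intro τ hτ
      obtain ⟨z, hz, hzτ⟩ := (hqyb.symm.trans ⟨c, α, β, hc, hx, hy, hcx, hcy⟩ h).exists_between h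
        (t := τ) (by rw [hybb, uIcc_of_le hby.le]; exact ⟨hτ.1, hτ.2.trans hσI.2⟩)
      exact ⟨z, hqyb.trans hz h, hzτ⟩
    -- The known trajectory from `q` passes the level `σ`, so W has a positive minimum on its
    -- compact part between `b` and `σ`. By `energy_eq` this bound carries over to all other core
    -- trajectories below `σ`.
    obtain ⟨m, hm, hmW⟩ : ∃ m > 0, ∀ z, Linked ρ P q z → ρ z ∈ Icc b σ → m ≤ W z := by
      obtain ⟨c', α', β', hc', hx', hy', hcx', hcy'⟩ :=
        hqyb.symm.trans ⟨c, α, β, hc, hx, hy, hcx, hcy⟩ h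
      rw [hybb] at hx'
      rw [hybb] at hcx'
      have hI : ∀ t ∈ Icc b (ρ y), t ∈ Ioo α' β' := fun t ht =>
        ⟨hx'.1.trans_le ht.1, ht.2.trans_lt hy'.2⟩
      have hcont : ContinuousOn (fun t => W (c' t)) (Icc b (ρ y)) := fun t ht =>
        (hWc.continuousAt.comp (h.continuousAt (hc' t (hI t ht)))).continuousWithinAt
      obtain ⟨t₀, ht₀, hmin⟩ := isCompact_Icc.exists_isMinOn (nonempty_Icc.2 hby.le) hcont
      refine ⟨W (c' t₀), (hWS _).1 (h.mem (hc' t₀ (hI t₀ ht₀))), fun z hz hzI => ?_⟩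
      have hzI' : ρ z ∈ Icc b (ρ y) := ⟨hzI.1, hzI.2.trans hσI.2⟩
      have h1 : Linked ρ P yb (c' (ρ z)) := h.linked_curve hc' (by rwa [hybb])
        (by rwa [hybb]) (hI _ hzI')
      have h2 : c' (ρ z) = z := ((h1.symm.trans hqyb.symm h).trans hz h).eq
        (h.level_curve hc' (x := yb) (by rwa [hybb]) (by rwa [hybb]) (hI _ hzI'))
      have := hmin hzI'
      simp only [mem_ofPred_eq] at this
      rwa [h2] at this
    intro q' hq'
    obtain ⟨u, hu, hult, hulim⟩ := exists_seq_strictMono_tendsto' hbσ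
    have huA : ∀ k, u k ∈ A := fun k => hlt _ (hult k).1.le (hult k).2
    choose yk hyk hykρ using fun k => huA k q' hq'
    -- The points of the trajectory of `q'` at levels increasing to `σ` converge by completeness.
    -- The limit has W ≥ m > 0, so it is regular and belongs to the same trajectory.
    obtain ⟨p, hp⟩ := hcomp q' yk m σ hm hyk
      (fun k l hkl => by simp only [hykρ]; exact hu.monotone hkl)
      (fun k => by rw [hykρ]; exact (hult k).2.le) (by
        intro k l z hkl hz hzI
        rw [hykρ, hykρ] at hzI
        have hzI' : ρ z ∈ Icc b σ := ⟨(hult k).1.le.trans hzI.1, hzI.2.trans (hult l).2.le⟩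
        obtain ⟨z', hz', hzz'⟩ := hαq _ hzI'
        rw [w.energy_eq h hW (hlt _ hzI'.1 (hzI.2.trans_lt (hult l).2)) hq' hq hz hz' rfl hzz']
        exact hmW z' hz' (by rwa [hzz']))
    have hρp : ρ p = σ := tendsto_nhds_unique ((hρ.tendsto p).comp hp)
      (hulim.congr fun k => (hykρ k).symm)
    have hWp : m ≤ W p := by
      refine ge_of_tendsto ((hWc.tendsto p).comp hp) (Eventually.of_forall fun k => ?_)
      have hzI' : ρ (yk k) ∈ Icc b σ := by
        rw [hykρ]; exact ⟨(hult k).1.le, (hult k).2.le⟩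
      obtain ⟨z', hz', hzz'⟩ := hαq _ hzI'
      simp only [Function.comp]
      rw [w.energy_eq h hW (huA k) hq' hq (hyk k) hz' (hykρ k) (hzz'.trans (hykρ k))]
      exact hmW z' hz' (by rwa [hzz'])
    refine ⟨p, h.linked_of_mem_closure ((hWS p).2 (hm.trans_le hWp)) ?_, hρp⟩
    exact mem_closure_of_tendsto hp (Eventually.of_forall hyk)
  · rintro σ ⟨hσA, hσI⟩ τ hτ
    have hcs : IsCompact ((O ∩ {x | ρ x ≤ s₁}) ∩ {x | ρ x = b}) :=
      w.isCompact.inter_right (isClosed_eq hρ continuous_const)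
    -- Each point of the level `b` of the well flows a little beyond `σ`, and so do its neighbours;
    -- compactness of this level makes the gain `ε` uniform.
    have hstep : ∃ ε > 0, ∀ x ∈ (O ∩ {x | ρ x ≤ s₁}) ∩ {x | ρ x = b},
        ∃ y, Linked ρ P x y ∧ σ + ε ≤ ρ y := by
      refine hcs.induction_on (p := fun T => ∃ ε > 0, ∀ x ∈ T, ∃ y, Linked ρ P x y ∧ σ + ε ≤ ρ y)
        ⟨1, one_pos, by simp⟩ ?_ ?_ ?_
      · rintro T T' hTT' ⟨ε, hε, hT⟩
        exact ⟨ε, hε, fun x hx => hT x (hTT' hx)⟩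
      · rintro T T' ⟨ε, hε, hT⟩ ⟨ε', hε', hT'⟩
        refine ⟨min ε ε', lt_min hε hε', ?_⟩
        rintro x (hx | hx)
        · obtain ⟨y, h1, h2⟩ := hT x hx
          exact ⟨y, h1, by linarith [min_le_left ε ε']⟩
        · obtain ⟨y, h1, h2⟩ := hT' x hx
          exact ⟨y, h1, by linarith [min_le_right ε ε']⟩
      · rintro x ⟨⟨hxO, -⟩, hxb⟩
        have hxb : ρ x = b := hxb
        have hxo : x ≠ o := by rintro rfl; exact hob.ne hxb
        obtain ⟨qx, hqx, hxqx⟩ := w.exists_core h hρ hxO hxo (by rw [hxb]; exact hb₁)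
        obtain ⟨yx, hyx, hyxσ⟩ := hσA qx hqx
        have h1 := exists_eventually_linked h (hxqx.trans hyx h) univ_mem
        rw [hyxσ] at h1
        obtain ⟨σ', ⟨y₂, -, hy₂, hy₂σ⟩, hσ'⟩ :=
          ((h1.filter_mono (nhdsWithin_le_nhds (s := Ioi σ))).and self_mem_nhdsWithin).exists
        refine ⟨_, nhdsWithin_le_nhds (hy₂.eventually h univ_mem), σ' - σ, sub_pos.2 hσ', ?_⟩
        rintro x' ⟨y', -, hy', hy'2⟩
        exact ⟨y', hy', by linarith⟩
    obtain ⟨ε, hε, hall⟩ := hstep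
    refine ⟨min τ (σ + ε), fun q' hq' => ?_, ⟨lt_min hτ (by linarith), min_le_left _ _⟩⟩
    obtain ⟨x, hxO, hqx, hxb⟩ := w.reach_core h hρ hq' ⟨hob, hb₁⟩
    obtain ⟨z, hz, hzε⟩ := hall x ⟨⟨hxO, by simp only [mem_ofPred_eq, hxb]; exact hb₁.le⟩, hxb⟩
    have hτ' : σ < τ := hτ
    obtain ⟨z', hz', hz'τ⟩ := hz.exists_between h (t := min τ (σ + ε)) (by
      rw [hxb, uIcc_of_le (by linarith [hσI.1])]
      exact ⟨hσI.1.trans (le_min hτ'.le (by linarith)), (min_le_right _ _).trans hzε⟩)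
    exact ⟨z', hqx.trans hz' h, hz'τ⟩

/-- Every regular point lies on a trajectory from the core. -/
theorem exists_linked_core (w : Well S ρ o O N s₁) (h : LevelFlow S ρ P) (hρ : Continuous ρ)
    (hW : ∀ z ∈ S, ∃ V ∈ 𝓝 z, ∀ x ∈ V, ∀ x' ∈ V, ρ x = ρ x' → W x = W x') (hWc : Continuous W)
    (hWS : ∀ z, z ∈ S ↔ 0 < W z) (hcomp : ForwardComplete ρ W P)
    (hS : IsPreconnected S) (hp : p ∈ S) : ∃ q ∈ N \ {o}, Linked ρ P q p := by
  obtain ⟨b, hob, hb₁⟩ := exists_between w.lt_level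
  set Ω : Set M := {p | ∃ q ∈ N \ {o}, Linked ρ P q p} with hΩ
  have hopen : IsOpen Ω := by
    rw [isOpen_iff_mem_nhds]
    rintro p ⟨q, hq, hqp⟩
    have hN : N \ {o} ∈ 𝓝 q := (w.isOpen_core.sdiff isClosed_singleton).mem_nhds hq
    filter_upwards [hqp.symm.eventually h hN] with p' ⟨q', hq', hlink, _⟩
    exact ⟨q', hq', hlink.symm⟩
  obtain ⟨q₀, hq₀⟩ := w.nonempty
  refine hS.subset_of_closure_inter_subset hopen
    ⟨q₀, w.core_regular hq₀, q₀, hq₀, h.linked_refl (w.core_regular hq₀)⟩ ?_ hp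
  rintro p ⟨hpΩ, hpS⟩
  by_contra hpn
  have hcs : IsCompact ((O ∩ {x | ρ x ≤ s₁}) ∩ {x | ρ x = b}) :=
    w.isCompact.inter_right (isClosed_eq hρ continuous_const)
  -- Suppose `p` is a regular limit of core trajectories but lies on none. Then each point of the
  -- compact level `b` has a neighbourhood whose trajectories avoid a neighbourhood of `p` on the
  -- level of `p`, and finitely many of these cover the level `b`.
  have hdisj : ∃ O' ∈ 𝓝 p, ∀ x ∈ (O ∩ {x | ρ x ≤ s₁}) ∩ {x | ρ x = b}, ∀ y ∈ O', ρ y = ρ p →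
      y ∈ Ω → ¬ Linked ρ P x y := by
    refine hcs.induction_on (p := fun T => ∃ O' ∈ 𝓝 p, ∀ x ∈ T, ∀ y ∈ O', ρ y = ρ p →
      y ∈ Ω → ¬ Linked ρ P x y) ⟨univ, univ_mem, by simp⟩ ?_ ?_ ?_
    · rintro T T' hTT' ⟨O', hO', hT⟩
      exact ⟨O', hO', fun x hx => hT x (hTT' hx)⟩
    · rintro T T' ⟨O', hO', hT⟩ ⟨O'', hO'', hT'⟩
      refine ⟨O' ∩ O'', inter_mem hO' hO'', ?_⟩
      rintro x (hx | hx) y hy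
      · exact hT x hx y hy.1
      · exact hT' x hx y hy.2
    · rintro x ⟨⟨hxO, -⟩, hxb⟩
      have hxb : ρ x = b := hxb
      have hxo : x ≠ o := by rintro rfl; exact hob.ne hxb
      obtain ⟨qx, hqx, hxqx⟩ := w.exists_core h hρ hxO hxo (by rw [hxb]; exact hb₁)
      -- If some core trajectory reaches the level of `p`, then all of them do, and the points
      -- reached can be separated from `p`. If none does, nothing has to be avoided.
      by_cases hex : ∃ q ∈ N \ {o}, ∃ y, Linked ρ P q y ∧ ρ y = ρ p
      · obtain ⟨q, hq, y, hqy, hyp⟩ := hex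
        obtain ⟨y', hy', hyy'⟩ := w.reach_all h hρ hW hWc hWS hcomp hq hqx hqy
        have hxy' := hxqx.trans hy' h
        have hne : y' ≠ p := by
          rintro rfl
          exact hpn ⟨qx, hqx, hy'⟩
        obtain ⟨u, v, hu, hv, hyu, hpv, huv⟩ := t2_separation hne
        refine ⟨_, nhdsWithin_le_nhds (hxy'.eventually h (hu.mem_nhds hyu)), v, hv.mem_nhds hpv, ?_⟩
        rintro x' ⟨z, hzu, hx'z, hzy'⟩ y₂ hy₂ hy₂p - hlink
        have : y₂ = z := (hlink.symm.trans hx'z h).eq (by linarith)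
        exact disjoint_left.1 huv hzu (this ▸ hy₂)
      · refine ⟨univ, univ_mem, univ, univ_mem, ?_⟩
        rintro x' - y - hyp ⟨q, hq, hqy⟩
        exact absurd ⟨q, hq, y, hqy, hyp⟩ hex
  obtain ⟨O', hO', hall⟩ := hdisj
  obtain ⟨p', hp', hp'Ω⟩ := mem_closure_iff_nhds.1 hpΩ _ ((h.linked_refl hpS).eventually h hO')
  obtain ⟨y, hyO', hp'y, hyp⟩ := hp'
  obtain ⟨q, hq, hqp'⟩ := hp'Ω
  obtain ⟨x, hxO, hqx, hxb⟩ := w.reach_core h hρ hq ⟨hob, hb₁⟩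
  have hqy := hqp'.trans hp'y h
  exact hall x ⟨⟨hxO, by simp only [mem_ofPred_eq, hxb]; exact hb₁.le⟩, hxb⟩ y hyO' hyp ⟨q, hq, hqy⟩
    (hqx.symm.trans hqy h)

end Well


/-! ### Connectedness of the regular set, and radial flows -/

/-- Removing a discrete closed set of points at which the space is not disconnected locally does not
disconnect the space. -/
theorem isPreconnected_of_isolated_compl {M : Type*} [TopologicalSpace M] [PreconnectedSpace M]
    {S : Set M} (hS : IsOpen S)
    (hN : ∀ z ∉ S, ∃ N ∈ 𝓝 z, IsPreconnected (N \ {z}) ∧ N \ {z} ⊆ S ∧ z ∈ closure (N \ {z})) :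
    IsPreconnected S := by
  rw [isPreconnected_iff_subset_of_disjoint]
  intro u v hu hv hSuv hdisj
  have hdisj' : ∀ p ∈ S, p ∈ u → p ∉ v := fun p hpS hpu hpv => by
    have : p ∈ S ∩ (u ∩ v) := ⟨hpS, hpu, hpv⟩
    rw [hdisj] at this
    exact this
  by_cases hne : (S ∩ u).Nonempty
  swap
  · right
    intro p hp
    exact (hSuv hp).resolve_left fun hpu => hne ⟨p, hp, hpu⟩
  left
  -- At a removed point in the closure of `S ∩ u`, the connected punctured neighbourhood meets `u`,
  -- hence lies in `u`, so the whole neighbourhood belongs to this closure.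
  have hopen : IsOpen (closure (S ∩ u)) := by
    rw [isOpen_iff_mem_nhds]
    intro p hp
    by_cases hpS : p ∈ S
    · refine mem_of_superset ((hS.inter hu).mem_nhds ⟨hpS, ?_⟩) subset_closure
      refine (hSuv hpS).resolve_right fun hpv => ?_
      obtain ⟨x, ⟨hxS, hxv⟩, -, hxu⟩ := mem_closure_iff.1 hp (S ∩ v) (hS.inter hv) ⟨hpS, hpv⟩
      exact hdisj' x hxS hxu hxv
    · obtain ⟨N, hNp, hNc, hNS, hpN⟩ := hN p hpS
      obtain ⟨x, hxN, hxS, hxu⟩ := mem_closure_iff_nhds.1 hp N hNp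
      have hxp : x ≠ p := by rintro rfl; exact hpS hxS
      have h1 : N \ {p} ⊆ u := by
        rw [isPreconnected_iff_subset_of_disjoint] at hNc
        refine (hNc u v hu hv (hNS.trans hSuv) ?_).resolve_right fun hv' =>
          hdisj' x hxS hxu (hv' ⟨hxN, hxp⟩)
        refine eq_empty_of_forall_notMem fun y hy => hdisj' y (hNS hy.1) hy.2.1 hy.2.2
      refine mem_of_superset hNp fun y hy => ?_
      by_cases hyp : y = p
      · rw [hyp]; exact hp
      · exact subset_closure ⟨hNS ⟨hy, hyp⟩, h1 ⟨hy, hyp⟩⟩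
  have huniv : closure (S ∩ u) = univ :=
    IsClopen.eq_univ ⟨isClosed_closure, hopen⟩ hne.closure
  intro p hp
  refine (hSuv hp).resolve_right fun hpv => ?_
  obtain ⟨x, ⟨hxS, hxv⟩, -, hxu⟩ := mem_closure_iff.1 (huniv ▸ mem_univ p : p ∈ closure (S ∩ u))
    (S ∩ v) (hS.inter hv) ⟨hp, hpv⟩
  exact hdisj' x hxS hxu hxv

/-- A flow all of whose trajectories issue from the point `o`. -/
structure RadialFlow {M : Type*} [TopologicalSpace M] (S : Set M) (ρ W : M → ℝ)
    (P : (ℝ → M) → ℝ → Prop) (o : M) : Prop where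
  flow : LevelFlow S ρ P
  lt : ∀ p ∈ S, ρ o < ρ p
  energy_eq : ∀ p ∈ S, ∀ p' ∈ S, ρ p = ρ p' → W p = W p'
  isPreconnected_level : ∀ c, IsPreconnected {p | p ∈ S ∧ ρ p = c}
  reach : ∀ p ∈ S, ∀ t ∈ Ioc (ρ o) (ρ p), ∃ y, Linked ρ P p y ∧ ρ y = t
  shrink : ∀ O' ∈ 𝓝 o, ∃ ε > 0, ∀ p ∈ S, ρ p < ρ o + ε → p ∈ O'

theorem Well.radialFlow {M : Type*} [TopologicalSpace M] [T2Space M] {S : Set M} {ρ W : M → ℝ}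
    {P : (ℝ → M) → ℝ → Prop} {o : M} {O N : Set M} {s₁ : ℝ} (w : Well S ρ o O N s₁)
    (h : LevelFlow S ρ P) (hρ : Continuous ρ)
    (hW : ∀ z ∈ S, ∃ V ∈ 𝓝 z, ∀ x ∈ V, ∀ x' ∈ V, ρ x = ρ x' → W x = W x') (hWc : Continuous W)
    (hWS : ∀ z, z ∈ S ↔ 0 < W z) (hcomp : ForwardComplete ρ W P)
    (hS : IsPreconnected S) : RadialFlow S ρ W P o := by
  have hcore : ∀ p ∈ S, ∃ q ∈ N \ {o}, Linked ρ P q p := fun p hp =>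
    w.exists_linked_core h hρ hW hWc hWS hcomp hS hp
  have hreach : ∀ p ∈ S, ∀ q ∈ N \ {o}, ∃ y, Linked ρ P q y ∧ ρ y = ρ p := fun p hp q hq => by
    obtain ⟨q', hq', hq'p⟩ := hcore p hp
    exact w.reach_all h hρ hW hWc hWS hcomp hq' hq hq'p
  refine ⟨h, ?_, ?_, ?_, ?_, ?_⟩
  · intro p hp
    obtain ⟨q, hq, hqp⟩ := hcore p hp
    exact w.lt_of_linked h hρ hq hqp
  · intro p hp p' hp' hpp'
    obtain ⟨q, hq, hqp⟩ := hcore p hp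
    obtain ⟨q', hq', hqp'⟩ := hcore p' hp'
    exact w.energy_eq h hW (hreach p hp) hq hq' hqp hqp' rfl hpp'.symm
  · intro c
    by_cases hne : ∃ p ∈ S, ρ p = c
    swap
    · have : {p | p ∈ S ∧ ρ p = c} = ∅ :=
        eq_empty_of_forall_notMem fun p hp => hne ⟨p, hp.1, hp.2⟩
      rw [this]
      exact isPreconnected_empty
    obtain ⟨p, hp, rfl⟩ := hne
    -- `f` follows each trajectory from the core to the given level. It is continuous and onto that
    -- level, so the level inherits connectedness from the core.
    choose! f hf hfρ using hreach p hp
    have himage : {p' | p' ∈ S ∧ ρ p' = ρ p} = f '' (N \ {o}) := by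
      ext p'
      constructor
      · rintro ⟨hp'S, hp'⟩
        obtain ⟨q, hq, hqp'⟩ := hcore p' hp'S
        exact ⟨q, hq, ((hf q hq).symm.trans hqp' h).eq ((hfρ q hq).trans hp'.symm)⟩
      · rintro ⟨q, hq, rfl⟩
        exact ⟨(hf q hq).mem_right h, hfρ q hq⟩
    rw [himage]
    refine w.isPreconnected.image f fun q hq => ?_
    refine (tendsto_def.2 fun O hO => ?_ : Tendsto f (𝓝[N \ {o}] q) (𝓝 (f q)))
    filter_upwards [nhdsWithin_le_nhds ((hf q hq).eventually h hO), self_mem_nhdsWithin]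
      with q' ⟨y, hyO, hy, hyρ⟩ hq'
    have : f q' = y := ((hf q' hq').symm.trans hy h).eq
      ((hfρ q' hq').trans ((hfρ q hq).symm.trans hyρ.symm))
    simpa [this] using hyO
  · intro p hp t ht
    obtain ⟨q, hq, hqp⟩ := hcore p hp
    obtain ⟨t', ht', ht's⟩ := exists_between w.lt_level
    have hot : ρ o < min t t' := lt_min ht.1 ht'
    obtain ⟨y, -, hqy, hyt⟩ := w.reach_core h hρ hq (t := min t t')
      ⟨hot, (min_le_right _ _).trans_lt ht's⟩
    have hpy := hqp.symm.trans hqy h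
    refine hpy.exists_between h ?_ |>.imp fun z hz => hz
    rw [hyt, uIcc_of_ge ((min_le_left _ _).trans ht.2)]
    exact ⟨min_le_left _ _, ht.2⟩
  · intro O' hO'
    obtain ⟨ε, hε, hε₁, hO⟩ := w.shrink hρ hO'
    refine ⟨ε, hε, fun p hp hpε => ?_⟩
    obtain ⟨q, hq, hqp⟩ := hcore p hp
    obtain ⟨y, hy, hqy, hyp⟩ := w.reach_core h hρ hq (t := ρ p)
      ⟨w.lt_of_linked h hρ hq hqp, by linarith⟩
    rw [(hqp.symm.trans hqy h).eq hyp.symm]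
    exact hO y hy (by rwa [hyp])


/-! ### Calculus and differential equations in normed spaces -/

section NormedSpace

variable {E : Type*} [NormedAddCommGroup E] [NormedSpace ℝ E]

/-- If `dW` is a multiple of `dρ ≠ 0`, then `W` is locally a function of `ρ`. -/
theorem exists_nhds_eq_of_eq [CompleteSpace E] {f W k : E → ℝ} {u : E} (hf : ContDiffAt ℝ 1 f u)
    (hfu : fderiv ℝ f u ≠ 0) (hW : ∀ᶠ x in 𝓝 u, HasFDerivAt W (k x • fderiv ℝ f x) x) :
    ∃ V ∈ 𝓝 u, ∀ x ∈ V, ∀ x' ∈ V, f x = f x' → W x = W x' := by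
  set l := fderiv ℝ f u with hl
  obtain ⟨v₀, hv₀⟩ : ∃ v, l v ≠ 0 := by
    by_contra! hall
    exact hfu (ContinuousLinearMap.ext hall)
  set v := (l v₀)⁻¹ • v₀
  have hlv : l v = 1 := by simp [v, hv₀]
  -- Θ straightens f: it has derivative the identity at `u`, and f = l ∘ Θ. In the new coordinates
  -- dW is a multiple of `l`, so W is constant along segments in the kernel direction of `l`; a ball
  -- contains these by convexity.
  set Θ : E → E := fun x => x + (f x - l x) • v with hΘ
  have hlΘ : ∀ x, l (Θ x) = f x := fun x => by simp [hΘ, hlv]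
  have hΘd : HasFDerivAt Θ ((ContinuousLinearEquiv.refl ℝ E : E ≃L[ℝ] E) : E →L[ℝ] E) u := by
    have h1 := (hasFDerivAt_id (𝕜 := ℝ) u).add
      (((hf.differentiableAt one_ne_zero).hasFDerivAt.sub l.hasFDerivAt).smul_const v)
    refine h1.congr_fderiv (ContinuousLinearMap.ext fun w => ?_)
    simp [hl]
  have hΘc : ContDiffAt ℝ 1 Θ u :=
    contDiffAt_id.add ((hf.sub l.contDiff.contDiffAt).smul contDiffAt_const)
  have hs := hΘc.hasStrictFDerivAt' hΘd one_ne_zero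
  set Ψ := hΘc.localInverse hΘd one_ne_zero with hΨ
  have hΨc : ContDiffAt ℝ 1 Ψ (Θ u) := hΘc.to_localInverse hΘd one_ne_zero
  have hright : ∀ᶠ y in 𝓝 (Θ u), Θ (Ψ y) = y := hs.eventually_right_inverse
  have hleft : ∀ᶠ x in 𝓝 u, Ψ (Θ x) = x := hs.eventually_left_inverse
  have hΨu : Ψ (Θ u) = u := hleft.self_of_nhds
  have hΨt : Tendsto Ψ (𝓝 (Θ u)) (𝓝 u) := by
    have := hΨc.continuousAt
    rwa [ContinuousAt, hΨu] at this
  have hfd : ∀ᶠ x in 𝓝 u, DifferentiableAt ℝ f x :=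
    (hf.eventually (by simp)).mono fun x hx => hx.differentiableAt one_ne_zero
  have hΨd : ∀ᶠ y in 𝓝 (Θ u), DifferentiableAt ℝ Ψ y :=
    (hΨc.eventually (by simp)).mono fun x hx => hx.differentiableAt one_ne_zero
  have hgood : ∀ᶠ y in 𝓝 (Θ u), HasFDerivAt (fun y => W (Ψ y)) (k (Ψ y) • l) y := by
    filter_upwards [hΨt.eventually hW, hΨt.eventually hfd, hΨd, hright.eventually_nhds]
      with y h1 h2 h3 h4
    have h5 := h2.hasFDerivAt.comp y h3.hasFDerivAt
    have h6 : HasFDerivAt (fun y => f (Ψ y)) l y := by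
      refine l.hasFDerivAt.congr_of_eventuallyEq (h4.mono fun z hz => ?_)
      simp only
      rw [← hlΘ, hz]
    have h7 := h5.unique h6
    refine (h1.comp y h3.hasFDerivAt).congr_fderiv ?_
    rw [ContinuousLinearMap.smul_comp, h7]
  obtain ⟨r, hr, hball⟩ := Metric.eventually_nhds_iff_ball.1 hgood
  refine ⟨_, inter_mem hleft (hΘc.continuousAt (Metric.ball_mem_nhds _ hr)), ?_⟩
  rintro x ⟨hx, hxb⟩ x' ⟨hx', hxb'⟩ hxx'
  simp only [mem_ofPred_eq] at hx hx'
  rw [← hx, ← hx']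
  set y := Θ x
  set y' := Θ x'
  have hly : l (y' - y) = 0 := by rw [map_sub, hlΘ, hlΘ, hxx', sub_self]
  have hder : ∀ t ∈ Icc (0 : ℝ) 1, HasDerivAt (fun t : ℝ => W (Ψ (y + t • (y' - y)))) 0 t := by
    intro t ht
    have hmem : y + t • (y' - y) ∈ Metric.ball (Θ u) r :=
      (convex_ball _ _).add_smul_sub_mem hxb hxb' ht
    have h1 := (hball _ hmem).comp_hasDerivAt t
      (by simpa using ((hasDerivAt_id t).smul_const (y' - y)).const_add y :
        HasDerivAt (fun t : ℝ => y + t • (y' - y)) (y' - y) t)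
    refine h1.congr_deriv ?_
    simp [hly]
  have := constant_of_has_deriv_right_zero
    (fun t ht => (hder t ht).continuousAt.continuousWithinAt)
    (fun t ht => (hder t (Ico_subset_Icc_self ht)).hasDerivWithinAt) 1 (right_mem_Icc.2 zero_le_one)
  simpa using this.symm

/-- Polar coordinates: the punctured ball is the image of an interval times the unit sphere, which
is connected in dimension at least two. -/
theorem isPreconnected_ball_diff_center (hE : 1 < Module.rank ℝ E) (x : E) (r : ℝ) :
    IsPreconnected (Metric.ball x r \ {x}) := by
  have : Metric.ball x r \ {x} =
      (fun p : ℝ × E => x + p.1 • p.2) '' (Ioo 0 r ×ˢ Metric.sphere 0 1) := by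
    ext y
    constructor
    · rintro ⟨hy, hyx⟩
      have h0 : 0 < ‖y - x‖ := norm_pos_iff.2 (sub_ne_zero.2 hyx)
      refine ⟨(‖y - x‖, ‖y - x‖⁻¹ • (y - x)), ⟨⟨h0, mem_ball_iff_norm.1 hy⟩, ?_⟩, ?_⟩
      · simp [norm_smul, h0.ne']
      · simp [smul_smul, h0.ne']
    · rintro ⟨⟨t, e⟩, ⟨ht, he⟩, rfl⟩
      have he1 : ‖e‖ = 1 := by simpa using he
      have he0 : e ≠ 0 := by rintro rfl; simp at he1
      refine ⟨?_, ?_⟩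
      · simpa [mem_ball_iff_norm, norm_smul, he1, abs_of_pos ht.1] using ht.2
      · simp [he0, ht.1.ne']
  rw [this]
  exact (isPreconnected_Ioo.prod (isPreconnected_sphere hE 0 1)).image _ (by fun_prop)

/-- At a critical point with positive definite Hessian the function has a strict local minimum, and
grows along the rays. -/
theorem eventually_lt_of_hessian [FiniteDimensional ℝ E] {f : E → ℝ} {u : E} (hf : ContDiffAt ℝ 2 f u)
    (hfu : fderiv ℝ f u = 0) (hpos : ∀ v ≠ 0, 0 < fderiv ℝ (fderiv ℝ f) u v v) :
    ∀ᶠ x in 𝓝 u, x ≠ u → f u < f x ∧ fderiv ℝ f x ≠ 0 := by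
  set A := fderiv ℝ (fderiv ℝ f) u with hA
  have hd : HasFDerivAt (fderiv ℝ f) A u :=
    ((hf.fderiv_right (m := 1) (by norm_num)).differentiableAt one_ne_zero).hasFDerivAt
  -- `m` is the minimum of the quadratic form on the unit sphere; any positive number does when the
  -- space is trivial.
  obtain ⟨m, hm, hmA⟩ : ∃ m > 0, ∀ v, m * ‖v‖ ^ 2 ≤ A v v := by
    by_cases hE : ∃ e : E, ‖e‖ = 1
    · have hK : IsCompact (Metric.sphere (0 : E) 1) := isCompact_sphere _ _
      obtain ⟨e, he, hmin⟩ := hK.exists_isMinOn (f := fun v => A v v)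
        (by obtain ⟨e, he⟩ := hE; exact ⟨e, by simpa using he⟩) (by fun_prop)
      have he1 : ‖e‖ = 1 := by simpa using he
      refine ⟨A e e, hpos e (by rintro rfl; simp at he1), fun v => ?_⟩
      by_cases hv : v = 0
      · simp [hv]
      have h0 : 0 < ‖v‖ := norm_pos_iff.2 hv
      have h1 := hmin (show ‖v‖⁻¹ • v ∈ Metric.sphere (0 : E) 1 by simp [norm_smul, h0.ne'])
      simp only [mem_ofPred_eq, map_smul, _root_.smul_apply, smul_eq_mul] at h1
      calc A e e * ‖v‖ ^ 2 ≤ (‖v‖⁻¹ * (‖v‖⁻¹ * A v v)) * ‖v‖ ^ 2 := by gcongr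
        _ = A v v := by field_simp
    · refine ⟨1, one_pos, fun v => ?_⟩
      have hv : v = 0 := by
        by_contra hv
        exact hE ⟨‖v‖⁻¹ • v, by simp [norm_smul, norm_ne_zero_iff.2 hv]⟩
      simp [hv]
  have hev : ∀ᶠ x in 𝓝 u, DifferentiableAt ℝ f x ∧ (x ≠ u → 0 < fderiv ℝ f x (x - u)) := by
    have h1 := hd.isLittleO.bound (show 0 < m / 2 by positivity)
    filter_upwards [h1, (hf.eventually (by simp)).mono fun x hx => hx.differentiableAt two_ne_zero]
      with x hx hxd
    refine ⟨hxd, fun hxu => ?_⟩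
    have h0 : 0 < ‖x - u‖ := norm_pos_iff.2 (sub_ne_zero.2 hxu)
    rw [hfu, sub_zero] at hx
    have h2 := (fderiv ℝ f x - A (x - u)).le_opNorm (x - u)
    have h3 : ‖(fderiv ℝ f x - A (x - u)) (x - u)‖ ≤ m / 2 * ‖x - u‖ ^ 2 := by
      refine h2.trans ?_
      rw [sq, ← mul_assoc]
      gcongr
    have h4 := hmA (x - u)
    rw [_root_.sub_apply, Real.norm_eq_abs] at h3
    have h5 := (abs_le.1 h3).1
    have : 0 < m / 2 * ‖x - u‖ ^ 2 := by positivity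
    linarith
  obtain ⟨r, hr, hball⟩ := Metric.eventually_nhds_iff_ball.1 hev
  filter_upwards [Metric.ball_mem_nhds u hr] with x hx hxu
  have hpt : ∀ t ∈ Icc (0 : ℝ) 1, u + t • (x - u) ∈ Metric.ball u r := by
    intro t ht
    rw [mem_ball_iff_norm] at hx ⊢
    rw [add_sub_cancel_left, norm_smul, Real.norm_eq_abs, abs_of_nonneg ht.1]
    nlinarith [norm_nonneg (x - u), ht.2]
  have hder : ∀ t ∈ Icc (0 : ℝ) 1, HasDerivAt (fun t : ℝ => f (u + t • (x - u)))
      (fderiv ℝ f (u + t • (x - u)) (x - u)) t := by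
    intro t ht
    refine (hball _ (hpt t ht)).1.hasFDerivAt.comp_hasDerivAt t ?_
    simpa using ((hasDerivAt_id t).smul_const (x - u)).const_add u
  constructor
  · have := strictMonoOn_of_deriv_pos (convex_Icc (0 : ℝ) 1)
      (fun t ht => (hder t ht).continuousAt.continuousWithinAt) (fun t ht => ?_)
      (left_mem_Icc.2 zero_le_one) (right_mem_Icc.2 zero_le_one) one_pos
    · simpa using this
    · rw [interior_Icc] at ht
      rw [(hder t (Ioo_subset_Icc_self ht)).deriv]
      have h1 := (hball _ (hpt t (Ioo_subset_Icc_self ht))).2 (by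
        simp [ht.1.ne', sub_ne_zero.2 hxu])
      rw [add_sub_cancel_left, map_smul, smul_eq_mul] at h1
      exact pos_of_mul_pos_right h1 ht.1.le
  · intro h0
    have := (hball x hx).2 hxu
    rw [h0] at this
    simp at this

/-- The local flow of a `C¹` vector field. -/
theorem exists_local_flow [CompleteSpace E] {X : E → E} {z : E} (hX : ContDiffAt ℝ 1 X z) {R : Set E}
    (hR : R ∈ 𝓝 z) : ∃ β : E → ℝ → E, ∃ δ > 0, ∃ ε > 0,
      (∀ x ∈ Metric.ball z δ, β x 0 = x ∧
        ∀ s ∈ Ioo (-ε) ε, HasDerivAt (β x) (X (β x s)) s ∧ β x s ∈ R) ∧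
      ContinuousOn (fun p : E × ℝ => β p.1 p.2) (Metric.ball z δ ×ˢ Ioo (-ε) ε) := by
  obtain ⟨ε, hε, a, r, _, _, hr, hpl⟩ := IsPicardLindelof.of_contDiffAt_one hX
  obtain ⟨α, hα, hcont⟩ := (hpl 0).exists_forall_mem_closedBall_eq_hasDerivWithinAt_continuousOn
  simp only [zero_sub, zero_add] at hα hcont
  have hc : ContinuousAt α (z, 0) := hcont.continuousAt
    (prod_mem_nhds (Metric.closedBall_mem_nhds _ hr) (Icc_mem_nhds (by linarith) hε))
  have hz : α (z, 0) = z := (hα z (Metric.mem_closedBall_self r.2)).1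
  rw [ContinuousAt, hz] at hc
  obtain ⟨δ, hδ, hsub⟩ := Metric.mem_nhds_iff.1 (hc hR)
  have hsub' : ∀ x s, x ∈ Metric.ball z δ → s ∈ Ioo (-δ) δ → α (x, s) ∈ R := by
    intro x s hx hs
    refine hsub ?_
    rw [← ball_prod_same]
    refine ⟨hx, ?_⟩
    rw [Real.ball_eq_Ioo]
    simpa using hs
  refine ⟨fun x s => α (x, s), min δ r, lt_min hδ hr, min δ ε, lt_min hδ hε, ?_, ?_⟩
  · intro x hx
    have hxr := Metric.ball_subset_closedBall (Metric.ball_subset_ball (min_le_right δ (r : ℝ)) hx)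
    refine ⟨(hα x hxr).1, fun s hs => ?_⟩
    have hs1 : s ∈ Ioo (-ε) ε := ⟨by linarith [hs.1, min_le_right δ ε], hs.2.trans_le (min_le_right _ _)⟩
    exact ⟨((hα x hxr).2 s (Ioo_subset_Icc_self hs1)).hasDerivAt (Icc_mem_nhds hs1.1 hs1.2),
      hsub' x s (Metric.ball_subset_ball (min_le_left _ _) hx)
        ⟨by linarith [hs.1, min_le_left δ ε], hs.2.trans_le (min_le_left _ _)⟩⟩
  · refine hcont.mono (prod_mono ?_ ?_)
    · exact (Metric.ball_subset_ball (min_le_right δ (r : ℝ))).trans Metric.ball_subset_closedBall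
    · exact fun s hs => ⟨by linarith [hs.1, min_le_right δ ε], hs.2.le.trans (min_le_right _ _)⟩

theorem ode_unique {X : E → E} {c c' : ℝ → E} {t : ℝ} (hX : ContDiffAt ℝ 1 X (c t))
    (hc : ∀ᶠ s in 𝓝 t, HasDerivAt c (X (c s)) s) (hc' : ∀ᶠ s in 𝓝 t, HasDerivAt c' (X (c' s)) s)
    (heq : c t = c' t) : c =ᶠ[𝓝 t] c' := by
  obtain ⟨K, s, hs, hl⟩ := hX.exists_lipschitzOnWith
  refine ODE_solution_unique_of_eventually (v := fun _ => X) (s := fun _ => s)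
    (Eventually.of_forall fun _ => hl) (hc.and ?_) (hc'.and ?_) heq
  · exact hc.self_of_nhds.continuousAt hs
  · exact hc'.self_of_nhds.continuousAt (by rwa [← heq])

end NormedSpace

/-! ### Energy and Hessian at the critical points -/

namespace LocalSolution

variable {n : ℕ} {U : Set (Coord n)} {L : Coord n → Coord n → ℝ} {ρ φ : Coord n → ℝ}
  {u v : Coord n}

theorem localGrad_eq_zero (h : LocalSolution U L ρ φ) (hu : u ∈ U) (hρ : fderiv ℝ ρ u = 0) :
    localGrad L ρ u = 0 := by
  refine h.finsler.isGrad_unique hu (p := fderiv ℝ ρ u) (fun z => ?_) (h.finsler.isGrad_localGrad hu ρ)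
  rw [hρ, h.finsler.map_zero]
  simp only [_root_.zero_apply, zero_sub]
  nlinarith [sq_nonneg (L u z)]

theorem localEnergy_eq_zero (h : LocalSolution U L ρ φ) (hu : u ∈ U) (hρ : fderiv ℝ ρ u = 0) :
    localEnergy L ρ u = 0 := by
  rw [localEnergy, h.localGrad_eq_zero hu hρ, h.finsler.map_zero]
  norm_num

theorem localEnergy_pos (h : LocalSolution U L ρ φ) (hu : u ∈ U) (hρ : fderiv ℝ ρ u ≠ 0) :
    0 < localEnergy L ρ u := by
  have := h.finsler.pos hu (h.finsler.localGrad_ne_zero hu hρ)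
  unfold localEnergy
  positivity

open Asymptotics in
/-- `dW = φ dρ`, also at the critical points. -/
theorem hasFDerivAt_energy (h : LocalSolution U L ρ φ) (hu : u ∈ U) :
    HasFDerivAt (localEnergy L ρ) (φ u • fderiv ℝ ρ u) u := by
  by_cases hρ : fderiv ℝ ρ u = 0
  swap
  · exact h.hasFDerivAt_localEnergy hu hρ
  have hF := h.finsler
  rw [hρ, smul_zero]
  obtain ⟨a, C, ha, hC, hb⟩ := hF.exists_bounds hu
  have hd : (fderiv ℝ ρ) =O[𝓝 u] fun x => x - u := by
    have h1 : ContDiffAt ℝ 1 (fderiv ℝ ρ) u :=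
      (h.smooth.contDiffAt (h.isOpen.mem_nhds hu)).fderiv_right (m := 1)
        (one_add_one_eq_two.trans_le two_le_infty)
    simpa [hρ] using (h1.differentiableAt one_ne_zero).hasFDerivAt.isBigO_sub
  -- Smoothness of the gradient was obtained only at regular points. At a critical point it is
  -- enough that W is bounded by a multiple of |dρ|², hence of second order.
  have hWO : localEnergy L ρ =O[𝓝 u] fun x => ‖fderiv ℝ ρ x‖ ^ 2 := by
    refine IsBigO.of_bound (1 / (2 * a ^ 2)) ?_
    filter_upwards [hb, h.isOpen.mem_nhds hu] with x hx hxU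
    set y := localGrad L ρ x
    have h1 := (hF.isGrad_localGrad hxU ρ).apply_self hF hxU
    have h2 : L x y ^ 2 ≤ ‖fderiv ℝ ρ x‖ * ‖y‖ := by
      rw [← h1]
      exact (le_abs_self _).trans ((fderiv ℝ ρ x).le_opNorm y)
    have h3 := (hx y).1
    have h4 : a * L x y ≤ ‖fderiv ℝ ρ x‖ := by
      by_cases h0 : L x y = 0
      · rw [h0, mul_zero]; exact norm_nonneg _
      have h0' : 0 < L x y := lt_of_le_of_ne (hF.nonneg _ _) (Ne.symm h0)
      refine le_of_mul_le_mul_right ?_ h0'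
      nlinarith [norm_nonneg (fderiv ℝ ρ x), norm_nonneg y]
    have h5 : (a * L x y) ^ 2 ≤ ‖fderiv ℝ ρ x‖ ^ 2 :=
      pow_le_pow_left₀ (mul_nonneg ha.le (hF.nonneg _ _)) h4 2
    have e1 : localEnergy L ρ x = L x y ^ 2 / 2 := rfl
    rw [Real.norm_of_nonneg (by rw [e1]; positivity), Real.norm_of_nonneg (by positivity), e1,
      div_mul_eq_mul_div, one_mul, le_div_iff₀ (by positivity)]
    nlinarith
  refine HasFDerivAt.of_isLittleO ?_
  simp only [h.localEnergy_eq_zero hu hρ, sub_zero, _root_.zero_apply]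
  have h2 : (fun x => ‖fderiv ℝ ρ x‖ ^ 2) =O[𝓝 u] fun x => ‖x - u‖ ^ 2 := (hd.norm_norm).pow 2
  refine (hWO.trans h2).trans_isLittleO ?_
  have h3 : (fun x : Coord n => ‖x - u‖ ^ 2) =o[𝓝 u] fun x => ‖x - u‖ := by
    have h4 : Tendsto (fun x : Coord n => ‖x - u‖) (𝓝 u) (𝓝 0) := by
      have : ContinuousAt (fun x : Coord n => ‖x - u‖) u := by fun_prop
      simpa [ContinuousAt] using this
    exact (isLittleO_pow_id one_lt_two).comp_tendsto h4
  exact h3.of_norm_right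

/-- At a critical point the connection term vanishes, so the reference direction of g is free.
Choosing `v` itself turns g(v, v) into L(v)². -/
theorem hessian_apply_self (h : LocalSolution U L ρ φ) (hu : u ∈ U) (hρ : fderiv ℝ ρ u = 0)
    (v : Coord n) : fderiv ℝ (fderiv ℝ ρ) u v v = φ u * L u v ^ 2 := by
  by_cases hv : v = 0
  · simp [hv, h.finsler.map_zero]
  have hd : DifferentiableAt ℝ (fderiv ℝ ρ) u :=
    ((h.smooth.contDiffAt (h.isOpen.mem_nhds hu)).fderiv_right (m := 1)
      (one_add_one_eq_two.trans_le two_le_infty)).differentiableAt one_ne_zero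
  have h1 : ∀ l, fderiv ℝ (partialDeriv ρ l) u v = fderiv ℝ (fderiv ℝ ρ) u v (basisVec l) := by
    intro l
    have : HasFDerivAt (partialDeriv ρ l) _ u := hd.hasFDerivAt.clm_apply
      (hasFDerivAt_const (basisVec l) u)
    rw [this.fderiv]
    simp
  rw [linearMap_apply_eq_sum (fderiv ℝ (fderiv ℝ ρ) u v) v]
  simp_rw [← h1, fderiv_apply_eq_sum, h.hessian_of_critical hu hv hρ]
  rw [← h.finsler.sum_sum_metricTensor hu hv, Finset.mul_sum]
  refine Finset.sum_congr rfl fun i _ => ?_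
  rw [smul_eq_mul, Finset.mul_sum, Finset.mul_sum]
  refine Finset.sum_congr rfl fun j _ => ?_
  rw [h.finsler.metricTensor_symm hu hv j i]
  ring

/-- A critical point with `φ > 0` is a strict local minimum, and isolated. -/
theorem eventually_lt_of_critical (h : LocalSolution U L ρ φ) (hu : u ∈ U)
    (hρ : fderiv ℝ ρ u = 0) (hφ : 0 < φ u) :
    ∀ᶠ x in 𝓝 u, x ≠ u → ρ u < ρ x ∧ fderiv ℝ ρ x ≠ 0 := by
  refine eventually_lt_of_hessian ((h.smooth.contDiffAt (h.isOpen.mem_nhds hu)).of_le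
    two_le_infty) hρ fun v hv => ?_
  rw [h.hessian_apply_self hu hρ]
  have := h.finsler.pos hu hv
  positivity

end LocalSolution


/-! ### From charts to the manifold: velocities, gradient, energy -/

section Chart

variable {n : ℕ} {M : Type*} [TopologicalSpace M] [ChartedSpace (Coord n) M]

/-- The differential of the inverse of the chart around `x₀`. -/
noncomputable def chartSymmDeriv (x₀ : M) (u : Coord n) : Coord n →L[ℝ] Coord n :=
  mfderiv (𝓡 n) (𝓡 n) (chartAt (Coord n) x₀).symm u

/-- The differential of a function, all tangent spaces being identified with the model space. -/
noncomputable def differential (ρ : M → ℝ) (q : M) : Coord n →L[ℝ] ℝ :=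
  mfderiv (𝓡 n) 𝓘(ℝ, ℝ) ρ q

theorem isCriticalPoint_iff_differential {ρ : M → ℝ} {q : M} :
    IsCriticalPoint n ρ q ↔ differential (n := n) ρ q = 0 := Iff.rfl

/-- `c` has the velocity `w` at time `t`. -/
def HasVelocityAt (c : ℝ → M) (t : ℝ) (w : Coord n) : Prop :=
  HasMFDerivAt 𝓘(ℝ, ℝ) (𝓡 n) c t (ContinuousLinearMap.toSpanSingleton ℝ w : ℝ →L[ℝ] Coord n)

variable [IsManifold (𝓡 n) ∞ M] {x₀ : M} {u : Coord n}

/-- The natural coordinates of the tangent bundle are the tangent map of the inverse chart;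
composing with them makes `inChart` smooth off the zero section. -/
theorem contMDiffOn_lift (x₀ : M) :
    ContMDiffOn 𝓘(ℝ, Coord n × Coord n) (𝓡 n).tangent ∞
      (fun p : Coord n × Coord n => (⟨(chartAt (Coord n) x₀).symm p.1,
        chartSymmDeriv x₀ p.1 p.2⟩ : TangentBundle (𝓡 n) M))
      ((chartAt (Coord n) x₀).target ×ˢ univ) := by
  have h1 : ContMDiffOn (𝓡 n) (𝓡 n) ∞ (chartAt (Coord n) x₀).symm (chartAt (Coord n) x₀).target :=
    contMDiffOn_chart_symm
  have h2 := h1.contMDiffOn_tangentMapWithin (m := ∞) (by simp)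
    (chartAt (Coord n) x₀).open_target.uniqueMDiffOn
  have h3 : ContMDiff 𝓘(ℝ, Coord n × Coord n) (𝓡 n).tangent ∞
      (fun p : Coord n × Coord n => (⟨p.1, p.2⟩ : TangentBundle (𝓡 n) (Coord n))) := by
    rw [modelWithCornersSelf_prod]
    exact contMDiff_tangentBundleModelSpaceHomeomorph_symm
  refine (h2.comp (h3.contMDiffOn (s := (chartAt (Coord n) x₀).target ×ˢ univ))
    (fun p hp => hp.1)).congr fun p hp => ?_
  have := mfderivWithin_of_isOpen (I := 𝓡 n) (I' := 𝓡 n) (f := (chartAt (Coord n) x₀).symm)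
    (chartAt (Coord n) x₀).open_target hp.1
  simp only [Function.comp, tangentMapWithin, this]
  rfl

theorem mdifferentiable_chart' (x₀ : M) :
    (chartAt (Coord n) x₀).MDifferentiable (𝓡 n) (𝓡 n) :=
  have : IsManifold (𝓡 n) 1 M := .of_le (n := ∞) (by simp)
  mdifferentiable_chart x₀

theorem chartSymmDeriv_surjective (hu : u ∈ (chartAt (Coord n) x₀).target) :
    Function.Surjective (chartSymmDeriv x₀ u) := by
  intro y
  have h := (mdifferentiable_chart' x₀).symm_comp_deriv
    ((chartAt (Coord n) x₀).map_target hu)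
  rw [(chartAt (Coord n) x₀).right_inv hu] at h
  exact ⟨mfderiv (𝓡 n) (𝓡 n) (chartAt (Coord n) x₀) ((chartAt (Coord n) x₀).symm u) y,
    congrArg (fun A => A y) h⟩

theorem mfderiv_chart_chartSymmDeriv (hu : u ∈ (chartAt (Coord n) x₀).target) (v : Coord n) :
    mfderiv (𝓡 n) (𝓡 n) (chartAt (Coord n) x₀) ((chartAt (Coord n) x₀).symm u)
      (chartSymmDeriv x₀ u v) = v :=
  congrArg (fun A => A v) ((mdifferentiable_chart' x₀).comp_symm_deriv hu)

theorem chartSymmDeriv_ne_zero (hu : u ∈ (chartAt (Coord n) x₀).target) {v : Coord n}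
    (hv : v ≠ 0) : chartSymmDeriv x₀ u v ≠ 0 := by
  intro h
  have := mfderiv_chart_chartSymmDeriv hu v
  rw [h] at this
  exact hv (this.symm.trans
    (mfderiv (𝓡 n) (𝓡 n) (chartAt (Coord n) x₀) ((chartAt (Coord n) x₀).symm u)).map_zero)

namespace FinslerStructure

variable (F : FinslerStructure n M)

theorem localFinsler (x₀ : M) :
    LocalFinsler (chartAt (Coord n) x₀).target (inChart F.toFun x₀) where
  isOpen := (chartAt (Coord n) x₀).open_target
  nonneg u v := F.nonneg _
  smooth := by
    refine contMDiffOn_iff_contDiffOn.1 ?_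
    refine F.smooth.comp ((contMDiffOn_lift x₀).mono (prod_mono_right (subset_univ _))) ?_
    rintro ⟨u, v⟩ ⟨hu, hv⟩
    exact chartSymmDeriv_ne_zero hu hv
  homog u v c hc := by
    exact (congrArg (fun y => F.toFun ⟨_, y⟩) ((chartSymmDeriv x₀ u).map_smul c v)).trans
      (F.homogeneous _ (chartSymmDeriv x₀ u v) c hc)
  posDef := F.posDef x₀

variable {F}

theorem inChart_chart {p : M} (hp : p ∈ (chartAt (Coord n) x₀).source) (v : Coord n) :
    inChart F.toFun x₀ (chartAt (Coord n) x₀ p) v =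
      F.toFun ⟨p, chartSymmDeriv x₀ (chartAt (Coord n) x₀ p) v⟩ :=
  congrArg (fun q => F.toFun ⟨q, chartSymmDeriv x₀ (chartAt (Coord n) x₀ p) v⟩)
    ((chartAt (Coord n) x₀).left_inv hp)

end FinslerStructure

theorem contDiffOn_comp_chart_symm {ρ : M → ℝ} (hρ : ContMDiff (𝓡 n) 𝓘(ℝ, ℝ) ∞ ρ) (x₀ : M) :
    ContDiffOn ℝ ∞ (fun x => ρ ((chartAt (Coord n) x₀).symm x)) (chartAt (Coord n) x₀).target :=
  contMDiffOn_iff_contDiffOn.1 (hρ.comp_contMDiffOn contMDiffOn_chart_symm)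

theorem fderiv_comp_chart_symm {ρ : M → ℝ} (hρ : ContMDiff (𝓡 n) 𝓘(ℝ, ℝ) ∞ ρ)
    (hu : u ∈ (chartAt (Coord n) x₀).target) (v : Coord n) :
    fderiv ℝ (fun x => ρ ((chartAt (Coord n) x₀).symm x)) u v =
      differential ρ ((chartAt (Coord n) x₀).symm u) (chartSymmDeriv x₀ u v) := by
  have h1 := (hρ.mdifferentiable (by simp) ((chartAt (Coord n) x₀).symm u)).hasMFDerivAt.comp u
    ((mdifferentiable_chart' x₀).symm.mdifferentiableAt hu).hasMFDerivAt
  have h2 : HasFDerivAt (fun x => ρ ((chartAt (Coord n) x₀).symm x))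
      ((differential ρ ((chartAt (Coord n) x₀).symm u)).comp (chartSymmDeriv x₀ u)) u :=
    hasMFDerivAt_iff_hasFDerivAt.1 h1
  rw [h2.fderiv]
  rfl

theorem isCriticalPoint_chart_symm_iff {ρ : M → ℝ} (hρ : ContMDiff (𝓡 n) 𝓘(ℝ, ℝ) ∞ ρ)
    (hu : u ∈ (chartAt (Coord n) x₀).target) :
    IsCriticalPoint n ρ ((chartAt (Coord n) x₀).symm u) ↔
      fderiv ℝ (fun x => ρ ((chartAt (Coord n) x₀).symm x)) u = 0 := by
  rw [isCriticalPoint_iff_differential]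
  constructor
  · intro h
    refine ContinuousLinearMap.ext fun v => ?_
    rw [fderiv_comp_chart_symm hρ hu, h]
    rfl
  · intro h
    refine ContinuousLinearMap.ext fun y => ?_
    obtain ⟨v, rfl⟩ := chartSymmDeriv_surjective hu y
    rw [← fderiv_comp_chart_symm hρ hu, h]
    rfl

theorem isCriticalPoint_iff {ρ : M → ℝ} (hρ : ContMDiff (𝓡 n) 𝓘(ℝ, ℝ) ∞ ρ) {p : M}
    (hp : p ∈ (chartAt (Coord n) x₀).source) : IsCriticalPoint n ρ p ↔
      fderiv ℝ (fun x => ρ ((chartAt (Coord n) x₀).symm x)) (chartAt (Coord n) x₀ p) = 0 := by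
  rw [← isCriticalPoint_chart_symm_iff hρ ((chartAt (Coord n) x₀).map_source hp),
    (chartAt (Coord n) x₀).left_inv hp]

theorem hasVelocityAt_iff {c : ℝ → M} {t : ℝ} (ht : c t ∈ (chartAt (Coord n) x₀).source)
    (w : Coord n) : HasVelocityAt c t (chartSymmDeriv x₀ (chartAt (Coord n) x₀ (c t)) w) ↔
      ContinuousAt c t ∧ HasDerivAt (fun s => chartAt (Coord n) x₀ (c s)) w t := by
  have hu := (chartAt (Coord n) x₀).map_source ht
  constructor
  · intro h
    refine ⟨HasMFDerivAt.continuousAt h, ?_⟩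
    have h1 := ((mdifferentiable_chart' x₀).mdifferentiableAt ht).hasMFDerivAt.comp t h
    let A : Coord n →L[ℝ] Coord n := mfderiv (𝓡 n) (𝓡 n) (chartAt (Coord n) x₀) (c t)
    have h2 : HasFDerivAt (fun s => chartAt (Coord n) x₀ (c s))
        (A.comp (ContinuousLinearMap.toSpanSingleton ℝ
          (chartSymmDeriv x₀ (chartAt (Coord n) x₀ (c t)) w))) t :=
      hasMFDerivAt_iff_hasFDerivAt.1 h1
    refine h2.hasDerivAt.congr_deriv ?_
    have h3 := mfderiv_chart_chartSymmDeriv hu w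
    rw [(chartAt (Coord n) x₀).left_inv ht] at h3
    refine Eq.trans ?_ h3
    exact congrArg A (one_smul ℝ (chartSymmDeriv x₀ (chartAt (Coord n) x₀ (c t)) w))
  · rintro ⟨hc, h⟩
    have h1 := ((mdifferentiable_chart' x₀).symm.mdifferentiableAt hu).hasMFDerivAt.comp t
      h.hasFDerivAt.hasMFDerivAt
    have h2 : c =ᶠ[𝓝 t] (chartAt (Coord n) x₀).symm ∘ fun s => chartAt (Coord n) x₀ (c s) := by
      filter_upwards [hc ((chartAt (Coord n) x₀).open_source.mem_nhds ht)] with s hs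
      exact ((chartAt (Coord n) x₀).left_inv hs).symm
    refine (h1.congr_of_eventuallyEq h2).congr_mfderiv ?_
    refine ContinuousLinearMap.ext fun s => ?_
    exact (chartSymmDeriv x₀ (chartAt (Coord n) x₀ (c t))).map_smul (s : ℝ) w

namespace FinslerStructure

theorem localSolution {F : FinslerStructure n M} {ρ φ : M → ℝ}
    (hρ : ContMDiff (𝓡 n) 𝓘(ℝ, ℝ) ∞ ρ) (hsol : F.IsSolution ρ φ) (x₀ : M) :
    LocalSolution (chartAt (Coord n) x₀).target (inChart F.toFun x₀)
      (fun x => ρ ((chartAt (Coord n) x₀).symm x)) (fun x => φ ((chartAt (Coord n) x₀).symm x)) where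
  finsler := F.localFinsler x₀
  smooth := contDiffOn_comp_chart_symm hρ x₀
  eq := hsol x₀

/-- The Finsler gradient of `ρ`. -/
noncomputable def grad (F : FinslerStructure n M) (ρ : M → ℝ) (q : M) : Coord n :=
  Classical.epsilon fun y : Coord n => IsGrad (fun z : Coord n => F.toFun ⟨q, z⟩) (differential ρ q) y

/-- Half the square of the norm of the gradient. -/
noncomputable def energy (F : FinslerStructure n M) (ρ : M → ℝ) (q : M) : ℝ :=
  F.toFun ⟨q, F.grad ρ q⟩ ^ 2 / 2

variable {F : FinslerStructure n M} {ρ φ : M → ℝ}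

/-- Legendre duality refers only to F and dρ on one tangent space, and the differential of the
inverse chart carries both from coordinates to the manifold. Uniqueness in coordinates then
identifies the two choices. -/
theorem grad_chart_symm (hρ : ContMDiff (𝓡 n) 𝓘(ℝ, ℝ) ∞ ρ)
    (hu : u ∈ (chartAt (Coord n) x₀).target) :
    F.grad ρ ((chartAt (Coord n) x₀).symm u) = chartSymmDeriv x₀ u
      (localGrad (inChart F.toFun x₀) (fun x => ρ ((chartAt (Coord n) x₀).symm x)) u) := by
  have hF := F.localFinsler x₀
  set q := (chartAt (Coord n) x₀).symm u with hq
  have hiff : ∀ w : Coord n, IsGrad (fun z : Coord n => F.toFun ⟨q, z⟩) (differential ρ q)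
      (chartSymmDeriv x₀ u w) ↔ IsGrad (inChart F.toFun x₀ u)
        (fderiv ℝ (fun x => ρ ((chartAt (Coord n) x₀).symm x)) u) w := by
    intro w
    constructor
    · intro h v
      have := h (chartSymmDeriv x₀ u v)
      rw [← fderiv_comp_chart_symm hρ hu, ← fderiv_comp_chart_symm hρ hu] at this
      exact this
    · intro h y
      obtain ⟨v, rfl⟩ := chartSymmDeriv_surjective hu y
      rw [← fderiv_comp_chart_symm hρ hu, ← fderiv_comp_chart_symm hρ hu]
      exact h v
  have hspec : IsGrad (fun z : Coord n => F.toFun ⟨q, z⟩) (differential ρ q) (F.grad ρ q) :=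
    Classical.epsilon_spec (p := fun y : Coord n =>
      IsGrad (fun z : Coord n => F.toFun ⟨q, z⟩) (differential ρ q) y)
      ⟨_, (hiff _).2 (hF.isGrad_localGrad hu _)⟩
  obtain ⟨w, hw⟩ := chartSymmDeriv_surjective hu (F.grad ρ q)
  rw [← hw] at hspec ⊢
  rw [hF.isGrad_unique hu (hF.isGrad_localGrad hu _) ((hiff w).1 hspec)]

theorem energy_chart_symm (hρ : ContMDiff (𝓡 n) 𝓘(ℝ, ℝ) ∞ ρ)
    (hu : u ∈ (chartAt (Coord n) x₀).target) :
    F.energy ρ ((chartAt (Coord n) x₀).symm u) =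
      localEnergy (inChart F.toFun x₀) (fun x => ρ ((chartAt (Coord n) x₀).symm x)) u := by
  rw [energy, grad_chart_symm hρ hu]
  rfl

theorem energy_eq_localEnergy (hρ : ContMDiff (𝓡 n) 𝓘(ℝ, ℝ) ∞ ρ) {p : M}
    (hp : p ∈ (chartAt (Coord n) x₀).source) : F.energy ρ p =
      localEnergy (inChart F.toFun x₀) (fun x => ρ ((chartAt (Coord n) x₀).symm x))
        (chartAt (Coord n) x₀ p) := by
  rw [← energy_chart_symm hρ ((chartAt (Coord n) x₀).map_source hp),
    (chartAt (Coord n) x₀).left_inv hp]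

theorem continuous_energy (hρ : ContMDiff (𝓡 n) 𝓘(ℝ, ℝ) ∞ ρ) (hsol : F.IsSolution ρ φ) :
    Continuous (F.energy ρ) := by
  rw [continuous_iff_continuousAt]
  intro p
  have hp := mem_chart_source (Coord n) p
  have h1 := ((localSolution hρ hsol p).hasFDerivAt_energy
    ((chartAt (Coord n) p).map_source hp)).continuousAt
  have h2 := ContinuousAt.comp (f := chartAt (Coord n) p) (x := p) h1
    ((chartAt (Coord n) p).continuousAt hp)
  refine h2.congr ?_
  filter_upwards [(chartAt (Coord n) p).open_source.mem_nhds hp] with q hq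
  exact (energy_eq_localEnergy hρ hq).symm

theorem energy_pos_iff (hρ : ContMDiff (𝓡 n) 𝓘(ℝ, ℝ) ∞ ρ) (hsol : F.IsSolution ρ φ) (p : M) :
    ¬ IsCriticalPoint n ρ p ↔ 0 < F.energy ρ p := by
  have hp := mem_chart_source (Coord n) p
  have hu := (chartAt (Coord n) p).map_source hp
  have h := localSolution hρ hsol p
  rw [isCriticalPoint_iff hρ hp, energy_eq_localEnergy hρ hp]
  constructor
  · exact h.localEnergy_pos hu
  · intro hpos h0
    rw [h.localEnergy_eq_zero hu h0] at hpos
    exact hpos.false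

end FinslerStructure

end Chart


/-- Solutions of differential equations with smooth right hand side are smooth. -/
theorem contDiffAt_of_ode {E : Type*} [NormedAddCommGroup E] [NormedSpace ℝ E] [CompleteSpace E]
    {X : E → E} {R : Set E} (hR : IsOpen R) (hX : ContDiffOn ℝ ∞ X R) {c : ℝ → E} {t : ℝ}
    (ht : c t ∈ R) (hc : ∀ᶠ s in 𝓝 t, HasDerivAt c (X (c s)) s) : ContDiffAt ℝ ∞ c t := by
  have h1 : ∀ᶠ s in 𝓝 t, HasDerivAt c (X (c s)) s ∧ c s ∈ R :=
    hc.and (hc.self_of_nhds.continuousAt (hR.mem_nhds ht))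
  obtain ⟨r, hr, hball⟩ := Metric.nhds_basis_closedBall.mem_iff.1 h1
  rw [Real.closedBall_eq_Icc] at hball
  have h2 : ContDiffOn ℝ ∞ c (Icc (t - r) (t + r)) := by
    refine ODE.contDiffOn_enat_Icc_of_hasDerivWithinAt (f := fun _ => X) (u := R) (n := ⊤)
      (hX.comp contDiffOn_snd fun p hp => hp.2) (fun s hs => (hball hs).1.hasDerivWithinAt)
      fun s hs => (hball hs).2
  exact h2.contDiffAt (Icc_mem_nhds (by linarith) (by linarith))

/-- The gradient of `ρ`, normalized such that `dρ` takes the value `1` on it. -/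
noncomputable def levelField {n : ℕ} (L : Coord n → Coord n → ℝ) (ρ : Coord n → ℝ)
    (u : Coord n) : Coord n := (2 * localEnergy L ρ u)⁻¹ • localGrad L ρ u

namespace LocalSolution

variable {n : ℕ} {U : Set (Coord n)} {L : Coord n → Coord n → ℝ} {ρ φ : Coord n → ℝ}
  {u v : Coord n}

theorem contDiffAt_levelField (h : LocalSolution U L ρ φ) (hu : u ∈ U) (hρ : fderiv ℝ ρ u ≠ 0) :
    ContDiffAt ℝ ∞ (levelField L ρ) u :=
  ((contDiffAt_const.mul (h.contDiffAt_localEnergy hu hρ)).inv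
    (mul_pos two_pos (h.localEnergy_pos hu hρ)).ne').smul (h.finsler.contDiffAt_localGrad hu h.smooth hρ)

theorem fderiv_levelField (h : LocalSolution U L ρ φ) (hu : u ∈ U) (hρ : fderiv ℝ ρ u ≠ 0) :
    fderiv ℝ ρ u (levelField L ρ u) = 1 := by
  have h1 : fderiv ℝ ρ u (localGrad L ρ u) = 2 * localEnergy L ρ u := by
    rw [(h.finsler.isGrad_localGrad hu ρ).apply_self h.finsler hu, localEnergy]
    ring
  rw [levelField, map_smul, h1, smul_eq_mul, inv_mul_cancel₀]
  exact (mul_pos two_pos (h.localEnergy_pos hu hρ)).ne'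

theorem isOpen_regular (h : LocalSolution U L ρ φ) : IsOpen {u | u ∈ U ∧ fderiv ℝ ρ u ≠ 0} :=
  (h.smooth.continuousOn_fderiv_of_isOpen h.isOpen (by simp)).isOpen_inter_preimage h.isOpen
    isOpen_compl_singleton

end LocalSolution

/-! ### The gradient flow on the manifold and forward completeness -/

section Chart

variable {n : ℕ} {M : Type*} [TopologicalSpace M] [ChartedSpace (Coord n) M]

theorem HasVelocityAt.velocity_eq {c : ℝ → M} {t : ℝ} {w : Coord n} (h : HasVelocityAt c t w) :
    velocity c t = (⟨c t, w⟩ : TangentBundle (𝓡 n) M) := by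
  have h1 : mfderiv 𝓘(ℝ, ℝ) (𝓡 n) c t = _ := HasMFDerivAt.mfderiv h
  unfold velocity
  rw [h1]
  exact congrArg (fun w : Coord n => (⟨c t, w⟩ : TangentBundle (𝓡 n) M)) (one_smul ℝ w)

theorem isPiecewiseSmooth_of_contMDiffOn {γ : ℝ → M} {a b : ℝ} (hab : a ≤ b)
    (h : ContMDiffOn 𝓘(ℝ, ℝ) (𝓡 n) ∞ γ (Icc a b)) : IsPiecewiseSmooth n γ a b := by
  refine ⟨1, fun i => if i = 0 then a else b, ?_, by simp, by simp, ?_⟩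
  · intro i j hij
    by_cases hi : i = 0
    · by_cases hj : j = 0 <;> simp [hi, hj, hab]
    · have hj : j ≠ 0 := by omega
      simp [hi, hj]
  · intro i hi
    obtain rfl : i = 0 := by omega
    simpa using h

theorem IsPiecewiseSmooth.le {γ : ℝ → M} {a b : ℝ} (h : IsPiecewiseSmooth n γ a b) :
    a ≤ b := by
  obtain ⟨N, τ, hτ, rfl, rfl, -⟩ := h
  exact hτ N.zero_le

variable [IsManifold (𝓡 n) ∞ M] {x₀ : M} {u : Coord n}

theorem contMDiffAt_of_chart {c : ℝ → M} {t : ℝ} (hc : ContinuousAt c t)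
    (ht : c t ∈ (chartAt (Coord n) x₀).source)
    (h : ContDiffAt ℝ ∞ (fun s => chartAt (Coord n) x₀ (c s)) t) :
    ContMDiffAt 𝓘(ℝ, ℝ) (𝓡 n) ∞ c t := by
  have h1 : ContMDiffAt (𝓡 n) (𝓡 n) ∞ (chartAt (Coord n) x₀).symm (chartAt (Coord n) x₀ (c t)) :=
    contMDiffOn_chart_symm.contMDiffAt
      ((chartAt (Coord n) x₀).open_target.mem_nhds ((chartAt (Coord n) x₀).map_source ht))
  refine (h1.comp t h.contMDiffAt).congr_of_eventuallyEq ?_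
  filter_upwards [hc ((chartAt (Coord n) x₀).open_source.mem_nhds ht)] with s hs
  exact ((chartAt (Coord n) x₀).left_inv hs).symm

namespace FinslerStructure

variable {F : FinslerStructure n M} {ρ φ : M → ℝ}

/-- `c` is a trajectory of the normalized gradient of `ρ`. -/
def IsTrajectory (F : FinslerStructure n M) (ρ : M → ℝ) (c : ℝ → M) (t : ℝ) : Prop :=
  ¬ IsCriticalPoint n ρ (c t) ∧ HasVelocityAt c t ((2 * F.energy ρ (c t))⁻¹ • F.grad ρ (c t))

theorem chartSymmDeriv_levelField (hρ : ContMDiff (𝓡 n) 𝓘(ℝ, ℝ) ∞ ρ) {p : M}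
    (hp : p ∈ (chartAt (Coord n) x₀).source) :
    chartSymmDeriv x₀ (chartAt (Coord n) x₀ p) (levelField (inChart F.toFun x₀)
      (fun x => ρ ((chartAt (Coord n) x₀).symm x)) (chartAt (Coord n) x₀ p)) =
      (2 * F.energy ρ p)⁻¹ • F.grad ρ p := by
  have hu := (chartAt (Coord n) x₀).map_source hp
  rw [levelField, map_smul, ← grad_chart_symm hρ hu, ← energy_chart_symm hρ hu,
    (chartAt (Coord n) x₀).left_inv hp]

theorem isTrajectory_iff (hρ : ContMDiff (𝓡 n) 𝓘(ℝ, ℝ) ∞ ρ) {c : ℝ → M} {t : ℝ}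
    (ht : c t ∈ (chartAt (Coord n) x₀).source) : F.IsTrajectory ρ c t ↔ ContinuousAt c t ∧
      fderiv ℝ (fun x => ρ ((chartAt (Coord n) x₀).symm x)) (chartAt (Coord n) x₀ (c t)) ≠ 0 ∧
      HasDerivAt (fun s => chartAt (Coord n) x₀ (c s)) (levelField (inChart F.toFun x₀)
        (fun x => ρ ((chartAt (Coord n) x₀).symm x)) (chartAt (Coord n) x₀ (c t))) t := by
  rw [IsTrajectory, isCriticalPoint_iff hρ ht, ← chartSymmDeriv_levelField hρ ht,
    hasVelocityAt_iff ht]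
  tauto

theorem isOpen_regular (hρ : ContMDiff (𝓡 n) 𝓘(ℝ, ℝ) ∞ ρ) (hsol : F.IsSolution ρ φ) :
    IsOpen {p | ¬ IsCriticalPoint n ρ p} := by
  have : {p | ¬ IsCriticalPoint n ρ p} = {p | 0 < F.energy ρ p} := by
    ext p
    exact energy_pos_iff hρ hsol p
  rw [this]
  exact isOpen_lt continuous_const (continuous_energy hρ hsol)

theorem IsTrajectory.hasDerivAt_level (hρ : ContMDiff (𝓡 n) 𝓘(ℝ, ℝ) ∞ ρ) (hsol : F.IsSolution ρ φ)
    {c : ℝ → M} {t : ℝ} (h : F.IsTrajectory ρ c t) : HasDerivAt (fun s => ρ (c s)) 1 t := by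
  have ht := mem_chart_source (Coord n) (c t)
  obtain ⟨h1, h2, h3⟩ := (isTrajectory_iff hρ ht).1 h
  have hS := localSolution hρ hsol (c t)
  have hu := (chartAt (Coord n) (c t)).map_source ht
  have h4 := (ContDiffOn.hasFDerivAt_of_isOpen hS.isOpen hS.smooth hu).comp_hasDerivAt t h3
  rw [hS.fderiv_levelField hu h2] at h4
  refine h4.congr_of_eventuallyEq ?_
  filter_upwards [h1 ((chartAt (Coord n) (c t)).open_source.mem_nhds ht)] with s hs
  simp only [Function.comp]
  rw [(chartAt (Coord n) (c t)).left_inv hs]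

/-- The gradient flow, parametrized by the values of `ρ`. -/
theorem levelFlow (hρ : ContMDiff (𝓡 n) 𝓘(ℝ, ℝ) ∞ ρ) (hsol : F.IsSolution ρ φ) :
    LevelFlow {p | ¬ IsCriticalPoint n ρ p} ρ (F.IsTrajectory ρ) where
  congr {c c' t} hcc h := by
    have hct : c t = c' t := hcc.self_of_nhds
    rw [IsTrajectory, hct] at h
    exact ⟨h.1, HasMFDerivAt.congr_of_eventuallyEq h.2 hcc.symm⟩
  mem h := h.1
  continuousAt h := HasMFDerivAt.continuousAt h.2
  level h := h.hasDerivAt_level hρ hsol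
  unique {c c' t} hc hc' heq := by
    have ht := mem_chart_source (Coord n) (c t)
    have hsrc := (chartAt (Coord n) (c t)).open_source
    have hcont := HasMFDerivAt.continuousAt hc.self_of_nhds.2
    have hcont' := HasMFDerivAt.continuousAt hc'.self_of_nhds.2
    have h1 : ∀ᶠ s in 𝓝 t, c s ∈ (chartAt (Coord n) (c t)).source := hcont (hsrc.mem_nhds ht)
    have h2 : ∀ᶠ s in 𝓝 t, c' s ∈ (chartAt (Coord n) (c t)).source :=
      hcont' (hsrc.mem_nhds (by rwa [← heq]))
    have hS := localSolution hρ hsol (c t)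
    have hu := (chartAt (Coord n) (c t)).map_source ht
    have h3 : (fun s => chartAt (Coord n) (c t) (c s)) =ᶠ[𝓝 t]
        fun s => chartAt (Coord n) (c t) (c' s) := by
      refine ode_unique ((hS.contDiffAt_levelField hu
        ((isTrajectory_iff hρ ht).1 hc.self_of_nhds).2.1).of_le (by simp)) ?_ ?_ ?_
      · filter_upwards [hc, h1] with s hs hs1 using ((isTrajectory_iff hρ hs1).1 hs).2.2
      · filter_upwards [hc', h2] with s hs hs1 using ((isTrajectory_iff hρ hs1).1 hs).2.2
      · simp only [heq]
    filter_upwards [h1, h2, h3] with s hs1 hs2 hs3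
    exact (chartAt (Coord n) (c t)).injOn hs1 hs2 hs3
  box z hz := by
    set e := chartAt (Coord n) z with he
    have hze : z ∈ e.source := mem_chart_source (Coord n) z
    have hS := localSolution hρ hsol z
    have hu := e.map_source hze
    have hreg := (isCriticalPoint_iff hρ hze).not.1 hz
    set R := {u | u ∈ e.target ∧ fderiv ℝ (fun x => ρ (e.symm x)) u ≠ 0} with hR
    obtain ⟨β, δ, hδ, ε, hε, hβ, hβc⟩ := exists_local_flow
      ((hS.contDiffAt_levelField hu hreg).of_le (by simp : (1 : WithTop ℕ∞) ≤ ∞))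
      (hS.isOpen_regular.mem_nhds ⟨hu, hreg⟩)
    -- The local flow runs in the time `t - ρ x`. Halving `ε` for both `ρ x` and `t` keeps this
    -- difference within the domain of the flow.
    have hmem : ∀ x t, |ρ x - ρ z| < ε / 2 → t ∈ Ioo (ρ z - ε / 2) (ρ z + ε / 2) →
        t - ρ x ∈ Ioo (-ε) ε := by
      intro x t hx ht
      rw [abs_sub_lt_iff] at hx
      constructor <;> linarith [ht.1, ht.2, hx.1, hx.2]
    refine ⟨(e.source ∩ e ⁻¹' Metric.ball (e z) δ) ∩ {x | |ρ x - ρ z| < ε / 2}, ?_, ?_, ε / 2,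
      half_pos hε, fun x t => e.symm (β (e x) (t - ρ x)), ?_, ?_⟩
    · refine (e.isOpen_inter_preimage Metric.isOpen_ball).inter ?_
      exact isOpen_lt ((hρ.continuous.sub continuous_const).abs) continuous_const
    · exact ⟨⟨hze, Metric.mem_ball_self hδ⟩, by simpa using hε⟩
    · rintro x ⟨⟨hxe, hxδ⟩, hxε⟩
      obtain ⟨hβ0, hβd⟩ := hβ (e x) hxδ
      refine ⟨by simp [hβ0, e.left_inv hxe], hxε, fun t ht => ?_⟩
      have hs := hmem x t hxε ht
      obtain ⟨h1, h2, h3⟩ := hβd _ hs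
      have h4 : HasDerivAt (fun t => β (e x) (t - ρ x))
          (levelField (inChart F.toFun z) (fun x => ρ (e.symm x)) (β (e x) (t - ρ x))) t := by
        simpa using h1.comp_sub_const t (ρ x)
      have hsrc : e.symm (β (e x) (t - ρ x)) ∈ e.source := e.map_target h2
      rw [isTrajectory_iff hρ hsrc]
      refine ⟨?_, ?_, ?_⟩
      · exact ContinuousAt.comp (f := fun t => β (e x) (t - ρ x)) (e.continuousAt_symm h2)
          h4.continuousAt
      · rwa [← he, e.right_inv h2]
      · rw [← he, e.right_inv h2]
        refine h4.congr_of_eventuallyEq ?_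
        filter_upwards [isOpen_Ioo.mem_nhds ht] with s hs'
        exact e.right_inv (hβd _ (hmem x s hxε hs')).2.1
    · intro t ht
      refine ContinuousOn.comp (t := e.target) e.continuousOn_symm ?_ ?_
      · refine ContinuousOn.comp (f := fun x => (e x, t - ρ x)) hβc ?_ ?_
        · refine (e.continuousOn.mono fun x hx => hx.1.1).prodMk ?_
          exact (continuous_const.sub hρ.continuous).continuousOn
        · exact fun x hx => ⟨hx.1.2, hmem x t hx.2 ht⟩
      · exact fun x hx => ((hβ (e x) hx.1.2).2 _ (hmem x t hx.2 ht)).2.1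

theorem exists_nhds_energy_eq (hρ : ContMDiff (𝓡 n) 𝓘(ℝ, ℝ) ∞ ρ) (hsol : F.IsSolution ρ φ)
    {z : M} (hz : ¬ IsCriticalPoint n ρ z) : ∃ V ∈ 𝓝 z, ∀ x ∈ V, ∀ x' ∈ V, ρ x = ρ x' →
      F.energy ρ x = F.energy ρ x' := by
  set e := chartAt (Coord n) z with he
  have hze : z ∈ e.source := mem_chart_source (Coord n) z
  have hS := localSolution hρ hsol z
  have hu := e.map_source hze
  obtain ⟨V, hV, hVW⟩ := exists_nhds_eq_of_eq (k := fun x => φ (e.symm x))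
    ((hS.smooth.contDiffAt (hS.isOpen.mem_nhds hu)).of_le (by simp))
    ((isCriticalPoint_iff hρ hze).not.1 hz)
    (by filter_upwards [hS.isOpen.mem_nhds hu] with x hx using hS.hasFDerivAt_energy hx)
  refine ⟨e.source ∩ e ⁻¹' V, inter_mem (e.open_source.mem_nhds hze)
    (e.continuousAt hze hV), ?_⟩
  rintro x ⟨hxe, hxV⟩ x' ⟨hxe', hxV'⟩ hxx'
  rw [energy_eq_localEnergy hρ hxe, energy_eq_localEnergy hρ hxe']
  refine hVW _ hxV _ hxV' ?_
  rw [e.left_inv hxe, e.left_inv hxe', hxx']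

theorem IsTrajectory.contMDiffAt (hρ : ContMDiff (𝓡 n) 𝓘(ℝ, ℝ) ∞ ρ) (hsol : F.IsSolution ρ φ)
    {c : ℝ → M} {t : ℝ} (h : ∀ᶠ s in 𝓝 t, F.IsTrajectory ρ c s) :
    ContMDiffAt 𝓘(ℝ, ℝ) (𝓡 n) ∞ c t := by
  have ht := mem_chart_source (Coord n) (c t)
  obtain ⟨h1, h2, -⟩ := (isTrajectory_iff hρ ht).1 h.self_of_nhds
  have hS := localSolution hρ hsol (c t)
  have hu := (chartAt (Coord n) (c t)).map_source ht
  refine contMDiffAt_of_chart h1 ht (contDiffAt_of_ode hS.isOpen_regular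
    (fun x hx => (hS.contDiffAt_levelField hx.1 hx.2).contDiffWithinAt) ⟨hu, h2⟩ ?_)
  filter_upwards [h, h1 ((chartAt (Coord n) (c t)).open_source.mem_nhds ht)] with s hs hs1
  exact ((isTrajectory_iff hρ hs1).1 hs).2.2

/-- With λ = F(∇ρ) = √(2W), the normalized field ∇ρ/λ² has norm 1/λ. -/
theorem IsTrajectory.norm_velocity (hρ : ContMDiff (𝓡 n) 𝓘(ℝ, ℝ) ∞ ρ) (hsol : F.IsSolution ρ φ)
    {c : ℝ → M} {t : ℝ} (h : F.IsTrajectory ρ c t) :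
    F.toFun (velocity c t) = (√(2 * F.energy ρ (c t)))⁻¹ := by
  have hpos := (energy_pos_iff hρ hsol _).1 h.1
  rw [h.2.velocity_eq]
  have h1 := F.homogeneous (c t) (F.grad ρ (c t)) (2 * F.energy ρ (c t))⁻¹ (by positivity)
  have h2 : 2 * F.energy ρ (c t) = F.toFun ⟨c t, F.grad ρ (c t)⟩ ^ 2 := by
    rw [energy]; ring
  refine Eq.trans h1 ?_
  rw [h2]
  rw [Real.sqrt_sq (F.nonneg _)]
  have h3 : F.toFun ⟨c t, F.grad ρ (c t)⟩ ≠ 0 := by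
    intro h0
    rw [energy, h0] at hpos
    norm_num at hpos
  field_simp

theorem length_nonneg {γ : ℝ → M} {a b : ℝ} (hab : a ≤ b) : 0 ≤ F.length γ a b :=
  intervalIntegral.integral_nonneg hab fun _ _ => F.nonneg _

theorem bddBelow_lengths (p q : M) : BddBelow {ℓ | ∃ (γ : ℝ → M) (a b : ℝ),
    IsPiecewiseSmooth n γ a b ∧ γ a = p ∧ γ b = q ∧ ℓ = F.length γ a b} := by
  refine ⟨0, ?_⟩
  rintro _ ⟨γ, a, b, h, -, -, rfl⟩
  exact length_nonneg h.le

theorem dist_le_length {γ : ℝ → M} {a b : ℝ} (h : IsPiecewiseSmooth n γ a b) {p q : M}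
    (hp : γ a = p) (hq : γ b = q) : F.dist p q ≤ F.length γ a b :=
  csInf_le (bddBelow_lengths p q) ⟨γ, a, b, h, hp, hq, rfl⟩

/-- Between two levels the trajectory has length at most their difference divided by √(2m). The
levels increase and are bounded, hence Cauchy, and the curves run from earlier to later points, so
the sequence is forward Cauchy. -/
theorem forwardComplete [T2Space M] (hF : F.IsComplete) (hρ : ContMDiff (𝓡 n) 𝓘(ℝ, ℝ) ∞ ρ)
    (hsol : F.IsSolution ρ φ) : Well.ForwardComplete ρ (F.energy ρ) (F.IsTrajectory ρ) := by
  have hfl := levelFlow hρ hsol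
  intro x y m b hm hxy hmono hb hW
  refine hF y fun ε hε => ?_
  have hcauchy : CauchySeq fun k => ρ (y k) :=
    (tendsto_atTop_ciSup hmono ⟨b, by rintro _ ⟨k, rfl⟩; exact hb k⟩).cauchySeq
  have hs : 0 < √(2 * m) := Real.sqrt_pos.2 (by positivity)
  obtain ⟨N, hN⟩ := Metric.cauchySeq_iff.1 hcauchy (ε * √(2 * m)) (by positivity)
  refine ⟨N, fun i hi j hij => ?_⟩
  have hij' : ρ (y i) ≤ ρ (y j) := hmono hij
  obtain ⟨c, α, β, hc, hi', hj', hci, hcj⟩ := (hxy i).symm.trans (hxy j) hfl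
  have hI : ∀ t ∈ Icc (ρ (y i)) (ρ (y j)), t ∈ Ioo α β := fun t ht =>
    ⟨hi'.1.trans_le ht.1, ht.2.trans_lt hj'.2⟩
  have hsm : ContMDiffOn 𝓘(ℝ, ℝ) (𝓡 n) ∞ c (Icc (ρ (y i)) (ρ (y j))) := fun t ht =>
    (IsTrajectory.contMDiffAt hρ hsol (by
      filter_upwards [isOpen_Ioo.mem_nhds (hI t ht)] with s hs using hc s hs)).contMDiffWithinAt
  refine (dist_le_length (isPiecewiseSmooth_of_contMDiffOn hij' hsm) hci hcj).trans_lt ?_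
  have hle : ∀ t ∈ Ioc (ρ (y i)) (ρ (y j)), ‖F.toFun (velocity c t)‖ ≤ (√(2 * m))⁻¹ := by
    intro t ht
    have htI := hI t (Ioc_subset_Icc_self ht)
    rw [Real.norm_of_nonneg (F.nonneg _), (hc t htI).norm_velocity hρ hsol]
    have hlev := hfl.level_curve hc hi' hci htI
    have := hW i j (c t) hij ((hxy i).trans (hfl.linked_curve hc hi' hci htI) hfl)
      (by rw [hlev]; exact Ioc_subset_Icc_self ht)
    gcongr
  rw [length]
  refine (le_abs_self _).trans_lt ?_
  rw [← Real.norm_eq_abs]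
  refine (intervalIntegral.norm_integral_le_of_norm_le_const
    (by rwa [uIoc_of_le hij'])).trans_lt ?_
  have h1 := hN i hi j (hi.trans hij)
  rw [Real.dist_eq, abs_sub_comm] at h1
  rw [inv_mul_lt_iff₀ hs, mul_comm]
  exact h1

end FinslerStructure

end Chart


/-! ### Critical points are isolated; a well around a minimum -/

theorem one_lt_rank_coord {n : ℕ} (hn : 2 ≤ n) : 1 < Module.rank ℝ (Coord n) := by
  rw [← Module.finrank_eq_rank, finrank_euclideanSpace, Fintype.card_fin]
  exact_mod_cast hn

theorem partialDeriv_neg {n : ℕ} (f : Coord n → ℝ) (i : Fin n) :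
    partialDeriv (fun x => -f x) i = fun x => -partialDeriv f i x := by
  ext x
  simp only [partialDeriv, fderiv_fun_neg, _root_.neg_apply]

section Manifold

variable {n : ℕ} {M : Type*} [TopologicalSpace M] [ChartedSpace (Coord n) M]

/-- Every neighbourhood contains a smaller one that stays connected after removing its center. -/
theorem exists_punctured_nhds (hn : 2 ≤ n) {z : M} {A : Set M} (hA : A ∈ 𝓝 z) :
    ∃ N ⊆ A, IsOpen N ∧ z ∈ N ∧ IsPreconnected (N \ {z}) ∧ (N \ {z}).Nonempty := by
  set e := chartAt (Coord n) z with he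
  have hze : z ∈ e.source := mem_chart_source (Coord n) z
  have h1 : e.target ∩ e.symm ⁻¹' A ∈ 𝓝 (e z) :=
    inter_mem (e.open_target.mem_nhds (e.map_source hze))
      (e.continuousAt_symm (e.map_source hze) (by rwa [e.left_inv hze]))
  obtain ⟨r, hr, hball⟩ := Metric.mem_nhds_iff.1 h1
  have hsub : Metric.ball (e z) r ⊆ e.target := fun u hu => (hball hu).1
  have hdiff : e.symm '' Metric.ball (e z) r \ {z} = e.symm '' (Metric.ball (e z) r \ {e z}) := by
    ext x
    constructor
    · rintro ⟨⟨u, hu, rfl⟩, hx⟩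
      refine ⟨u, ⟨hu, ?_⟩, rfl⟩
      rintro rfl
      exact hx (e.left_inv hze)
    · rintro ⟨u, ⟨hu, hne⟩, rfl⟩
      refine ⟨⟨u, hu, rfl⟩, ?_⟩
      rintro (hx : e.symm u = z)
      exact hne (show u = e z by rw [← hx, e.right_inv (hsub hu)])
  refine ⟨e.symm '' Metric.ball (e z) r, ?_, ?_, ⟨e z, Metric.mem_ball_self hr, e.left_inv hze⟩, ?_, ?_⟩
  · rintro _ ⟨u, hu, rfl⟩
    exact (hball hu).2
  · exact e.isOpen_image_symm_of_subset_target Metric.isOpen_ball hsub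
  · rw [hdiff]
    exact (isPreconnected_ball_diff_center (one_lt_rank_coord hn) _ _).image _
      (e.continuousOn_symm.mono (sdiff_subset.trans hsub))
  · rw [hdiff]
    refine Nonempty.image _ ?_
    have : Nontrivial (Coord n) := by
      have : Nonempty (Fin n) := ⟨⟨0, by omega⟩⟩
      infer_instance
    have := Module.punctured_nhds_neBot ℝ (Coord n) (e z)
    obtain ⟨u, hu, hne⟩ := Filter.nonempty_of_mem (inter_mem
      (nhdsWithin_le_nhds (Metric.ball_mem_nhds (e z) hr)) (self_mem_nhdsWithin (s := {e z}ᶜ)))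
    exact ⟨u, hu, hne⟩

theorem eventually_of_chart {p : M} {Q : Coord n → Prop} {Q' : M → Prop}
    (h : ∀ᶠ u in 𝓝 (chartAt (Coord n) p p), Q u)
    (hQ : ∀ q ∈ (chartAt (Coord n) p).source, Q (chartAt (Coord n) p q) → Q' q) :
    ∀ᶠ q in 𝓝 p, Q' q := by
  have hp := mem_chart_source (Coord n) p
  filter_upwards [(chartAt (Coord n) p).open_source.mem_nhds hp,
    ((chartAt (Coord n) p).continuousAt hp).eventually h] with q hq h using hQ q hq h

theorem isCriticalPoint_neg_iff {ρ : M → ℝ} {p : M} :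
    IsCriticalPoint n (fun x => -ρ x) p ↔ IsCriticalPoint n ρ p := by
  have : mfderiv (𝓡 n) 𝓘(ℝ, ℝ) (fun x => -ρ x) p = -mfderiv (𝓡 n) 𝓘(ℝ, ℝ) ρ p := mfderiv_neg
  unfold IsCriticalPoint
  rw [this]
  exact neg_eq_zero (α := Coord n →L[ℝ] ℝ)

variable [IsManifold (𝓡 n) ∞ M]

namespace FinslerStructure

variable {F : FinslerStructure n M} {ρ φ : M → ℝ}

/-- The equation is linear in (ρ, φ), as Γ* and g do not involve ρ. So maxima reduce to minima,
although for a non-reversible F the gradient of -ρ need not be minus the gradient of ρ. -/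
theorem IsSolution.neg (hsol : F.IsSolution ρ φ) :
    F.IsSolution (fun x => -ρ x) (fun x => -φ x) := by
  intro x₀ u hu v hv k l
  have h := hsol x₀ u hu v hv k l
  simp only [horizontalHessian, partialDeriv_neg] at h ⊢
  simp only [mul_neg, Finset.sum_neg_distrib, neg_mul]
  linarith

theorem continuous_factor (hn : 2 ≤ n) (hρ : ContMDiff (𝓡 n) 𝓘(ℝ, ℝ) ∞ ρ)
    (hsol : F.IsSolution ρ φ) : Continuous φ := by
  rw [continuous_iff_continuousAt]
  intro p
  have hp := mem_chart_source (Coord n) p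
  have hS := localSolution hρ hsol p
  have h1 := (hS.contDiffOn_factor (by omega)).continuousOn.continuousAt
    (hS.isOpen.mem_nhds ((chartAt (Coord n) p).map_source hp))
  refine (ContinuousAt.comp (f := chartAt (Coord n) p) (x := p) h1
    ((chartAt (Coord n) p).continuousAt hp)).congr ?_
  filter_upwards [(chartAt (Coord n) p).open_source.mem_nhds hp] with q hq
  simp only [Function.comp]
  rw [(chartAt (Coord n) p).left_inv hq]

/-- The common zeros of dρ and φ form a closed set, which is open by `eventually_critical`. If it
were nonempty it would be all of M, and ρ would be constant. -/
theorem factor_ne_zero [ConnectedSpace M] (hn : 2 ≤ n) (hρ : ContMDiff (𝓡 n) 𝓘(ℝ, ℝ) ∞ ρ)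
    (hsol : F.IsSolution ρ φ) (hnonconst : ∃ p q : M, ρ p ≠ ρ q) {z : M}
    (hz : IsCriticalPoint n ρ z) : φ z ≠ 0 := by
  intro hφ
  have hclosed : IsClosed {z | IsCriticalPoint n ρ z ∧ φ z = 0} := by
    refine IsClosed.inter ?_ (isClosed_eq (continuous_factor hn hρ hsol) continuous_const)
    exact isOpen_compl_iff.1 (isOpen_regular hρ hsol)
  have hopen : IsOpen {z | IsCriticalPoint n ρ z ∧ φ z = 0} := by
    rw [isOpen_iff_mem_nhds]
    rintro z ⟨hz, hφ⟩
    have hp := mem_chart_source (Coord n) z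
    refine eventually_of_chart ((localSolution hρ hsol z).eventually_critical hn
      ((chartAt (Coord n) z).map_source hp) ((isCriticalPoint_iff hρ hp).1 hz)
      (by rwa [(chartAt (Coord n) z).left_inv hp])) fun q hq h => ?_
    rw [(chartAt (Coord n) z).left_inv hq] at h
    exact ⟨(isCriticalPoint_iff hρ hq).2 h.1, h.2⟩
  have huniv := IsClopen.eq_univ ⟨hclosed, hopen⟩ ⟨z, hz, hφ⟩
  have hcrit : ∀ p, IsCriticalPoint n ρ p := fun p =>
    (huniv ▸ mem_univ p : p ∈ {z | IsCriticalPoint n ρ z ∧ φ z = 0}).1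
  obtain ⟨p, q, hpq⟩ := hnonconst
  refine hpq (IsLocallyConstant.apply_eq_of_preconnectedSpace
    ((IsLocallyConstant.iff_eventually_eq ρ).2 fun x => ?_) p q)
  set e := chartAt (Coord n) x with he
  have hx : x ∈ e.source := mem_chart_source (Coord n) x
  obtain ⟨r, hr, hball⟩ := Metric.mem_nhds_iff.1 (e.open_target.mem_nhds (e.map_source hx))
  have hS := localSolution hρ hsol x
  refine eventually_of_chart (Metric.ball_mem_nhds (e x) hr) fun q hq h => ?_
  have h1 := Metric.isOpen_ball.is_const_of_fderiv_eq_zero (𝕜 := ℝ) (f := fun u => ρ (e.symm u))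
    Metric.isPreconnected_ball
    (fun u hu => (ContDiffOn.hasFDerivAt_of_isOpen hS.isOpen hS.smooth
      (hball hu)).differentiableAt.differentiableWithinAt)
    (fun u hu => (isCriticalPoint_chart_symm_iff hρ (hball hu)).1 (hcrit _)) h
    (Metric.mem_ball_self hr)
  rwa [e.left_inv hq, e.left_inv hx] at h1

theorem eventually_lt_of_isCriticalPoint (hρ : ContMDiff (𝓡 n) 𝓘(ℝ, ℝ) ∞ ρ)
    (hsol : F.IsSolution ρ φ) {z : M} (hz : IsCriticalPoint n ρ z) (hφ : 0 < φ z) :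
    ∀ᶠ x in 𝓝 z, x ≠ z → ρ z < ρ x ∧ ¬ IsCriticalPoint n ρ x := by
  have hp := mem_chart_source (Coord n) z
  refine eventually_of_chart ((localSolution hρ hsol z).eventually_lt_of_critical
    ((chartAt (Coord n) z).map_source hp) ((isCriticalPoint_iff hρ hp).1 hz)
    (by rwa [(chartAt (Coord n) z).left_inv hp])) fun q hq h hqz => ?_
  have := h fun he => hqz ((chartAt (Coord n) z).injOn hq hp he)
  rw [(chartAt (Coord n) z).left_inv hq, (chartAt (Coord n) z).left_inv hp] at this
  exact ⟨this.1, (isCriticalPoint_iff hρ hq).not.2 this.2⟩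

/-- Critical points are isolated. -/
theorem eventually_not_isCriticalPoint [ConnectedSpace M] (hn : 2 ≤ n)
    (hρ : ContMDiff (𝓡 n) 𝓘(ℝ, ℝ) ∞ ρ) (hsol : F.IsSolution ρ φ)
    (hnonconst : ∃ p q : M, ρ p ≠ ρ q) {z : M} (hz : IsCriticalPoint n ρ z) :
    ∀ᶠ x in 𝓝 z, x ≠ z → ¬ IsCriticalPoint n ρ x := by
  rcases lt_or_gt_of_ne (factor_ne_zero hn hρ hsol hnonconst hz) with hφ | hφ
  · filter_upwards [eventually_lt_of_isCriticalPoint hρ.neg hsol.neg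
      (isCriticalPoint_neg_iff.2 hz) (neg_pos.2 hφ)] with x hx hxz
    exact fun h => (hx hxz).2 (isCriticalPoint_neg_iff.2 h)
  · filter_upwards [eventually_lt_of_isCriticalPoint hρ hsol hz hφ] with x hx hxz
    exact (hx hxz).2

theorem isPreconnected_regular [ConnectedSpace M] (hn : 2 ≤ n)
    (hρ : ContMDiff (𝓡 n) 𝓘(ℝ, ℝ) ∞ ρ) (hsol : F.IsSolution ρ φ)
    (hnonconst : ∃ p q : M, ρ p ≠ ρ q) : IsPreconnected {p | ¬ IsCriticalPoint n ρ p} := by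
  refine isPreconnected_of_isolated_compl (isOpen_regular hρ hsol) fun z hz => ?_
  have hz : IsCriticalPoint n ρ z := not_not.1 hz
  obtain ⟨N, hNA, hNo, hzN, hNc, hNne⟩ := exists_punctured_nhds hn
    (eventually_not_isCriticalPoint hn hρ hsol hnonconst hz)
  refine ⟨N, hNo.mem_nhds hzN, hNc, fun x hx => hNA hx.1 hx.2, ?_⟩
  rw [mem_closure_iff_nhds]
  intro A hA
  obtain ⟨N', hN'A, -, -, -, x, hxN', hxz⟩ := exists_punctured_nhds hn
    (inter_mem hA (hNo.mem_nhds hzN))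
  exact ⟨x, (hN'A hxN').1, (hN'A hxN').2, hxz⟩

/-- `O` is a small ball in the chart, and `s₁` lies strictly below the minimum of ρ on the bounding
sphere. The sublevel set of the open ball then equals that of the closed ball, which is compact. -/
theorem exists_well (hn : 2 ≤ n) (hρ : ContMDiff (𝓡 n) 𝓘(ℝ, ℝ) ∞ ρ)
    (hsol : F.IsSolution ρ φ) {o : M} (ho : IsCriticalPoint n ρ o) (hφ : 0 < φ o) :
    ∃ O N s₁, Well {p | ¬ IsCriticalPoint n ρ p} ρ o O N s₁ := by
  set e := chartAt (Coord n) o with he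
  have hoe : o ∈ e.source := mem_chart_source (Coord n) o
  have hev := eventually_lt_of_isCriticalPoint hρ hsol ho hφ
  have h1 : e.target ∩ e.symm ⁻¹' {x | x ≠ o → ρ o < ρ x ∧ ¬ IsCriticalPoint n ρ x} ∈ 𝓝 (e o) :=
    inter_mem (e.open_target.mem_nhds (e.map_source hoe))
      (e.continuousAt_symm (e.map_source hoe) (by rwa [e.left_inv hoe]))
  obtain ⟨r, hr, hball⟩ := Metric.nhds_basis_closedBall.mem_iff.1 h1
  have hsub : Metric.closedBall (e o) r ⊆ e.target := fun u hu => (hball hu).1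
  have hne : ∀ u ∈ Metric.closedBall (e o) r, e.symm u ≠ o → ρ o < ρ (e.symm u) ∧
    ¬ IsCriticalPoint n ρ (e.symm u) := fun u hu => (hball hu).2
  have hcont : ContinuousOn (fun u => ρ (e.symm u)) (Metric.closedBall (e o) r) :=
    hρ.continuous.comp_continuousOn (e.continuousOn_symm.mono hsub)
  obtain ⟨m, hm, hsphere⟩ : ∃ m > ρ o, ∀ u ∈ Metric.sphere (e o) r, m ≤ ρ (e.symm u) := by
    rcases (Metric.sphere (e o) r).eq_empty_or_nonempty with hemp | hnemp
    · exact ⟨ρ o + 1, by linarith, by simp [hemp]⟩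
    obtain ⟨u, hu, hmin⟩ := (isCompact_sphere (e o) r).exists_isMinOn hnemp
      (hcont.mono Metric.sphere_subset_closedBall)
    have hu' := Metric.sphere_subset_closedBall hu
    refine ⟨ρ (e.symm u), (hne u hu' fun h => ?_).1, fun u hu => hmin hu⟩
    have : u = e o := by rw [← h, e.right_inv (hsub hu')]
    rw [this] at hu
    simp [hr.ne] at hu
  obtain ⟨s₁, hs₁, hs₁m⟩ := exists_between hm
  have hOo : IsOpen (e.symm '' Metric.ball (e o) r) := e.isOpen_image_symm_of_subset_target
    Metric.isOpen_ball (Metric.ball_subset_closedBall.trans hsub)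
  have hoO : o ∈ e.symm '' Metric.ball (e o) r := ⟨e o, Metric.mem_ball_self hr, e.left_inv hoe⟩
  obtain ⟨N, hNA, hNo, hoN, hNc, hNne⟩ := exists_punctured_nhds hn
    (inter_mem (hOo.mem_nhds hoO) (hρ.continuous.continuousAt.eventually_lt
      continuousAt_const hs₁ : ∀ᶠ x in 𝓝 o, ρ x < s₁))
  refine ⟨e.symm '' Metric.ball (e o) r, N, s₁, hOo, fun h => h ho, hs₁, ?_, ?_, ?_, hNo, hoN,
    fun x hx => (hNA hx).1, fun x hx => (hNA hx).2, hNc, hNne⟩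
  · rintro _ ⟨u, hu, rfl⟩ hxo
    exact (hne u (Metric.ball_subset_closedBall hu) hxo).2
  · rintro _ ⟨u, hu, rfl⟩ hxo
    exact (hne u (Metric.ball_subset_closedBall hu) hxo).1
  · have himage : e.symm '' Metric.ball (e o) r ∩ {x | ρ x ≤ s₁} =
        e.symm '' (Metric.closedBall (e o) r ∩ (fun u => ρ (e.symm u)) ⁻¹' Iic s₁) := by
      ext x
      constructor
      · rintro ⟨⟨u, hu, rfl⟩, hx⟩
        exact ⟨u, ⟨Metric.ball_subset_closedBall hu, hx⟩, rfl⟩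
      · rintro ⟨u, ⟨hu, hx⟩, rfl⟩
        refine ⟨⟨u, ?_, rfl⟩, hx⟩
        rw [← Metric.sphere_union_ball] at hu
        refine hu.resolve_left fun hus => ?_
        have := hsphere u hus
        have hx : ρ (e.symm u) ≤ s₁ := hx
        linarith
    rw [himage]
    refine IsCompact.image_of_continuousOn ?_ (e.continuousOn_symm.mono (inter_subset_left.trans hsub))
    exact (isCompact_closedBall _ _).of_isClosed_subset
      (hcont.preimage_isClosed_of_isClosed Metric.isClosed_closedBall isClosed_Iic) inter_subset_left

theorem radialFlow [T2Space M] [ConnectedSpace M] (hn : 2 ≤ n) (hF : F.IsComplete)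
    (hρ : ContMDiff (𝓡 n) 𝓘(ℝ, ℝ) ∞ ρ) (hsol : F.IsSolution ρ φ)
    (hnonconst : ∃ p q : M, ρ p ≠ ρ q) {o : M} (ho : IsCriticalPoint n ρ o) (hφ : 0 < φ o) :
    RadialFlow {p | ¬ IsCriticalPoint n ρ p} ρ (F.energy ρ) (F.IsTrajectory ρ) o := by
  obtain ⟨O, N, s₁, w⟩ := exists_well hn hρ hsol ho hφ
  exact w.radialFlow (levelFlow hρ hsol) hρ.continuous
    (fun z hz => exists_nhds_energy_eq hρ hsol hz) (continuous_energy hρ hsol)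
    (energy_pos_iff hρ hsol) (forwardComplete hF hρ hsol)
    (isPreconnected_regular hn hρ hsol hnonconst)

end FinslerStructure

end Manifold


/-! ### Lengths of curves and the dual norm inequality -/

section Manifold

variable {n : ℕ} {M : Type*} [TopologicalSpace M] [ChartedSpace (Coord n) M]

theorem exists_hasVelocityAt {c : ℝ → M} {t : ℝ}
    (h : MDifferentiableAt 𝓘(ℝ, ℝ) (𝓡 n) c t) : ∃ w : Coord n, HasVelocityAt c t w := by
  let A : ℝ →L[ℝ] Coord n := mfderiv 𝓘(ℝ, ℝ) (𝓡 n) c t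
  refine ⟨A 1, HasMFDerivAt.congr_mfderiv h.hasMFDerivAt ?_⟩
  exact (ContinuousLinearMap.ext_ring (by simp) : A = ContinuousLinearMap.toSpanSingleton ℝ (A 1))

variable {x₀ : M}

theorem HasVelocityAt.eventually_mem {c : ℝ → M} {t : ℝ} {w : Coord n} (h : HasVelocityAt c t w)
    (ht : c t ∈ (chartAt (Coord n) x₀).source) :
    ∀ᶠ s in 𝓝 t, c s ∈ (chartAt (Coord n) x₀).source :=
  (HasMFDerivAt.continuousAt h) ((chartAt (Coord n) x₀).open_source.mem_nhds ht)

variable [IsManifold (𝓡 n) ∞ M]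

theorem HasVelocityAt.exists_hasDerivAt {c : ℝ → M} {t : ℝ} {w : Coord n} (h : HasVelocityAt c t w)
    (ht : c t ∈ (chartAt (Coord n) x₀).source) :
    ∃ v : Coord n, chartSymmDeriv x₀ (chartAt (Coord n) x₀ (c t)) v = w ∧
      HasDerivAt (fun s => chartAt (Coord n) x₀ (c s)) v t := by
  obtain ⟨v, rfl⟩ := chartSymmDeriv_surjective ((chartAt (Coord n) x₀).map_source ht) w
  exact ⟨v, rfl, ((hasVelocityAt_iff ht v).1 h).2⟩

theorem fderiv_comp_chart {ρ : M → ℝ} (hρ : ContMDiff (𝓡 n) 𝓘(ℝ, ℝ) ∞ ρ) {q : M}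
    (hq : q ∈ (chartAt (Coord n) x₀).source) (v : Coord n) :
    fderiv ℝ (fun x => ρ ((chartAt (Coord n) x₀).symm x)) (chartAt (Coord n) x₀ q) v =
      differential ρ q (chartSymmDeriv x₀ (chartAt (Coord n) x₀ q) v) := by
  rw [fderiv_comp_chart_symm hρ ((chartAt (Coord n) x₀).map_source hq),
    (chartAt (Coord n) x₀).left_inv hq]

namespace FinslerStructure

variable {F : FinslerStructure n M} {ρ φ : M → ℝ}

theorem _root_.Finsler.HasVelocityAt.hasDerivAt_comp (hρ : ContMDiff (𝓡 n) 𝓘(ℝ, ℝ) ∞ ρ) {c : ℝ → M}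
    {t : ℝ} {w : Coord n} (h : HasVelocityAt c t w) :
    HasDerivAt (fun s => ρ (c s)) (differential ρ (c t) w) t := by
  have ht := mem_chart_source (Coord n) (c t)
  obtain ⟨v, rfl, hv⟩ := h.exists_hasDerivAt ht
  have h4 := (ContDiffOn.hasFDerivAt_of_isOpen (chartAt (Coord n) (c t)).open_target
    (contDiffOn_comp_chart_symm hρ (c t))
    ((chartAt (Coord n) (c t)).map_source ht)).comp_hasDerivAt t hv
  rw [fderiv_comp_chart hρ ht] at h4
  refine h4.congr_of_eventuallyEq ?_
  filter_upwards [h.eventually_mem ht] with s hs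
  simp only [Function.comp]
  rw [(chartAt (Coord n) (c t)).left_inv hs]

/-- `dW = φ dρ` along curves. -/
theorem _root_.Finsler.HasVelocityAt.hasDerivAt_energy (hρ : ContMDiff (𝓡 n) 𝓘(ℝ, ℝ) ∞ ρ)
    (hsol : F.IsSolution ρ φ) {c : ℝ → M} {t : ℝ} {w : Coord n} (h : HasVelocityAt c t w) :
    HasDerivAt (fun s => F.energy ρ (c s)) (φ (c t) * differential ρ (c t) w) t := by
  have ht := mem_chart_source (Coord n) (c t)
  obtain ⟨v, rfl, hv⟩ := h.exists_hasDerivAt ht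
  have h4 := ((localSolution hρ hsol (c t)).hasFDerivAt_energy
    ((chartAt (Coord n) (c t)).map_source ht)).comp_hasDerivAt t hv
  rw [_root_.smul_apply, fderiv_comp_chart hρ ht, (chartAt (Coord n) (c t)).left_inv ht,
    smul_eq_mul] at h4
  refine h4.congr_of_eventuallyEq ?_
  filter_upwards [h.eventually_mem ht] with s hs
  exact energy_eq_localEnergy hρ hs

/-- √(2W) is the dual norm of dρ; this is the Cauchy–Schwarz inequality for Legendre duals. -/
theorem differential_le (hρ : ContMDiff (𝓡 n) 𝓘(ℝ, ℝ) ∞ ρ) (q : M) (w : Coord n) :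
    differential ρ q w ≤ √(2 * F.energy ρ q) * F.toFun ⟨q, w⟩ := by
  have hq := mem_chart_source (Coord n) q
  have hu := (chartAt (Coord n) q).map_source hq
  obtain ⟨v, rfl⟩ := chartSymmDeriv_surjective hu w
  have hF := F.localFinsler q
  have h1 := (hF.isGrad_localGrad hu (fun x => ρ ((chartAt (Coord n) q).symm x))).le hF hu v
  rw [fderiv_comp_chart hρ hq, inChart_chart hq v] at h1
  rw [energy_eq_localEnergy hρ hq, localEnergy, mul_div_cancel₀ _ two_ne_zero,
    Real.sqrt_sq (hF.nonneg _ _)]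
  exact h1

theorem _root_.Finsler.chartSymmDeriv_mfderiv_chart {q : M}
    (hq : q ∈ (chartAt (Coord n) x₀).source) (y : Coord n) :
    chartSymmDeriv x₀ (chartAt (Coord n) x₀ q)
      (mfderiv (𝓡 n) (𝓡 n) (chartAt (Coord n) x₀) q y) = y :=
  congrArg (fun A => A y) ((mdifferentiable_chart' x₀).symm_comp_deriv hq)

theorem continuous_toFun (F : FinslerStructure n M) : Continuous F.toFun := by
  rw [continuous_iff_continuousAt]
  intro p
  set e := chartAt (Coord n) p.1 with he
  have hp : p.1 ∈ e.source := mem_chart_source (Coord n) p.1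
  have h1 : ContMDiffOn (𝓡 n) (𝓡 n) ∞ e e.source := contMDiffOn_chart
  have h2 := h1.continuousOn_tangentMapWithin (by simp) e.open_source.uniqueMDiffOn
  have hopen : IsOpen (Bundle.TotalSpace.proj (F := Coord n) (E := TangentSpace (𝓡 n) (M := M)) ⁻¹'
      e.source) := e.open_source.preimage (FiberBundle.continuous_proj _ _)
  have h3 := h2.continuousAt (hopen.mem_nhds hp)
  have h4 : ContinuousAt (fun p => tangentBundleModelSpaceHomeomorph (𝓡 n)
      (tangentMapWithin (𝓡 n) (𝓡 n) e e.source p)) p :=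
    (tangentBundleModelSpaceHomeomorph (𝓡 n)).continuous.continuousAt.comp h3
  have h5 := ContinuousAt.comp (x := p)
    (g := fun p' : Coord n × Coord n => inChart F.toFun p.1 p'.1 p'.2)
    (f := fun p => tangentBundleModelSpaceHomeomorph (𝓡 n)
      (tangentMapWithin (𝓡 n) (𝓡 n) e e.source p))
    ((F.localFinsler p.1).continuousAt (e.map_source hp) _) h4
  refine h5.congr ?_
  filter_upwards [hopen.mem_nhds hp] with p' hp'
  have hp' : p'.1 ∈ e.source := hp'
  have h6 : mfderivWithin (𝓡 n) (𝓡 n) e e.source p'.1 = mfderiv (𝓡 n) (𝓡 n) e p'.1 :=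
    mfderivWithin_of_isOpen e.open_source hp'
  have h7 := inChart_chart (F := F) hp' (mfderivWithin (𝓡 n) (𝓡 n) e e.source p'.1 p'.2)
  refine Eq.trans h7 ?_
  refine congrArg (fun w : Coord n => F.toFun ⟨p'.1, w⟩) ?_
  rw [h6]
  exact chartSymmDeriv_mfderiv_chart hp' p'.2

open MeasureTheory in
-- On the open interval the velocity coincides with the tangent map relative to the closed interval,
-- which is continuous up to the end points. The values of `velocity` at the end points do not
-- matter.
theorem intervalIntegrable_velocity {γ : ℝ → M} {a b : ℝ} (hab : a ≤ b)
    (h : ContMDiffOn 𝓘(ℝ, ℝ) (𝓡 n) ∞ γ (Icc a b)) :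
    IntervalIntegrable (fun t => F.toFun (velocity γ t)) volume a b := by
  rcases hab.eq_or_lt with rfl | hlt
  · exact IntervalIntegrable.refl
  have huniq : UniqueMDiffOn 𝓘(ℝ, ℝ) (Icc a b) :=
    uniqueMDiffOn_iff_uniqueDiffOn.2 (uniqueDiffOn_Icc hlt)
  have h1 := h.continuousOn_tangentMapWithin (by simp) huniq
  have h2 : Continuous fun t : ℝ => (⟨t, (1 : ℝ)⟩ : TangentBundle 𝓘(ℝ, ℝ) ℝ) :=
    (tangentBundleModelSpaceHomeomorph 𝓘(ℝ, ℝ)).symm.continuous.comp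
      (f := fun t : ℝ => ((t, 1) : ℝ × ℝ)) (by fun_prop)
  have h3 : ContinuousOn (fun t : ℝ => F.toFun (tangentMapWithin 𝓘(ℝ, ℝ) (𝓡 n) γ (Icc a b)
      ⟨t, (1 : ℝ)⟩)) (Icc a b) :=
    F.continuous_toFun.comp_continuousOn (h1.comp h2.continuousOn fun t ht => ht)
  rw [intervalIntegrable_iff_integrableOn_Ioo_of_le hab]
  refine ((h3.integrableOn_compact isCompact_Icc).mono_set Ioo_subset_Icc_self).congr_fun
    (fun t ht => ?_) measurableSet_Ioo
  have h4 := mfderivWithin_of_mem_nhds (I := 𝓘(ℝ, ℝ)) (I' := 𝓡 n) (f := γ)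
    (Icc_mem_nhds ht.1 ht.2)
  simp only [tangentMapWithin, velocity, h4]

/-- A lower bound for the length of curves. -/
theorem sub_le_length (hρ : ContMDiff (𝓡 n) 𝓘(ℝ, ℝ) ∞ ρ) {γ : ℝ → M} {a b : ℝ}
    (hγ : IsPiecewiseSmooth n γ a b) {f κ : ℝ → ℝ} (hf : ∀ t, HasDerivAt f (κ t) t)
    (hκ : ∀ (q : M) (w : Coord n), κ (ρ q) * differential ρ q w ≤ F.toFun ⟨q, w⟩) :
    f (ρ (γ b)) - f (ρ (γ a)) ≤ F.length γ a b := by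
  obtain ⟨N, τ, hτ, rfl, rfl, hsm⟩ := hγ
  have hpiece : ∀ i < N, IntervalIntegrable (fun t => F.toFun (velocity γ t)) MeasureTheory.volume
      (τ i) (τ (i + 1)) ∧ f (ρ (γ (τ (i + 1)))) - f (ρ (γ (τ i))) ≤ F.length γ (τ i) (τ (i + 1)) := by
    intro i hi
    have hle := hτ i.le_succ
    have hint := intervalIntegrable_velocity (F := F) hle (hsm i hi)
    refine ⟨hint, ?_⟩
    have hd : ∀ t ∈ Ioo (τ i) (τ (i + 1)), ∃ w : Coord n, HasVelocityAt γ t w := fun t ht =>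
      exists_hasVelocityAt (((hsm i hi).contMDiffAt (Icc_mem_nhds ht.1 ht.2)).mdifferentiableAt
        (by simp))
    choose! w hw using hd
    -- On each smooth piece f∘ρ∘γ has derivative κ dρ(γ'), which by `hκ` is at most F(γ').
    refine intervalIntegral.sub_le_integral_of_hasDeriv_right_of_le (g := fun t => f (ρ (γ t)))
      (g' := fun t => κ (ρ (γ t)) * differential ρ (γ t) (w t)) hle ?_ ?_
      ((integrableOn_Icc_iff_integrableOn_Ioc).2
        ((intervalIntegrable_iff_integrableOn_Ioc_of_le hle).1 hint)) ?_
    · have hfc : Continuous f := continuous_iff_continuousAt.2 fun t => (hf t).continuousAt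
      exact (hfc.comp hρ.continuous).comp_continuousOn (hsm i hi).continuousOn
    · intro t ht
      exact ((hf _).comp t ((hw t ht).hasDerivAt_comp hρ)).hasDerivWithinAt
    · intro t ht
      rw [(hw t ht).velocity_eq]
      exact hκ _ _
  have hsum : ∀ k ≤ N, IntervalIntegrable (fun t => F.toFun (velocity γ t)) MeasureTheory.volume
      (τ 0) (τ k) ∧ f (ρ (γ (τ k))) - f (ρ (γ (τ 0))) ≤ F.length γ (τ 0) (τ k) := by
    intro k
    induction k with
    | zero => exact fun _ => ⟨IntervalIntegrable.refl, by simp [length]⟩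
    | succ k ih =>
      intro hk
      obtain ⟨h1, h2⟩ := ih (by omega)
      obtain ⟨h3, h4⟩ := hpiece k hk
      refine ⟨h1.trans h3, ?_⟩
      have h5 : F.length γ (τ 0) (τ (k + 1)) = F.length γ (τ 0) (τ k) + F.length γ (τ k) (τ (k + 1)) :=
        (intervalIntegral.integral_add_adjacent_intervals h1 h3).symm
      linarith
  exact (hsum N le_rfl).2

end FinslerStructure

end Manifold


/-! ### The radius as a function of the level, and the lower bound for lengths -/

open MeasureTheory in
-- Comparison with a multiple of (t - a)^(-1/2). This gives the convergence of the radius integral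
-- at `ρ o`, where W tends to zero.
theorem intervalIntegrable_inv_sqrt {w : ℝ → ℝ} {a b m : ℝ} (hab : a < b) (hm : 0 < m)
    (hw : ContinuousOn w (Ioc a b)) (hlow : ∀ t ∈ Ioc a b, m * (t - a) ≤ w t) :
    IntervalIntegrable (fun t => (√(2 * w t))⁻¹) volume a b := by
  have hpos : ∀ t ∈ Ioc a b, 0 < w t := fun t ht =>
    (mul_pos hm (sub_pos.2 ht.1)).trans_le (hlow t ht)
  have h1 : IntervalIntegrable (fun t => (√(2 * m))⁻¹ * (t - a) ^ (-(1 / 2) : ℝ)) volume a b := by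
    have h2 := (intervalIntegral.intervalIntegrable_rpow' (a := 0) (b := b - a)
      (r := (-(1 / 2) : ℝ)) (by norm_num)).comp_sub_right a
    simp only [zero_add, sub_add_cancel] at h2
    exact h2.const_mul _
  rw [intervalIntegrable_iff_integrableOn_Ioc_of_le hab.le] at h1 ⊢
  refine Integrable.mono' h1 ?_ ?_
  · refine ContinuousOn.aestronglyMeasurable ?_ measurableSet_Ioc
    refine ContinuousOn.inv₀ (by fun_prop) fun t ht => (Real.sqrt_pos.2 ?_).ne'
    exact mul_pos two_pos (hpos t ht)
  · refine (ae_restrict_iff' measurableSet_Ioc).2 (Eventually.of_forall fun t ht => ?_)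
    have h0 : 0 < t - a := sub_pos.2 ht.1
    rw [Real.norm_of_nonneg (by positivity), Real.rpow_neg h0.le, ← Real.sqrt_eq_rpow, ← mul_inv,
      ← Real.sqrt_mul (by positivity)]
    have := hlow t ht
    exact inv_anti₀ (Real.sqrt_pos.2 (by positivity)) (Real.sqrt_le_sqrt (by linarith))

namespace FinslerStructure

variable {n : ℕ} {M : Type*} [TopologicalSpace M] [ChartedSpace (Coord n) M]
  [IsManifold (𝓡 n) ∞ M] {F : FinslerStructure n M} {ρ φ : M → ℝ} {o : M}

/-- A solution of `∇ᴴ∇ᴴρ = φ g` all of whose gradient lines issue from its minimum `o`. -/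
structure RadialSolution (F : FinslerStructure n M) (ρ φ : M → ℝ) (o : M) : Prop where
  smooth : ContMDiff (𝓡 n) 𝓘(ℝ, ℝ) ∞ ρ
  sol : F.IsSolution ρ φ
  crit : IsCriticalPoint n ρ o
  pos : 0 < φ o
  factor : Continuous φ
  flow : RadialFlow {p | ¬ IsCriticalPoint n ρ p} ρ (F.energy ρ) (F.IsTrajectory ρ) o
  dense : ∀ z, z ∈ closure {p | ¬ IsCriticalPoint n ρ p}

/-- The values of `ρ` at its regular points. -/
def levels (n : ℕ) {M : Type*} [TopologicalSpace M] [ChartedSpace (Coord n) M] (ρ : M → ℝ) :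
    Set ℝ := ρ '' {p | ¬ IsCriticalPoint n ρ p}

/-- Half the square of the norm of the gradient, as a function of the value of `ρ`. -/
noncomputable def levelEnergy (F : FinslerStructure n M) (ρ : M → ℝ) (t : ℝ) : ℝ :=
  Classical.epsilon fun w => ∃ p, ¬ IsCriticalPoint n ρ p ∧ ρ p = t ∧ F.energy ρ p = w

/-- The distance from `o` of the level `t` of `ρ`. -/
noncomputable def radius (F : FinslerStructure n M) (ρ : M → ℝ) (o : M) (t : ℝ) : ℝ :=
  ∫ s in ρ o..t, (√(2 * F.levelEnergy ρ s))⁻¹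

namespace RadialSolution

variable {p : M} {t : ℝ}

theorem levelEnergy_eq (h : F.RadialSolution ρ φ o) (hp : ¬ IsCriticalPoint n ρ p) :
    F.levelEnergy ρ (ρ p) = F.energy ρ p := by
  obtain ⟨q, hq, hqp, hqe⟩ := Classical.epsilon_spec
    (p := fun w => ∃ q, ¬ IsCriticalPoint n ρ q ∧ ρ q = ρ p ∧ F.energy ρ q = w)
    ⟨_, p, hp, rfl, rfl⟩
  rw [levelEnergy, ← hqe]
  exact h.flow.energy_eq q hq p hp hqp

theorem energy_pos (h : F.RadialSolution ρ φ o) (hp : ¬ IsCriticalPoint n ρ p) :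
    0 < F.energy ρ p := (energy_pos_iff h.smooth h.sol p).1 hp

theorem levelEnergy_pos (h : F.RadialSolution ρ φ o) (ht : t ∈ levels n ρ) :
    0 < F.levelEnergy ρ t := by
  obtain ⟨p, hp, rfl⟩ := ht
  rw [h.levelEnergy_eq hp]
  exact h.energy_pos hp

theorem lt_of_mem_levels (h : F.RadialSolution ρ φ o) (ht : t ∈ levels n ρ) : ρ o < t := by
  obtain ⟨p, hp, rfl⟩ := ht
  exact h.flow.lt p hp

theorem mem_levels_of_le (h : F.RadialSolution ρ φ o) (ht : t ∈ levels n ρ) {s : ℝ} (hs : ρ o < s)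
    (hst : s ≤ t) : s ∈ levels n ρ := by
  obtain ⟨p, hp, rfl⟩ := ht
  obtain ⟨y, hpy, hy⟩ := h.flow.reach p hp s ⟨hs, hst⟩
  exact ⟨y, hpy.mem_right h.flow.flow, hy⟩

theorem radius_self : F.radius ρ o (ρ o) = 0 := intervalIntegral.integral_same

variable [T2Space M]

theorem isOpen_levels (h : F.RadialSolution ρ φ o) : IsOpen (levels n ρ) := by
  rw [isOpen_iff_mem_nhds]
  rintro _ ⟨p, hp, rfl⟩
  filter_upwards [Well.exists_eventually_linked h.flow.flow (h.flow.flow.linked_refl hp) univ_mem]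
    with t ⟨z, _, hz, hzt⟩
  exact ⟨z, hz.mem_right h.flow.flow, hzt⟩

/-- Along a trajectory the parameter is the level and dρ of the velocity is 1, so dW = φ dρ reads W'
= φ. -/
theorem hasDerivAt_levelEnergy (h : F.RadialSolution ρ φ o) (hp : ¬ IsCriticalPoint n ρ p) :
    HasDerivAt (F.levelEnergy ρ) (φ p) (ρ p) := by
  obtain ⟨c, a, b, hc, hx, -, hcx, -⟩ := h.flow.flow.linked_refl hp
  have h1 := (hc _ hx).2.hasDerivAt_energy h.smooth h.sol
  have h2 := (hc _ hx).2.hasDerivAt_comp h.smooth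
  have h3 := h2.unique ((hc _ hx).hasDerivAt_level h.smooth h.sol)
  rw [h3, mul_one, hcx] at h1
  refine h1.congr_of_eventuallyEq ?_
  filter_upwards [isOpen_Ioo.mem_nhds hx] with s hs
  have h4 := h.levelEnergy_eq (hc s hs).1
  rwa [h.flow.flow.level_curve hc hx hcx hs] at h4

theorem continuousAt_levelEnergy (h : F.RadialSolution ρ φ o) (ht : t ∈ levels n ρ) :
    ContinuousAt (F.levelEnergy ρ) t := by
  obtain ⟨p, hp, rfl⟩ := ht
  exact (h.hasDerivAt_levelEnergy hp).continuousAt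

/-- Regular points are dense, so if `ρ p` were a regular level, W = `levelEnergy` ∘ ρ would extend
by continuity to `p` and be positive there. -/
theorem notMem_levels (h : F.RadialSolution ρ φ o) (hp : IsCriticalPoint n ρ p) :
    ρ p ∉ levels n ρ := by
  intro hmem
  have hne : (𝓝[{p | ¬ IsCriticalPoint n ρ p}] p).NeBot := mem_closure_iff_nhdsWithin_neBot.1 (h.dense p)
  have h1 : Tendsto (F.energy ρ) (𝓝[{p | ¬ IsCriticalPoint n ρ p}] p) (𝓝 (F.energy ρ p)) :=
    (continuous_energy h.smooth h.sol).continuousAt.mono_left nhdsWithin_le_nhds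
  have h2 : Tendsto (fun q => F.levelEnergy ρ (ρ q)) (𝓝[{p | ¬ IsCriticalPoint n ρ p}] p)
      (𝓝 (F.levelEnergy ρ (ρ p))) :=
    ((h.continuousAt_levelEnergy hmem).tendsto.comp h.smooth.continuous.continuousAt).mono_left
      nhdsWithin_le_nhds
  have h3 := tendsto_nhds_unique h1 (h2.congr' (by
    filter_upwards [self_mem_nhdsWithin] with q hq using h.levelEnergy_eq hq))
  have h4 := h.levelEnergy_pos hmem
  rw [← h3] at h4
  exact (energy_pos_iff h.smooth h.sol p).2 h4 hp

/-- Near `o` the derivative φ of the energy exceeds φ(o)/2, which gives linear growth just above `ρ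
o`. On the remaining compact interval the energy has a positive minimum. -/
theorem exists_lower_bound (h : F.RadialSolution ρ φ o) (ht : t ∈ levels n ρ) :
    ∃ m > 0, ∀ s ∈ Ioc (ρ o) t, m * (s - ρ o) ≤ F.levelEnergy ρ s := by
  have hlev : ∀ s ∈ Ioc (ρ o) t, s ∈ levels n ρ := fun s hs => h.mem_levels_of_le ht hs.1 hs.2
  obtain ⟨ε, hε, hnear⟩ := h.flow.shrink {p | φ o / 2 < φ p}
    (h.factor.continuousAt.eventually_const_lt (half_lt_self h.pos))
  have hot := h.lt_of_mem_levels ht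
  set b := min t (ρ o + ε / 2) with hb
  have hob : ρ o < b := lt_min hot (by linarith)
  have hpos := h.pos
  have h1 : ∀ s ∈ Ioc (ρ o) b, φ o / 2 * (s - ρ o) ≤ F.levelEnergy ρ s := by
    intro s hs
    -- The level `ρ o` is not regular, so `levelEnergy` has no meaning there. The mean value
    -- inequality is applied on `[s', s]`, and then `s'` decreases to `ρ o`.
    have h2 : ∀ s' ∈ Ioo (ρ o) s, φ o / 2 * (s - s') ≤ F.levelEnergy ρ s := by
      intro s' hs'
      have hmem : ∀ x ∈ Icc s' s, x ∈ levels n ρ := fun x hx =>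
        hlev x ⟨hs'.1.trans_le hx.1, hx.2.trans (hs.2.trans (min_le_left _ _))⟩
      have h3 := (convex_Icc s' s).mul_sub_le_image_sub_of_le_deriv (C := φ o / 2)
        (f := F.levelEnergy ρ)
        (fun x hx => (h.continuousAt_levelEnergy (hmem x hx)).continuousWithinAt)
        (fun x hx => by
          obtain ⟨q, hq, rfl⟩ := hmem x (interior_subset hx)
          exact (h.hasDerivAt_levelEnergy hq).differentiableAt.differentiableWithinAt)
        (fun x hx => by
          obtain ⟨q, hq, rfl⟩ := hmem x (interior_subset hx)
          rw [(h.hasDerivAt_levelEnergy hq).deriv]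
          refine (hnear q hq ?_).le
          have := (interior_subset hx).2
          linarith [hs.2, min_le_right t (ρ o + ε / 2)])
        s' (left_mem_Icc.2 hs'.2.le) s (right_mem_Icc.2 hs'.2.le) hs'.2.le
      have h4 := h.levelEnergy_pos (hmem s' (left_mem_Icc.2 hs'.2.le))
      linarith
    have h5 : Tendsto (fun s' => φ o / 2 * (s - s')) (𝓝[>] (ρ o)) (𝓝 (φ o / 2 * (s - ρ o))) :=
      (Continuous.tendsto (by fun_prop) _).mono_left nhdsWithin_le_nhds
    refine le_of_tendsto h5 ?_
    filter_upwards [Ioo_mem_nhdsGT hs.1] with s' hs' using h2 s' hs'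
  obtain ⟨s₀, hs₀, hmin⟩ := isCompact_Icc.exists_isMinOn (nonempty_Icc.2 (min_le_left t (ρ o + ε / 2)))
    (f := F.levelEnergy ρ) fun s hs => (h.continuousAt_levelEnergy
      (hlev s ⟨hob.trans_le hs.1, hs.2⟩)).continuousWithinAt
  have hs₀pos := h.levelEnergy_pos (hlev s₀ ⟨hob.trans_le hs₀.1, hs₀.2⟩)
  have hto : 0 < t - ρ o := sub_pos.2 hot
  refine ⟨min (φ o / 2) (F.levelEnergy ρ s₀ / (t - ρ o)), by positivity, fun s hs => ?_⟩
  have hso : 0 < s - ρ o := sub_pos.2 hs.1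
  rcases le_total s b with hsb | hsb
  · exact (mul_le_mul_of_nonneg_right (min_le_left _ _) hso.le).trans (h1 s ⟨hs.1, hsb⟩)
  · refine (mul_le_mul_of_nonneg_right (min_le_right _ _) hso.le).trans ?_
    refine le_trans ?_ (hmin ⟨hsb, hs.2⟩)
    rw [div_mul_eq_mul_div, div_le_iff₀ hto]
    have := hs.2
    gcongr

theorem intervalIntegrable (h : F.RadialSolution ρ φ o) (ht : t ∈ levels n ρ) :
    IntervalIntegrable (fun s => (√(2 * F.levelEnergy ρ s))⁻¹) MeasureTheory.volume (ρ o) t := by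
  obtain ⟨m, hm, hlow⟩ := h.exists_lower_bound ht
  exact intervalIntegrable_inv_sqrt (h.lt_of_mem_levels ht) hm (fun s hs =>
    (h.continuousAt_levelEnergy (h.mem_levels_of_le ht hs.1 hs.2)).continuousWithinAt) hlow

theorem continuousAt_inv_sqrt (h : F.RadialSolution ρ φ o) (ht : t ∈ levels n ρ) :
    ContinuousAt (fun s => (√(2 * F.levelEnergy ρ s))⁻¹) t := by
  have h1 := h.continuousAt_levelEnergy ht
  have h2 := h.levelEnergy_pos ht
  exact ContinuousAt.inv₀ (by fun_prop) (Real.sqrt_pos.2 (by positivity)).ne'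

theorem hasDerivAt_radius (h : F.RadialSolution ρ φ o) (ht : t ∈ levels n ρ) :
    HasDerivAt (F.radius ρ o) (√(2 * F.levelEnergy ρ t))⁻¹ t := by
  refine intervalIntegral.integral_hasDerivAt_right (h.intervalIntegrable ht) ?_
    (h.continuousAt_inv_sqrt ht)
  exact ContinuousOn.stronglyMeasurableAtFilter h.isOpen_levels
    (fun s hs => (h.continuousAt_inv_sqrt hs).continuousWithinAt) t ht

theorem continuousOn_radius (h : F.RadialSolution ρ φ o) (ht : t ∈ levels n ρ) :
    ContinuousOn (F.radius ρ o) (Icc (ρ o) t) := by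
  have hot := (h.lt_of_mem_levels ht).le
  have := intervalIntegral.continuousOn_primitive_interval (a := ρ o) (b := t)
    (f := fun s => (√(2 * F.levelEnergy ρ s))⁻¹) (μ := MeasureTheory.volume) (by
      rw [uIcc_of_le hot, integrableOn_Icc_iff_integrableOn_Ioc]
      exact (intervalIntegrable_iff_integrableOn_Ioc_of_le hot).1 (h.intervalIntegrable ht))
  rwa [uIcc_of_le hot] at this

theorem strictMonoOn_radius (h : F.RadialSolution ρ φ o) (ht : t ∈ levels n ρ) :
    StrictMonoOn (F.radius ρ o) (Icc (ρ o) t) := by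
  refine strictMonoOn_of_deriv_pos (convex_Icc _ _) (h.continuousOn_radius ht) fun s hs => ?_
  rw [interior_Icc] at hs
  have hs' := h.mem_levels_of_le ht hs.1 hs.2.le
  rw [(h.hasDerivAt_radius hs').deriv]
  have := h.levelEnergy_pos hs'
  positivity

theorem radius_lt (h : F.RadialSolution ρ φ o) (ht : t ∈ levels n ρ) {s : ℝ} (hs : ρ o ≤ s)
    (hst : s < t) : F.radius ρ o s < F.radius ρ o t :=
  h.strictMonoOn_radius ht ⟨hs, hst.le⟩ ⟨hs.trans hst.le, le_rfl⟩ hst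

theorem radius_pos (h : F.RadialSolution ρ φ o) (ht : t ∈ levels n ρ) : 0 < F.radius ρ o t := by
  have := h.radius_lt ht le_rfl (h.lt_of_mem_levels ht)
  rwa [radius_self] at this

/-- Curves from `o` to the level `t` are not shorter than `radius t`. -/
theorem radius_le_length (h : F.RadialSolution ρ φ o) (ht : t ∈ levels n ρ) {γ : ℝ → M} {a b : ℝ}
    (hγ : IsPiecewiseSmooth n γ a b) (ha : γ a = o) (hb : t ≤ ρ (γ b)) :
    F.radius ρ o t ≤ F.length γ a b := by
  have hot := h.lt_of_mem_levels ht
  obtain ⟨l, u, htlu, hlu⟩ := mem_nhds_iff_exists_Ioo_subset.1 (h.isOpen_levels.mem_nhds ht)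
  obtain ⟨t₂, htt₂, ht₂u⟩ := exists_between htlu.2
  have ht₂ : t₂ ∈ levels n ρ := hlu ⟨htlu.1.trans htt₂, ht₂u⟩
  set k : ℝ → ℝ := fun s => (√(2 * F.levelEnergy ρ s))⁻¹ with hk
  have hrad : ∀ s ∈ Ioo (ρ o) t, F.radius ρ o t - F.radius ρ o s ≤ F.length γ a b := by
    intro s hs
    obtain ⟨s₂, hs₂, hs₂s⟩ := exists_between hs.1
    -- The curve may leave the regular levels, where 1/√(2W) is out of control. The cutoff is 1 on
    -- `[s, t]` and vanishes outside `[s₂, t₂]`, an interval of regular levels, so that the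
    -- inequality κ dρ ≤ F holds everywhere.
    set χ : ℝ → ℝ := fun x => max 0 (min 1 (min ((x - s₂) / (s - s₂)) ((t₂ - x) / (t₂ - t)))) with hχ
    have hd1 : 0 < s - s₂ := sub_pos.2 hs₂s
    have hd2 : 0 < t₂ - t := sub_pos.2 htt₂
    have hχ0 : ∀ x, 0 ≤ χ x := fun x => le_max_left _ _
    have hχ1 : ∀ x, χ x ≤ 1 := fun x => max_le zero_le_one (min_le_left _ _)
    have hχs : ∀ x, χ x ≠ 0 → x ∈ Icc s₂ t₂ := by
      intro x hx
      by_contra hnot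
      refine hx (max_eq_left ?_)
      rcases lt_or_ge x s₂ with h1 | h1
      · exact (min_le_right _ _).trans ((min_le_left _ _).trans
          (div_nonpos_of_nonpos_of_nonneg (by linarith) hd1.le))
      · have h2 : t₂ < x := lt_of_not_ge fun h2 => hnot ⟨h1, h2⟩
        exact (min_le_right _ _).trans ((min_le_right _ _).trans
          (div_nonpos_of_nonpos_of_nonneg (by linarith) hd2.le))
    have hχe : ∀ x ∈ Icc s t, χ x = 1 := by
      intro x hx
      have h1 : 1 ≤ (x - s₂) / (s - s₂) := by rw [le_div_iff₀ hd1]; linarith [hx.1]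
      have h2 : 1 ≤ (t₂ - x) / (t₂ - t) := by rw [le_div_iff₀ hd2]; linarith [hx.2]
      simp only [hχ, min_eq_left (le_min h1 h2)]
      exact max_eq_right zero_le_one
    -- Clamping to `[s₂, t₂]` makes the integrand continuous on the whole line without changing it
    -- on the support of `χ`.
    set π : ℝ → ℝ := fun x => max s₂ (min t₂ x) with hπ
    have hst₂ : s₂ ≤ t₂ := (hs₂s.trans (hs.2.trans htt₂)).le
    have hπm : ∀ x, π x ∈ levels n ρ := fun x => h.mem_levels_of_le ht₂
      (hs₂.trans_le (le_max_left _ _)) (max_le hst₂ (min_le_left _ _))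
    have hπe : ∀ x ∈ Icc s₂ t₂, π x = x := fun x hx => by
      simp only [hπ, min_eq_right hx.2, max_eq_right hx.1]
    have hkc : Continuous fun x => k (π x) := continuous_iff_continuousAt.2 fun x =>
      ContinuousAt.comp (g := k) (f := π) (h.continuousAt_inv_sqrt (hπm x)) (by fun_prop)
    have hχc : Continuous χ := by fun_prop
    have hk0 : ∀ x, 0 ≤ k x := fun x => by positivity
    have hκ0 : ∀ x, 0 ≤ χ x * k (π x) := fun x => mul_nonneg (hχ0 x) (hk0 _)
    have hf : ∀ x, HasDerivAt (fun y => ∫ z in s..y, χ z * k (π z)) (χ x * k (π x)) x := fun x =>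
      ((hχc.mul hkc).integral_hasStrictDerivAt s x).hasDerivAt
    have hmono : Monotone fun y => ∫ z in s..y, χ z * k (π z) :=
      monotone_of_deriv_nonneg (fun x => (hf x).differentiableAt) fun x => by
        rw [(hf x).deriv]; exact hκ0 x
    have h1 := F.sub_le_length h.smooth hγ hf fun q w => by
      by_cases h0 : χ (ρ q) = 0
      · rw [h0, zero_mul, zero_mul]; exact F.nonneg _
      have hq := hχs _ h0
      have hq' := h.mem_levels_of_le ht₂ (hs₂.trans_le hq.1) hq.2
      have hreg : ¬ IsCriticalPoint n ρ q := fun hc => h.notMem_levels hc hq'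
      have hpos := h.energy_pos hreg
      have h2 := F.differential_le h.smooth q w
      rw [hπe _ hq]
      simp only [hk]
      rw [h.levelEnergy_eq hreg, mul_assoc]
      have h3 : 0 < √(2 * F.energy ρ q) := Real.sqrt_pos.2 (by positivity)
      have h4 : (√(2 * F.energy ρ q))⁻¹ * differential ρ q w ≤ F.toFun ⟨q, w⟩ := by
        rw [inv_mul_le_iff₀ h3]
        exact h2
      calc _ ≤ χ (ρ q) * F.toFun ⟨q, w⟩ := mul_le_mul_of_nonneg_left h4 (hχ0 _)
        _ ≤ 1 * F.toFun ⟨q, w⟩ := mul_le_mul_of_nonneg_right (hχ1 _) (F.nonneg _)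
        _ = _ := one_mul _
    have h2 := hmono hb
    have h3 := hmono hs.1.le
    rw [ha] at h1
    simp only [intervalIntegral.integral_same] at h1 h2 h3
    have h4 : F.radius ρ o t - F.radius ρ o s = ∫ z in s..t, χ z * k (π z) := by
      rw [radius, radius, intervalIntegral.integral_interval_sub_left (h.intervalIntegrable ht)
        (h.intervalIntegrable (h.mem_levels_of_le ht hs.1 hs.2.le))]
      refine intervalIntegral.integral_congr fun x hx => ?_
      rw [uIcc_of_le hs.2.le] at hx
      rw [hχe x hx, hπe x ⟨hs₂s.le.trans hx.1, hx.2.trans htt₂.le⟩, one_mul]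
    linarith
  -- Letting `s` decrease to `ρ o` recovers the full radius.
  have hlim : Tendsto (fun s => F.radius ρ o t - F.radius ρ o s) (𝓝[>] (ρ o))
      (𝓝 (F.radius ρ o t - F.radius ρ o (ρ o))) := by
    refine tendsto_const_nhds.sub ?_
    have h1 := h.continuousOn_radius ht (ρ o) (left_mem_Icc.2 hot.le)
    rw [← nhdsWithin_Ioc_eq_nhdsGT hot]
    exact h1.mono_left (nhdsWithin_mono _ Ioc_subset_Icc_self)
  rw [radius_self, sub_zero] at hlim
  refine le_of_tendsto hlim ?_
  filter_upwards [Ioo_mem_nhdsGT hot] with s hs using hrad s hs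

end RadialSolution

end FinslerStructure


/-! ### Regularity of geodesics at the center -/

theorem differentiableAt_deriv {E : Type*} [NormedAddCommGroup E] [NormedSpace ℝ E] {g : ℝ → E}
    {t : ℝ} (hg : ContDiffAt ℝ 2 g t) : DifferentiableAt ℝ (deriv g) t := by
  have h1 := ((hg.fderiv_right (m := 1) one_add_one_eq_two.le).differentiableAt
    one_ne_zero).clm_apply (differentiableAt_const (1 : ℝ))
  simpa only [fderiv_apply_one_eq_deriv] using h1

/-- The second derivative of the geodesics. -/
noncomputable def sprayVec {n : ℕ} (L : Coord n → Coord n → ℝ) (u v : Coord n) : Coord n :=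
  WithLp.toLp 2 fun i => -(2 * sprayCoeff L i u v)

namespace LocalFinsler

variable {n : ℕ} {U : Set (Coord n)} {L : Coord n → Coord n → ℝ}

theorem contDiffOn_sprayVec (h : LocalFinsler U L) :
    ContDiffOn ℝ ∞ (fun p : Coord n × Coord n => sprayVec L p.1 p.2) (U ×ˢ {0}ᶜ) := by
  rw [contDiffOn_euclidean]
  intro i
  exact (contDiffOn_const.mul (h.smooth_sprayCoeff i)).neg

/-- A unit speed geodesic is smooth up to its starting point. -/
theorem contDiffOn_of_geodesic (h : LocalFinsler U L) {g : ℝ → Coord n} {δ : ℝ} (hδ : 0 < δ)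
    (hg0 : ContinuousWithinAt g (Ioi 0) 0) (hU : g 0 ∈ U) (hg : ∀ t ∈ Ioo 0 δ, ContDiffAt ℝ 2 g t)
    (hL : ∀ t ∈ Ioo 0 δ, L (g t) (deriv g t) = 1)
    (hgeo : ∀ t ∈ Ioo 0 δ, ∀ i,
      deriv (deriv g) t i + 2 * sprayCoeff L i (g t) (deriv g t) = 0) :
    ∃ δ' > 0, ContDiffOn ℝ ∞ g (Icc 0 δ') := by
  obtain ⟨a, C, ha, hC, hb⟩ := h.exists_bounds hU
  obtain ⟨r, hr, hball⟩ := Metric.nhds_basis_closedBall.mem_iff.1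
    (inter_mem (h.isOpen.mem_nhds hU) hb)
  have hev : ∀ᶠ t in 𝓝[>] (0 : ℝ), g t ∈ Metric.closedBall (g 0) r ∧ t ∈ Ioo 0 δ :=
    (hg0.eventually_mem (Metric.closedBall_mem_nhds _ hr)).and (Ioo_mem_nhdsGT hδ)
  obtain ⟨δ₁, hδ₁, hsub⟩ := mem_nhdsGT_iff_exists_Ioo_subset.1 hev
  have hδ₁ : 0 < δ₁ := hδ₁
  have hgb : ∀ t ∈ Ioo 0 δ₁, g t ∈ Metric.closedBall (g 0) r := fun t ht => (hsub ht).1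
  have hlt : ∀ t ∈ Ioo 0 δ₁, t ∈ Ioo 0 δ := fun t ht => (hsub ht).2
  -- Unit speed and the two-sided comparison of L with the Euclidean norm confine the velocities to
  -- an annulus, away from y = 0, where smoothness of the spray is not available.
  set A : Set (Coord n) := Metric.closedBall 0 (1 / a) \ Metric.ball 0 (1 / C) with hA
  have hA0 : A ⊆ {0}ᶜ := by
    rintro v ⟨-, hv⟩ rfl
    exact hv (Metric.mem_ball_self (by positivity))
  have hdA : ∀ t ∈ Ioo 0 δ₁, deriv g t ∈ A := by
    intro t ht
    obtain ⟨h1, h2⟩ := (hball (hgb t ht)).2 (deriv g t)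
    rw [hL t (hlt t ht)] at h1 h2
    refine ⟨?_, ?_⟩
    · rw [mem_closedBall_zero_iff, le_div_iff₀ ha]; linarith
    · rw [mem_ball_zero_iff, not_lt, div_le_iff₀ hC]; linarith
  set K : Set (Coord n × Coord n) := Metric.closedBall (g 0) r ×ˢ A with hKdef
  have hK : IsCompact K :=
    (isCompact_closedBall _ _).prod ((isCompact_closedBall _ _).diff Metric.isOpen_ball)
  have hKU : K ⊆ U ×ˢ {0}ᶜ := prod_mono (fun u hu => (hball hu).1) hA0
  have hYc := h.contDiffOn_sprayVec.continuousOn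
  obtain ⟨B, hB⟩ := hK.exists_bound_of_continuousOn (hYc.mono hKU)
  have hder : ∀ t ∈ Ioo 0 δ, HasDerivAt (deriv g) (sprayVec L (g t) (deriv g t)) t := by
    intro t ht
    refine (differentiableAt_deriv (hg t ht)).hasDerivAt.congr_deriv ?_
    ext i
    have := hgeo t ht i
    change deriv (deriv g) t i = -(2 * sprayCoeff L i (g t) (deriv g t))
    linarith
  -- The spray is bounded on the compact set `K`, so the velocity is Lipschitz and has a limit `v₀`
  -- at the starting point.
  have hlip : LipschitzOnWith (Real.toNNReal B) (deriv g) (Ioo 0 δ₁) := by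
    refine LipschitzOnWith.of_dist_le_mul fun x hx y hy => ?_
    rw [dist_eq_norm, dist_eq_norm]
    refine (convex_Ioo 0 δ₁).norm_image_sub_le_of_norm_hasDerivWithin_le
      (fun t ht => (hder t (hlt t ht)).hasDerivWithinAt) (fun t ht => ?_) hy hx
    exact (hB (g t, deriv g t) ⟨hgb t ht, hdA t ht⟩).trans (Real.le_coe_toNNReal B)
  have hne : (𝓝[Ioo 0 δ₁] (0 : ℝ)).NeBot := by
    rw [nhdsWithin_Ioo_eq_nhdsGT hδ₁]; infer_instance
  obtain ⟨v₀, hv₀⟩ : ∃ v₀, Tendsto (deriv g) (𝓝[Ioo 0 δ₁] (0 : ℝ)) (𝓝 v₀) := by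
    refine cauchy_map_iff_exists_tendsto.1 ?_
    exact (cauchy_nhds.mono nhdsWithin_le_nhds).map_of_le hlip.uniformContinuousOn
      (le_principal_iff.2 self_mem_nhdsWithin)
  have hclosedA : IsClosed A := Metric.isClosed_closedBall.sdiff Metric.isOpen_ball
  have hv₀A : v₀ ∈ A := hclosedA.mem_of_tendsto hv₀ (by
    filter_upwards [self_mem_nhdsWithin] with t ht using hdA t ht)
  rw [nhdsWithin_Ioo_eq_nhdsGT hδ₁] at hv₀
  have hmem0 : (g 0, v₀) ∈ U ×ˢ ({0}ᶜ : Set (Coord n)) := ⟨hU, hA0 hv₀A⟩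
  -- The velocity extended by its limit. The pair (g, g₁) solves the first order geodesic system on
  -- a closed interval, including the end point 0, hence is smooth there.
  set g₁ : ℝ → Coord n := Function.update (deriv g) 0 v₀ with hg₁
  have hg₁0 : g₁ 0 = v₀ := Function.update_self _ _ _
  have hg₁t : ∀ t, 0 < t → g₁ =ᶠ[𝓝 t] deriv g := fun t ht => by
    filter_upwards [isOpen_Ioi.mem_nhds ht] with s hs
    exact Function.update_of_ne (ne_of_gt hs) _ _
  have hg₁e : g₁ =ᶠ[𝓝[>] 0] deriv g := by
    filter_upwards [self_mem_nhdsWithin] with s hs using (hg₁t s hs).self_of_nhds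
  have hd0 : HasDerivWithinAt g v₀ (Ici 0) 0 := hasDerivWithinAt_Ici_of_tendsto_deriv
    (fun t ht => ((hg t (hlt t ht)).differentiableAt two_ne_zero).differentiableWithinAt)
    (hg0.mono Ioo_subset_Ioi_self) (Ioo_mem_nhdsGT hδ₁) hv₀
  have hd1 : HasDerivWithinAt g₁ (sprayVec L (g 0) v₀) (Ici 0) 0 := by
    refine hasDerivWithinAt_Ici_of_tendsto_deriv (s := Ioo 0 δ₁) (fun t ht => ?_) ?_
      (Ioo_mem_nhdsGT hδ₁) ?_
    · exact ((hder t (hlt t ht)).congr_of_eventuallyEq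
        (hg₁t t ht.1)).differentiableAt.differentiableWithinAt
    · refine ContinuousWithinAt.mono (t := Ioi 0) ?_ Ioo_subset_Ioi_self
      rw [ContinuousWithinAt, hg₁0]
      exact hv₀.congr' hg₁e.symm
    · have h1 : Tendsto (fun t => sprayVec L (g t) (deriv g t)) (𝓝[>] 0)
          (𝓝 (sprayVec L (g 0) v₀)) := by
        refine Tendsto.comp (f := fun t => (g t, deriv g t))
          (hYc.continuousAt ((h.isOpen.prod isOpen_compl_singleton).mem_nhds hmem0)) ?_
        exact hg0.tendsto.prodMk_nhds hv₀
      refine h1.congr' ?_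
      filter_upwards [Ioo_mem_nhdsGT hδ₁] with t ht
      rw [(hg₁t t ht.1).deriv_eq, (hder t (hlt t ht)).deriv]
  refine ⟨δ₁ / 2, half_pos hδ₁, ?_⟩
  have hmain : ContDiffOn ℝ ∞ (fun t => (g t, g₁ t)) (Icc 0 (δ₁ / 2)) := by
    refine ODE.contDiffOn_enat_Icc_of_hasDerivWithinAt (n := ⊤) (u := U ×ˢ {0}ᶜ)
      (f := fun _ p => (p.2, sprayVec L p.1 p.2)) ?_ ?_ ?_
    · exact (contDiffOn_snd.comp contDiffOn_snd (fun p hp => hp.2)).prodMk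
        (h.contDiffOn_sprayVec.comp contDiffOn_snd fun p hp => hp.2)
    · intro t ht
      rcases ht.1.eq_or_lt with rfl | h0
      · refine HasDerivWithinAt.prodMk (hd0.mono Icc_subset_Ici_self |>.congr_deriv hg₁0.symm) ?_
        rw [hg₁0]
        exact hd1.mono Icc_subset_Ici_self
      · have ht' := hlt t ⟨h0, by linarith [ht.2]⟩
        have h1 := (hg₁t t h0).self_of_nhds
        refine HasDerivAt.hasDerivWithinAt (HasDerivAt.prodMk ?_ ?_)
        · rw [h1]
          exact ((hg t ht').differentiableAt two_ne_zero).hasDerivAt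
        · simp only [h1]
          exact (hder t ht').congr_of_eventuallyEq (hg₁t t h0)
    · intro t ht
      rcases ht.1.eq_or_lt with rfl | h0
      · simpa only [hg₁0] using hmem0
      · have ht' : t ∈ Ioo 0 δ₁ := ⟨h0, by linarith [ht.2]⟩
        refine ⟨(hball (hgb t ht')).1, ?_⟩
        change g₁ t ∈ ({0}ᶜ : Set (Coord n))
        rw [(hg₁t t h0).self_of_nhds]
        exact hA0 (hdA t ht')
  exact contDiff_fst.comp_contDiffOn hmain

end LocalFinsler

/-- Through every point there is a trajectory that comes from the center. -/
theorem RadialFlow.exists_curve {M : Type*} [TopologicalSpace M] [T2Space M] {S : Set M}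
    {ρ W : M → ℝ} {P : (ℝ → M) → ℝ → Prop} {o q : M} (h : RadialFlow S ρ W P o) (hq : q ∈ S) :
    ∃ (c : ℝ → M) (b : ℝ), ρ q < b ∧ (∀ t ∈ Ioo (ρ o) b, P c t ∧ ρ (c t) = t) ∧ c (ρ q) = q := by
  have hfl := h.flow
  obtain ⟨c₀, a₀, b₀, hc₀, hx₀, -, hcx₀, -⟩ := hfl.linked_refl hq
  obtain ⟨b, hqb, hbb₀⟩ := exists_between hx₀.2
  have hb : b ∈ Ioo a₀ b₀ := ⟨hx₀.1.trans hqb, hbb₀⟩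
  have hy : ∀ t ∈ Ioo (ρ o) b, ∃ y, Linked ρ P q y ∧ ρ y = t := by
    intro t ht
    rcases le_total t (ρ q) with h1 | h1
    · exact h.reach q hq t ⟨ht.1, h1⟩
    · have ht₀ : t ∈ Ioo a₀ b₀ := ⟨hx₀.1.trans_le h1, ht.2.trans hbb₀⟩
      exact ⟨c₀ t, hfl.linked_curve hc₀ hx₀ hcx₀ ht₀, hfl.level_curve hc₀ hx₀ hcx₀ ht₀⟩
  have : Nonempty M := ⟨q⟩
  -- `c t` is the only point of the trajectory of `q` on the level `t`. It therefore agrees locally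
  -- with solution curves and is itself a solution on the whole interval.
  choose! c hc hcρ using hy
  refine ⟨c, b, hqb, fun t ht => ⟨?_, hcρ t ht⟩, ?_⟩
  · obtain ⟨c₁, a₁, b₁, hc₁, hx₁, hy₁, hcx₁, hcy₁⟩ := hc t ht
    rw [hcρ t ht] at hy₁ hcy₁
    refine hfl.congr (c := c₁) ?_ (hc₁ t hy₁)
    filter_upwards [isOpen_Ioo.mem_nhds hy₁, isOpen_Ioo.mem_nhds ht] with s hs₁ hs
    exact ((hfl.linked_curve hc₁ hx₁ hcx₁ hs₁).symm.trans (hc s hs) hfl).eq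
      ((hfl.level_curve hc₁ hx₁ hcx₁ hs₁).trans (hcρ s hs).symm)
  · have hqI : ρ q ∈ Ioo (ρ o) b := ⟨h.lt q hq, hqb⟩
    exact ((hc _ hqI).eq (hcρ _ hqI).symm).symm


/-! ### Minimizing geodesics from the center and the distance function -/

namespace LocalSolution

variable {n : ℕ} {U : Set (Coord n)} {L : Coord n → Coord n → ℝ} {ρ φ : Coord n → ℝ}
  {u v : Coord n}

theorem norm_localGrad (h : LocalSolution U L ρ φ) (u : Coord n) :
    L u (localGrad L ρ u) = √(2 * localEnergy L ρ u) := by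
  rw [localEnergy, mul_div_cancel₀ _ two_ne_zero, Real.sqrt_sq (h.finsler.nonneg _ _)]

/-- The unit vector field in the direction of the gradient of `ρ`. -/
theorem unit_localGrad (h : LocalSolution U L ρ φ) (hu : u ∈ U) (hρ : fderiv ℝ ρ u ≠ 0) :
    (L u (localGrad L ρ u))⁻¹ • localGrad L ρ u =
      √(2 * localEnergy L ρ u) • levelField L ρ u := by
  have hpos : 0 < 2 * localEnergy L ρ u := mul_pos two_pos (h.localEnergy_pos hu hρ)
  rw [h.norm_localGrad, levelField, smul_smul]
  congr 1
  have h1 := Real.sqrt_pos.2 hpos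
  nth_rw 3 [← Real.mul_self_sqrt hpos.le]
  field_simp

theorem contDiffAt_unit_localGrad (h : LocalSolution U L ρ φ) (hu : u ∈ U)
    (hρ : fderiv ℝ ρ u ≠ 0) :
    ContDiffAt ℝ ∞ (fun u => (L u (localGrad L ρ u))⁻¹ • localGrad L ρ u) u := by
  have hpos : 0 < 2 * localEnergy L ρ u := mul_pos two_pos (h.localEnergy_pos hu hρ)
  simp only [h.norm_localGrad]
  exact (((contDiffAt_const.mul (h.contDiffAt_localEnergy hu hρ)).sqrt hpos.ne').inv
    (Real.sqrt_pos.2 hpos).ne').smul (h.finsler.contDiffAt_localGrad hu h.smooth hρ)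

end LocalSolution

namespace FinslerStructure

variable {n : ℕ} {M : Type*} [TopologicalSpace M] [ChartedSpace (Coord n) M]
  [IsManifold (𝓡 n) ∞ M] {F : FinslerStructure n M} {ρ φ : M → ℝ} {o : M} {t : ℝ}

/-- Curves whose velocity is the unit vector in the direction of the gradient of `ρ`. -/
def IsUnitTrajectory (F : FinslerStructure n M) (ρ : M → ℝ) (γ : ℝ → M) (t : ℝ) : Prop :=
  ∀ x₀ : M, γ t ∈ (chartAt (Coord n) x₀).source → HasDerivAt (fun s => chartAt (Coord n) x₀ (γ s))
    ((inChart F.toFun x₀ (chartAt (Coord n) x₀ (γ t)) (localGrad (inChart F.toFun x₀)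
      (fun x => ρ ((chartAt (Coord n) x₀).symm x)) (chartAt (Coord n) x₀ (γ t))))⁻¹ •
    localGrad (inChart F.toFun x₀) (fun x => ρ ((chartAt (Coord n) x₀).symm x))
      (chartAt (Coord n) x₀ (γ t))) t

variable {γ : ℝ → M}

theorem IsUnitTrajectory.norm_velocity (hρ : ContMDiff (𝓡 n) 𝓘(ℝ, ℝ) ∞ ρ) (hreg : ¬ IsCriticalPoint n ρ (γ t))
    (hc : ContinuousAt γ t) (hγ : IsUnitTrajectory F ρ γ t) : F.toFun (velocity γ t) = 1 := by
  have ht := mem_chart_source (Coord n) (γ t)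
  have hF := F.localFinsler (γ t)
  have hu := (chartAt (Coord n) (γ t)).map_source ht
  rw [((hasVelocityAt_iff ht _).2 ⟨hc, hγ _ ht⟩).velocity_eq]
  refine (inChart_chart ht _).symm.trans ?_
  have hpos := hF.pos hu (hF.localGrad_ne_zero hu ((isCriticalPoint_iff hρ ht).not.1 hreg))
  rw [hF.homog _ _ _ (inv_pos.2 hpos), inv_mul_cancel₀ hpos.ne']

theorem IsUnitTrajectory.geodesic (hρ : ContMDiff (𝓡 n) 𝓘(ℝ, ℝ) ∞ ρ) (hsol : F.IsSolution ρ φ)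
    (hreg : ¬ IsCriticalPoint n ρ (γ t)) (hc : ContinuousAt γ t)
    (hγ : ∀ᶠ s in 𝓝 t, IsUnitTrajectory F ρ γ s) {x₀ : M}
    (ht : γ t ∈ (chartAt (Coord n) x₀).source) (i : Fin n) :
    deriv (deriv fun s => chartAt (Coord n) x₀ (γ s)) t i + 2 * sprayCoeff (inChart F.toFun x₀) i
      (chartAt (Coord n) x₀ (γ t)) (deriv (fun s => chartAt (Coord n) x₀ (γ s)) t) = 0 := by
  refine (localSolution hρ hsol x₀).geodesic_of_grad (γ := fun s => chartAt (Coord n) x₀ (γ s))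
    ((chartAt (Coord n) x₀).map_source ht) ((isCriticalPoint_iff hρ ht).not.1 hreg) ?_ i
  filter_upwards [hγ, hc ((chartAt (Coord n) x₀).open_source.mem_nhds ht)] with s hs hs1
  exact hs x₀ hs1

theorem IsUnitTrajectory.contDiffAt (hρ : ContMDiff (𝓡 n) 𝓘(ℝ, ℝ) ∞ ρ) (hsol : F.IsSolution ρ φ)
    (hreg : ¬ IsCriticalPoint n ρ (γ t)) (hc : ContinuousAt γ t)
    (hγ : ∀ᶠ s in 𝓝 t, IsUnitTrajectory F ρ γ s) {x₀ : M}
    (ht : γ t ∈ (chartAt (Coord n) x₀).source) :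
    ContDiffAt ℝ ∞ (fun s => chartAt (Coord n) x₀ (γ s)) t := by
  have hS := localSolution hρ hsol x₀
  refine contDiffAt_of_ode hS.isOpen_regular
    (fun x hx => (hS.contDiffAt_unit_localGrad hx.1 hx.2).contDiffWithinAt)
    ⟨(chartAt (Coord n) x₀).map_source ht, (isCriticalPoint_iff hρ ht).not.1 hreg⟩ ?_
  filter_upwards [hγ, hc ((chartAt (Coord n) x₀).open_source.mem_nhds ht)] with s hs hs1
  exact hs x₀ hs1

/-- The reparametrization of the gradient lines by arc length. -/
theorem RadialSolution.isUnitTrajectory_comp (h : F.RadialSolution ρ φ o) {c : ℝ → M} {T : ℝ → ℝ}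
    (hc : F.IsTrajectory ρ c (T t)) (hρc : ρ (c (T t)) = T t)
    (hT : HasDerivAt T (√(2 * F.levelEnergy ρ (T t))) t) (hγ : γ =ᶠ[𝓝 t] c ∘ T) :
    IsUnitTrajectory F ρ γ t := by
  intro x₀ ht
  have hγt : γ t = c (T t) := hγ.self_of_nhds
  rw [hγt] at ht ⊢
  have hS := localSolution h.smooth h.sol x₀
  have hu := (chartAt (Coord n) x₀).map_source ht
  obtain ⟨h1, h2, h3⟩ := (isTrajectory_iff h.smooth ht).1 hc
  have h4 := h3.scomp t hT
  rw [hS.unit_localGrad hu h2, ← energy_eq_localEnergy h.smooth ht, ← h.levelEnergy_eq hc.1, hρc]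
  refine h4.congr_of_eventuallyEq ?_
  filter_upwards [hγ] with s hs
  rw [hs]; rfl

theorem IsUnitSpeedGeodesic.length_eq {r : ℝ} (hr : 0 ≤ r)
    (h : F.IsUnitSpeedGeodesic γ r) : F.length γ 0 r = r := by
  rw [length, intervalIntegral.integral_congr_Ioo_of_le hr fun t ht => (h.2 t ht).1]
  simp

namespace RadialSolution

variable [T2Space M]

/-- The inverse function of the radius. -/
theorem exists_inverse_radius (h : F.RadialSolution ρ φ o) (ht : t ∈ levels n ρ) :
    ∃ T : ℝ → ℝ, (∀ s ∈ Icc (ρ o) t, T (F.radius ρ o s) = s) ∧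
      (∀ τ ∈ Ioo 0 (F.radius ρ o t), T τ ∈ Ioo (ρ o) t ∧
        HasDerivAt T (√(2 * F.levelEnergy ρ (T τ))) τ) ∧
      Tendsto T (𝓝[>] 0) (𝓝 (ρ o)) := by
  have hot := h.lt_of_mem_levels ht
  have hR0 : F.radius ρ o (ρ o) = 0 := radius_self
  have hmono := h.strictMonoOn_radius ht
  have hcont := h.continuousOn_radius ht
  have hRt := h.radius_pos ht
  have hderiv := fun s (hs : s ∈ levels n ρ) => h.hasDerivAt_radius hs
  set R := F.radius ρ o with hR
  have hleft : ∀ s ∈ Icc (ρ o) t, Function.invFunOn R (Icc (ρ o) t) (R s) = s :=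
    hmono.injOn.leftInvOn_invFunOn
  set T := Function.invFunOn R (Icc (ρ o) t) with hT
  have hsurj : ∀ τ ∈ Icc 0 (R t), ∃ s ∈ Icc (ρ o) t, R s = τ := by
    have := intermediate_value_Icc hot.le hcont
    rwa [hR0] at this
  have hmem : ∀ τ ∈ Icc 0 (R t), T τ ∈ Icc (ρ o) t ∧ R (T τ) = τ := fun τ hτ =>
    ⟨Function.invFunOn_mem (hsurj τ hτ), Function.invFunOn_eq (hsurj τ hτ)⟩
  have hIoo : ∀ τ ∈ Ioo 0 (R t), T τ ∈ Ioo (ρ o) t := by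
    intro τ hτ
    obtain ⟨h1, h2⟩ := hmem τ (Ioo_subset_Icc_self hτ)
    refine ⟨lt_of_le_of_ne h1.1 fun h3 => ?_, lt_of_le_of_ne h1.2 fun h3 => ?_⟩
    · rw [← h3, hR0] at h2; exact hτ.1.ne h2
    · rw [h3] at h2; exact hτ.2.ne' h2
  have hTmono : StrictMonoOn T (Icc 0 (R t)) := by
    intro x hx y hy hxy
    rwa [← hmono.lt_iff_lt (hmem x hx).1 (hmem y hy).1, (hmem x hx).2, (hmem y hy).2]
  have hRmem : ∀ s ∈ Icc (ρ o) t, R s ∈ Icc 0 (R t) := by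
    intro s hs
    rw [← hR0]
    exact ⟨hmono.monotoneOn (left_mem_Icc.2 hot.le) hs hs.1,
      hmono.monotoneOn hs (right_mem_Icc.2 hot.le) hs.2⟩
  refine ⟨T, hleft, fun τ hτ => ⟨hIoo τ hτ, ?_⟩, ?_⟩
  · have hl := h.mem_levels_of_le ht (hIoo τ hτ).1 (hIoo τ hτ).2.le
    have hTc : ContinuousAt T τ := by
      refine hTmono.continuousAt_of_image_mem_nhds (Icc_mem_nhds hτ.1 hτ.2) ?_
      refine mem_of_superset (Icc_mem_nhds (hIoo τ hτ).1 (hIoo τ hτ).2) fun s hs => ?_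
      exact ⟨R s, hRmem s hs, hleft s hs⟩
    have h1 := HasDerivAt.of_local_left_inverse hTc (hderiv _ hl)
      (inv_pos.2 (Real.sqrt_pos.2 (mul_pos two_pos (h.levelEnergy_pos hl)))).ne' (by
        filter_upwards [isOpen_Ioo.mem_nhds hτ] with x hx
          using (hmem x (Ioo_subset_Icc_self hx)).2)
    rwa [inv_inv] at h1
  · refine tendsto_order.2 ⟨fun a ha => ?_, fun a ha => ?_⟩
    · filter_upwards [Ioo_mem_nhdsGT hRt] with τ hτ using ha.trans (hIoo τ hτ).1
    · have hs : min a t ∈ Icc (ρ o) t := ⟨le_min ha.le hot.le, min_le_right _ _⟩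
      have hpos : 0 < R (min a t) := by
        rw [← hR0]; exact hmono (left_mem_Icc.2 hot.le) hs (lt_min ha hot)
      filter_upwards [Ioo_mem_nhdsGT hpos] with τ hτ
      have h1 := hTmono ⟨hτ.1.le, hτ.2.le.trans (hRmem _ hs).2⟩ (hRmem _ hs) hτ.2
      rw [hleft _ hs] at h1
      exact h1.trans_le (min_le_left _ _)

/-- Every regular point is the end point of a minimizing geodesic that issues from `o`. -/
theorem exists_geodesic (h : F.RadialSolution ρ φ o) {q : M} (hq : ¬ IsCriticalPoint n ρ q) :
    ∃ γ : ℝ → M, ContMDiffOn 𝓘(ℝ, ℝ) (𝓡 n) ∞ γ (Icc 0 (F.radius ρ o (ρ q))) ∧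
      F.IsUnitSpeedGeodesic γ (F.radius ρ o (ρ q)) ∧ γ 0 = o ∧ γ (F.radius ρ o (ρ q)) = q := by
  obtain ⟨c, b₁, hqb₁, hc, hcq⟩ := h.flow.exists_curve hq
  -- A level slightly above that of `q`, so that the radius `r` of `q` is an interior time of the
  -- curve and smoothness at the end point is automatic.
  obtain ⟨b, hqb, hbb₁⟩ := exists_between hqb₁
  have hoq : ρ o < ρ q := h.flow.lt q hq
  have hbI : b ∈ Ioo (ρ o) b₁ := ⟨hoq.trans hqb, hbb₁⟩
  have hb : b ∈ levels n ρ := ⟨c b, (hc b hbI).1.1, (hc b hbI).2⟩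
  obtain ⟨T, hTR, hTd, hT0⟩ := h.exists_inverse_radius hb
  have hrpos := h.radius_pos ⟨q, hq, rfl⟩
  have hrb := h.radius_lt hb hoq.le hqb
  set r := F.radius ρ o (ρ q) with hr
  set B := F.radius ρ o b with hB
  set γ : ℝ → M := fun τ => if 0 < τ then c (T τ) else o with hγ
  have hγ0 : γ 0 = o := if_neg (lt_irrefl 0)
  have hγpos : ∀ τ, 0 < τ → γ τ = c (T τ) := fun τ hτ => if_pos hτ
  have hγe : ∀ τ, 0 < τ → γ =ᶠ[𝓝 τ] c ∘ T := fun τ hτ => by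
    filter_upwards [isOpen_Ioi.mem_nhds hτ] with s hs using hγpos s hs
  have hTI : ∀ τ ∈ Ioo 0 B, T τ ∈ Ioo (ρ o) b₁ := fun τ hτ =>
    ⟨(hTd τ hτ).1.1, (hTd τ hτ).1.2.trans hbb₁⟩
  have hreg : ∀ τ ∈ Ioo 0 B, ¬ IsCriticalPoint n ρ (γ τ) := fun τ hτ => by
    rw [hγpos τ hτ.1]
    exact (hc _ (hTI τ hτ)).1.1
  have hγc : ∀ τ ∈ Ioo 0 B, ContinuousAt γ τ := fun τ hτ => by
    refine ContinuousAt.congr ?_ (hγe τ hτ.1).symm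
    exact ContinuousAt.comp (h.flow.flow.continuousAt (hc _ (hTI τ hτ)).1)
      (hTd τ hτ).2.continuousAt
  have hunit : ∀ τ ∈ Ioo 0 B, IsUnitTrajectory F ρ γ τ := fun τ hτ =>
    h.isUnitTrajectory_comp (hc _ (hTI τ hτ)).1 (hc _ (hTI τ hτ)).2 (hTd τ hτ).2 (hγe τ hτ.1)
  have hunit' : ∀ τ ∈ Ioo 0 B, ∀ᶠ s in 𝓝 τ, IsUnitTrajectory F ρ γ s := fun τ hτ => by
    filter_upwards [isOpen_Ioo.mem_nhds hτ] with s hs using hunit s hs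
  have hBpos : 0 < B := hrpos.trans hrb
  have hlim : Tendsto γ (𝓝[>] 0) (𝓝 o) := by
    intro O hO
    obtain ⟨ε, hε, hsh⟩ := h.flow.shrink O hO
    rw [mem_map]
    filter_upwards [hT0.eventually_lt_const (lt_add_of_pos_right (ρ o) hε), Ioo_mem_nhdsGT hBpos]
      with τ hτ hτB
    refine hsh _ (hreg τ hτB) ?_
    rw [hγpos τ hτB.1, (hc _ (hTI τ hτB)).2]
    exact hτ
  have hsm : ∀ τ ∈ Ioo 0 B, ContMDiffAt 𝓘(ℝ, ℝ) (𝓡 n) ∞ γ τ := fun τ hτ =>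
    contMDiffAt_of_chart (hγc τ hτ) (mem_chart_source (Coord n) (γ τ))
      (IsUnitTrajectory.contDiffAt h.smooth h.sol (hreg τ hτ) (hγc τ hτ) (hunit' τ hτ)
        (mem_chart_source (Coord n) (γ τ)))
  have hnorm : ∀ τ ∈ Ioo 0 B, F.toFun (velocity γ τ) = 1 := fun τ hτ =>
    IsUnitTrajectory.norm_velocity h.smooth (hreg τ hτ) (hγc τ hτ) (hunit τ hτ)
  have hoe := mem_chart_source (Coord n) o
  -- The normalized gradient is not defined at `o`. Smoothness there comes from the geodesic
  -- equation on the open interval.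
  have hsm0 : ContMDiffWithinAt 𝓘(ℝ, ℝ) (𝓡 n) ∞ γ (Icc 0 r) 0 := by
    have hev : ∀ᶠ τ in 𝓝[>] (0 : ℝ), γ τ ∈ (chartAt (Coord n) o).source ∧ τ ∈ Ioo 0 B :=
      (hlim.eventually_mem ((chartAt (Coord n) o).open_source.mem_nhds hoe)).and
        (Ioo_mem_nhdsGT hBpos)
    obtain ⟨δ, hδ, hsub⟩ := mem_nhdsGT_iff_exists_Ioo_subset.1 hev
    have hδ : 0 < δ := hδ
    have hd : ∀ τ ∈ Ioo 0 δ, HasDerivAt (fun s => chartAt (Coord n) o (γ s)) _ τ := fun τ hτ =>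
      hunit τ (hsub hτ).2 o (hsub hτ).1
    have hF := F.localFinsler o
    obtain ⟨δ', hδ', hcd⟩ := hF.contDiffOn_of_geodesic (g := fun s => chartAt (Coord n) o (γ s)) hδ
      (by
        rw [ContinuousWithinAt, hγ0]
        exact ((chartAt (Coord n) o).continuousAt hoe).tendsto.comp hlim)
      (by rw [hγ0]; exact (chartAt (Coord n) o).map_source hoe)
      (fun τ hτ => (IsUnitTrajectory.contDiffAt h.smooth h.sol (hreg τ (hsub hτ).2)
        (hγc τ (hsub hτ).2) (hunit' τ (hsub hτ).2) (hsub hτ).1).of_le two_le_infty)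
      (fun τ hτ => by
        have hu := (chartAt (Coord n) o).map_source (hsub hτ).1
        have hpos := hF.pos hu (hF.localGrad_ne_zero hu
          ((isCriticalPoint_iff h.smooth (hsub hτ).1).not.1 (hreg τ (hsub hτ).2)))
        rw [(hd τ hτ).deriv, hF.homog _ _ _ (inv_pos.2 hpos), inv_mul_cancel₀ hpos.ne'])
      (fun τ hτ i => IsUnitTrajectory.geodesic h.smooth h.sol (hreg τ (hsub hτ).2)
        (hγc τ (hsub hτ).2) (hunit' τ (hsub hτ).2) (hsub hτ).1 i)
    have h1 : ContMDiffAt (𝓡 n) (𝓡 n) ∞ (chartAt (Coord n) o).symm (chartAt (Coord n) o (γ 0)) := by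
      rw [hγ0]
      exact contMDiffOn_chart_symm.contMDiffAt
        ((chartAt (Coord n) o).open_target.mem_nhds ((chartAt (Coord n) o).map_source hoe))
    have h2 := h1.comp_contMDiffWithinAt (f := fun s => chartAt (Coord n) o (γ s)) 0
      (hcd 0 (left_mem_Icc.2 hδ'.le)).contMDiffWithinAt
    have hset : 𝓝[Icc 0 r] (0 : ℝ) = 𝓝[Icc 0 δ'] (0 : ℝ) := by
      rw [nhdsWithin_Icc_eq_nhdsGE hrpos, nhdsWithin_Icc_eq_nhdsGE hδ']
    refine (h2.mono_of_mem_nhdsWithin (hset ▸ self_mem_nhdsWithin)).congr_of_eventuallyEq ?_ ?_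
    · filter_upwards [self_mem_nhdsWithin, mem_nhdsWithin_of_mem_nhds (Iio_mem_nhds hδ)]
        with s hs hsδ
      rcases hs.1.eq_or_lt with rfl | h0
      · exact ((chartAt (Coord n) o).left_inv (hγ0.symm ▸ hoe)).symm
      · exact ((chartAt (Coord n) o).left_inv (hsub ⟨h0, hsδ⟩).1).symm
    · exact ((chartAt (Coord n) o).left_inv (hγ0.symm ▸ hoe)).symm
  have hIB : ∀ τ, 0 < τ → τ ≤ r → τ ∈ Ioo 0 B := fun τ h0 h1 => ⟨h0, h1.trans_lt hrb⟩
  have hsmooth : ContMDiffOn 𝓘(ℝ, ℝ) (𝓡 n) ∞ γ (Icc 0 r) := by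
    intro τ hτ
    rcases hτ.1.eq_or_lt with rfl | h0
    · exact hsm0
    · exact (hsm τ (hIB τ h0 hτ.2)).contMDiffWithinAt
  refine ⟨γ, hsmooth, ⟨hsmooth.of_le two_le_infty, fun τ hτ => ?_⟩, hγ0, ?_⟩
  · have hτ' := hIB τ hτ.1 hτ.2.le
    exact ⟨hnorm τ hτ', fun x₀ hx₀ i => IsUnitTrajectory.geodesic h.smooth h.sol (hreg τ hτ')
      (hγc τ hτ') (hunit' τ hτ') hx₀ i⟩
  · rw [hγpos r hrpos, hTR _ ⟨hoq.le, hqb.le⟩, hcq]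

/-- The distance from `o` of a regular point. -/
theorem dist_eq (h : F.RadialSolution ρ φ o) {q : M} (hq : ¬ IsCriticalPoint n ρ q) :
    F.dist o q = F.radius ρ o (ρ q) := by
  obtain ⟨γ, hsm, hgeo, h0, hr⟩ := h.exists_geodesic hq
  have hpos := (h.radius_pos ⟨q, hq, rfl⟩).le
  have hps := isPiecewiseSmooth_of_contMDiffOn hpos hsm
  refine le_antisymm ?_ ?_
  · exact (dist_le_length hps h0 hr).trans_eq (IsUnitSpeedGeodesic.length_eq hpos hgeo)
  · refine le_csInf ⟨_, γ, 0, _, hps, h0, hr, rfl⟩ ?_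
    rintro _ ⟨γ', a, b, hγ', ha, hb, rfl⟩
    exact h.radius_le_length ⟨q, hq, rfl⟩ hγ' ha (by rw [hb])

end RadialSolution

end FinslerStructure


/-! ### Arbitrary geodesics from the center -/

namespace FinslerStructure

variable {n : ℕ} {M : Type*} [TopologicalSpace M] [ChartedSpace (Coord n) M]
  [IsManifold (𝓡 n) ∞ M] {F : FinslerStructure n M} {ρ φ : M → ℝ} {o : M} {γ : ℝ → M} {r t : ℝ}

/-- The second derivative of a solution of `∇ᴴ∇ᴴρ = φ g` along a unit speed geodesic is `φ`. -/
theorem IsUnitSpeedGeodesic.hasDerivAt_deriv (hρ : ContMDiff (𝓡 n) 𝓘(ℝ, ℝ) ∞ ρ)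
    (hsol : F.IsSolution ρ φ) (h : F.IsUnitSpeedGeodesic γ r) (ht : t ∈ Ioo 0 r) :
    HasDerivAt (deriv fun s => ρ (γ s)) (φ (γ t)) t := by
  obtain ⟨hF, hgeo⟩ := h.2 t ht
  have hts := mem_chart_source (Coord n) (γ t)
  set e := chartAt (Coord n) (γ t) with he
  have hsm : ContMDiffAt 𝓘(ℝ, ℝ) (𝓡 n) 2 γ t := h.1.contMDiffAt (Icc_mem_nhds ht.1 ht.2)
  have hev : ∀ᶠ s in 𝓝 t, γ s ∈ e.source := hsm.continuousAt (e.open_source.mem_nhds hts)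
  have hu := e.map_source hts
  have hS := localSolution hρ hsol (γ t)
  have hc : ContDiffAt ℝ 2 (fun s => e (γ s)) t := by
    have h1 : ContMDiffAt (𝓡 n) (𝓡 n) 2 e (γ t) :=
      (contMDiffOn_chart.contMDiffAt (e.open_source.mem_nhds hts)).of_le two_le_infty
    exact (h1.comp t hsm).contDiffAt
  have hc1 : ∀ᶠ s in 𝓝 t, DifferentiableAt ℝ (fun s => e (γ s)) s :=
    (hc.eventually (by simp)).mono fun s hs => hs.differentiableAt two_ne_zero
  set v := deriv (fun s => e (γ s)) t with hv
  have hL : inChart F.toFun (γ t) (e (γ t)) v = 1 := by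
    rw [inChart_chart hts, ← hF]
    exact (congrArg F.toFun ((hasVelocityAt_iff hts v).2
      ⟨hsm.continuousAt, hc1.self_of_nhds.hasDerivAt⟩).velocity_eq).symm
  have hv0 : v ≠ 0 := by
    intro h0
    rw [h0, hS.finsler.map_zero] at hL
    exact zero_ne_one hL
  have h1 := hS.hasDerivAt_along_geodesic (γ := fun s => e (γ s))
    (γ' := deriv fun s => e (γ s)) hc1.self_of_nhds.hasDerivAt
    (differentiableAt_deriv hc).hasDerivAt hu hv0 (hgeo (γ t) hts)
  simp only [← hv, hL, one_pow, mul_one, ← he, e.left_inv hts] at h1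
  refine h1.congr_of_eventuallyEq ?_
  filter_upwards [hev.eventually_nhds, hc1] with s hs hs1
  have h2 := (ContDiffOn.hasFDerivAt_of_isOpen hS.isOpen hS.smooth
    (e.map_source hs.self_of_nhds)).comp_hasDerivAt s hs1.hasDerivAt
  rw [← h2.deriv]
  refine EventuallyEq.deriv_eq ?_
  filter_upwards [hs] with x hx
  simp only [Function.comp, e.left_inv hx, ← he]

theorem IsUnitSpeedGeodesic.hasDerivAt_energy (hρ : ContMDiff (𝓡 n) 𝓘(ℝ, ℝ) ∞ ρ)
    (hsol : F.IsSolution ρ φ) (h : F.IsUnitSpeedGeodesic γ r) (ht : t ∈ Ioo 0 r) :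
    HasDerivAt (fun s => F.energy ρ (γ s)) (φ (γ t) * deriv (fun s => ρ (γ s)) t) t := by
  have hsm : ContMDiffAt 𝓘(ℝ, ℝ) (𝓡 n) 2 γ t := h.1.contMDiffAt (Icc_mem_nhds ht.1 ht.2)
  obtain ⟨w, hw⟩ := exists_hasVelocityAt (hsm.mdifferentiableAt two_ne_zero)
  rw [(hw.hasDerivAt_comp hρ).deriv]
  exact hw.hasDerivAt_energy hρ hsol

/-- Along a unit speed geodesic from a critical point, a solution of `∇ᴴ∇ᴴρ = φ g` has the
derivative zero at the starting point, and the geodesic is tangent to the gradient. -/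
theorem IsUnitSpeedGeodesic.exists_deriv (hρ : ContMDiff (𝓡 n) 𝓘(ℝ, ℝ) ∞ ρ)
    (hsol : F.IsSolution ρ φ) (h : F.IsUnitSpeedGeodesic γ r) (hr : 0 < r)
    (ho : IsCriticalPoint n ρ (γ 0)) : ∃ f' : ℝ → ℝ, ContinuousOn f' (Icc 0 r) ∧ f' 0 = 0 ∧
      (∀ t ∈ Ioo 0 r, HasDerivAt (fun s => ρ (γ s)) (f' t) t) ∧
      (∀ t ∈ Ioo 0 r, HasDerivAt f' (φ (γ t)) t) ∧
      ∀ t ∈ Icc 0 r, 2 * F.energy ρ (γ t) = f' t ^ 2 := by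
  have huniq := uniqueDiffOn_Icc hr
  have h0 : (0 : ℝ) ∈ Icc 0 r := left_mem_Icc.2 hr.le
  have hf : ContDiffOn ℝ 2 (fun s => ρ (γ s)) (Icc 0 r) :=
    ((hρ.of_le two_le_infty).comp_contMDiffOn h.1).contDiffOn
  set f' := derivWithin (fun s => ρ (γ s)) (Icc 0 r) with hf'
  have hc : ContinuousOn f' (Icc 0 r) := hf.continuousOn_derivWithin huniq one_le_two
  have hd : ∀ t ∈ Ioo 0 r, f' =ᶠ[𝓝 t] deriv fun s => ρ (γ s) := fun t ht => by
    filter_upwards [isOpen_Ioo.mem_nhds ht] with s hs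
    exact derivWithin_of_mem_nhds (Icc_mem_nhds hs.1 hs.2)
  have hf'0 : f' 0 = 0 := by
    have h1 := ((hρ (γ 0)).mdifferentiableAt (by simp)).hasMFDerivAt.comp_hasMFDerivWithinAt 0
      ((h.1 0 h0).mdifferentiableWithinAt two_ne_zero).hasMFDerivWithinAt
    let A : ℝ →L[ℝ] Coord n := mfderivWithin 𝓘(ℝ, ℝ) (𝓡 n) γ (Icc 0 r) 0
    have h2 : HasFDerivWithinAt (fun s => ρ (γ s)) ((differential ρ (γ 0)).comp A) (Icc 0 r) 0 :=
      h1.hasFDerivWithinAt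
    rw [isCriticalPoint_iff_differential.1 ho] at h2
    exact h2.hasDerivWithinAt.derivWithin (huniq 0 h0)
  have hdf : ∀ t ∈ Ioo 0 r, HasDerivAt (fun s => ρ (γ s)) (f' t) t := fun t ht => by
    rw [(hd t ht).self_of_nhds]
    exact ((hf.contDiffAt (Icc_mem_nhds ht.1 ht.2)).differentiableAt two_ne_zero).hasDerivAt
  have hdf' : ∀ t ∈ Ioo 0 r, HasDerivAt f' (φ (γ t)) t := fun t ht =>
    (h.hasDerivAt_deriv hρ hsol ht).congr_of_eventuallyEq (hd t ht)
  refine ⟨f', hc, hf'0, hdf, hdf', fun t ht => ?_⟩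
  have hE0 : F.energy ρ (γ 0) = 0 := by
    have h1 := (energy_pos_iff (F := F) hρ hsol (γ 0)).not.1 (not_not.2 ho)
    have h2 : 0 ≤ F.energy ρ (γ 0) := by rw [energy]; positivity
    linarith
  rcases ht.1.eq_or_lt with rfl | htpos
  · rw [hf'0, hE0]
    norm_num
  -- 2W - f'² has derivative 2φf' - 2f'φ = 0, and it vanishes at the critical starting point.
  have hcont : ContinuousOn (fun s => 2 * F.energy ρ (γ s) - f' s ^ 2) (Icc 0 r) :=
    (continuousOn_const.mul ((continuous_energy hρ hsol).comp_continuousOn h.1.continuousOn)).sub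
      (hc.pow 2)
  obtain ⟨s, hs, hslope⟩ := exists_hasDerivAt_eq_slope
    (fun s => 2 * F.energy ρ (γ s) - f' s ^ 2) (fun _ => 0) htpos
    (hcont.mono (Icc_subset_Icc_right ht.2)) fun s hs => by
      have hs' : s ∈ Ioo 0 r := ⟨hs.1, hs.2.trans_le ht.2⟩
      have h1 := h.hasDerivAt_energy hρ hsol hs'
      rw [(hdf s hs').deriv] at h1
      refine ((h1.const_mul 2).sub ((hdf' s hs').pow 2)).congr_deriv ?_
      push_cast
      ring
  rw [hE0, hf'0, eq_comm, div_eq_zero_iff] at hslope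
  rcases hslope with h1 | h1 <;> linarith

theorem RadialSolution.radius_injOn [T2Space M] (h : F.RadialSolution ρ φ o) :
    InjOn (F.radius ρ o) (levels n ρ) := by
  intro s hs t ht hst
  rcases lt_trichotomy s t with h1 | h1 | h1
  · exact ((h.radius_lt ht (h.lt_of_mem_levels hs).le h1).ne hst).elim
  · exact h1
  · exact ((h.radius_lt hs (h.lt_of_mem_levels ht).le h1).ne' hst).elim

/-- Unit speed geodesics from `o` move along the gradient of `ρ`. -/
theorem RadialSolution.level_geodesic [T2Space M] (h : F.RadialSolution ρ φ o)
    (hγ : F.IsUnitSpeedGeodesic γ r) (h0 : γ 0 = o) {c : ℝ} (hc : c ∈ levels n ρ)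
    (hr : r = F.radius ρ o c) : ¬ IsCriticalPoint n ρ (γ r) ∧ ρ (γ r) = c := by
  have hrpos : 0 < r := hr ▸ h.radius_pos hc
  obtain ⟨f', hf'c, hf'0, hf, hf', hE⟩ := hγ.exists_deriv h.smooth h.sol hrpos (h0.symm ▸ h.crit)
  set f : ℝ → ℝ := fun s => ρ (γ s) with hfdef
  have hγc := hγ.1.continuousOn
  have hfc : ContinuousOn f (Icc 0 r) := h.smooth.continuous.comp_continuousOn hγc
  have hf0 : f 0 = ρ o := congrArg ρ h0
  have hreg : ∀ t ∈ Icc 0 r, f' t ≠ 0 ↔ ¬ IsCriticalPoint n ρ (γ t) := fun t ht => by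
    have h1 := hE t ht
    rw [energy_pos_iff h.smooth h.sol (γ t)]
    constructor
    · intro h2
      have := sq_pos_of_ne_zero h2
      linarith
    · intro h2 h3
      rw [h3] at h1
      norm_num at h1
      exact h2.ne' h1
  have hmono : ∀ t ∈ Icc 0 r, (∀ s ∈ Ioo 0 t, 0 < f' s) → StrictMonoOn f (Icc 0 t) := by
    intro t ht hpos
    refine strictMonoOn_of_deriv_pos (convex_Icc _ _) (hfc.mono (Icc_subset_Icc_right ht.2))
      fun s hs => ?_
    rw [interior_Icc] at hs
    rw [(hf s ⟨hs.1, hs.2.trans_le ht.2⟩).deriv]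
    exact hpos s hs
  -- The derivative of the radius is 1/√(2W) = 1/f' as long as f' > 0, so radius ∘ f has slope one.
  have hrad : ∀ t ∈ Ioc 0 r, (∀ s ∈ Ioo 0 t, 0 < f' s) → f t ∈ levels n ρ →
      F.radius ρ o (f t) = t := by
    intro t ht hpos hlev
    have hm := (hmono t ⟨ht.1.le, ht.2⟩ hpos).monotoneOn
    have hgc : ContinuousOn (fun s => F.radius ρ o (f s)) (Icc 0 t) := by
      refine (h.continuousOn_radius hlev).comp (hfc.mono (Icc_subset_Icc_right ht.2)) fun s hs => ?_
      rw [← hf0]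
      exact ⟨hm (left_mem_Icc.2 ht.1.le) hs hs.1, hm hs (right_mem_Icc.2 ht.1.le) hs.2⟩
    obtain ⟨s, hs, hslope⟩ := exists_hasDerivAt_eq_slope (fun s => F.radius ρ o (f s)) (fun _ => 1)
      ht.1 hgc fun s hs => by
        have hs' : s ∈ Ioo 0 r := ⟨hs.1, hs.2.trans_le ht.2⟩
        have h1 := hpos s hs
        have h2 := (hreg s (Ioo_subset_Icc_self hs')).1 h1.ne'
        refine ((h.hasDerivAt_radius ⟨γ s, h2, rfl⟩).comp s (hf s hs')).congr_deriv ?_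
        rw [h.levelEnergy_eq h2, hE s (Ioo_subset_Icc_self hs'), Real.sqrt_sq h1.le,
          inv_mul_cancel₀ h1.ne']
    rw [hf0, radius_self, sub_zero, sub_zero, eq_div_iff ht.1.ne', one_mul] at hslope
    exact hslope.symm
  have hlt : ∀ t ∈ Ioo 0 r, f t ∈ levels n ρ → F.radius ρ o (f t) = t → f t < c := by
    intro t ht hlev hRt
    by_contra! hcf
    rcases hcf.eq_or_lt with h1 | h1
    · rw [← h1, ← hr] at hRt
      exact ht.2.ne' hRt
    · have := h.radius_lt hlev (h.lt_of_mem_levels hc).le h1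
      rw [← hr, hRt] at this
      exact this.not_gt ht.2
  -- Just after the start f'' = φ∘γ is positive and f'(0) = 0, so f' becomes positive.
  have hev : ∀ᶠ s in 𝓝[≥] (0 : ℝ), 0 < φ (γ s) := by
    rw [← nhdsWithin_Icc_eq_nhdsGE hrpos]
    refine (h.factor.comp_continuousOn hγc 0 (left_mem_Icc.2 hrpos.le)).eventually_const_lt ?_
    simpa [h0] using h.pos
  obtain ⟨δ, hδ, hδs⟩ := mem_nhdsGE_iff_exists_Icc_subset.1 hev
  have hδ : 0 < δ := hδ
  have hnear : ∀ s ∈ Ioc 0 (min δ r), 0 < f' s := by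
    intro s hs
    have hsr : s ≤ r := hs.2.trans (min_le_right _ _)
    have h1 : StrictMonoOn f' (Icc 0 s) := by
      refine strictMonoOn_of_deriv_pos (convex_Icc _ _) (hf'c.mono (Icc_subset_Icc_right hsr))
        fun x hx => ?_
      rw [interior_Icc] at hx
      rw [(hf' x ⟨hx.1, hx.2.trans_le hsr⟩).deriv]
      exact hδs ⟨hx.1.le, hx.2.le.trans (hs.2.trans (min_le_left _ _))⟩
    have h2 := h1 (left_mem_Icc.2 hs.1.le) (right_mem_Icc.2 hs.1.le) hs.1
    rwa [hf'0] at h2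
  have hpos : ∀ t ∈ Ioc 0 r, 0 < f' t := by
    by_contra! hbad
    obtain ⟨t₂, ht₂, hft₂⟩ := hbad
    set K := {t | t ∈ Icc (min δ r) r ∧ f' t ≤ 0} with hK
    have hδr : 0 < min δ r := lt_min hδ hrpos
    have hKc : IsClosed K := by
      have := (hf'c.mono (Icc_subset_Icc_left hδr.le)).preimage_isClosed_of_isClosed isClosed_Icc
        (isClosed_Iic (a := (0 : ℝ)))
      exact this
    have hKne : K.Nonempty := ⟨t₂, ⟨le_of_not_gt fun h1 =>
      (hnear t₂ ⟨ht₂.1, h1.le⟩).not_ge hft₂, ht₂.2⟩, hft₂⟩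
    have hKb : BddBelow K := ⟨min δ r, fun t ht => ht.1.1⟩
    have hmem := hKc.csInf_mem hKne hKb
    -- The first zero of f'. There γ meets a critical point, whose value lies above `ρ o` since f
    -- increases and at most `c` since the elapsed time is below the radius of `c`. Such a value is
    -- a regular level, a contradiction.
    set t₁ := sInf K with ht₁
    have ht₁I : t₁ ∈ Ioc 0 r := ⟨hδr.trans_le hmem.1.1, hmem.1.2⟩
    have hbelow : ∀ s ∈ Ioo 0 t₁, 0 < f' s := by
      intro s hs
      by_contra! hs0
      rcases le_total s (min δ r) with h1 | h1
      · exact (hnear s ⟨hs.1, h1⟩).not_ge hs0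
      · exact hs.2.not_ge (csInf_le hKb ⟨⟨h1, hs.2.le.trans ht₁I.2⟩, hs0⟩)
    have hwithin : (𝓝[Ioo 0 t₁] t₁).NeBot := by
      rw [nhdsWithin_Ioo_eq_nhdsLT ht₁I.1]; infer_instance
    have hsub : Ioo 0 t₁ ⊆ Icc 0 r := fun s hs => ⟨hs.1.le, hs.2.le.trans ht₁I.2⟩
    have hft₁ : f' t₁ = 0 := by
      refine le_antisymm hmem.2 (ge_of_tendsto
        ((hf'c t₁ ⟨ht₁I.1.le, ht₁I.2⟩).mono hsub).tendsto ?_)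
      filter_upwards [self_mem_nhdsWithin] with s hs using (hbelow s hs).le
    have hcrit : IsCriticalPoint n ρ (γ t₁) :=
      not_not.1 fun h1 => (hreg t₁ ⟨ht₁I.1.le, ht₁I.2⟩).2 h1 hft₁
    refine h.notMem_levels hcrit (h.mem_levels_of_le hc ?_ ?_)
    · rw [← hf0]
      exact hmono t₁ ⟨ht₁I.1.le, ht₁I.2⟩ hbelow (left_mem_Icc.2 ht₁I.1.le)
        (right_mem_Icc.2 ht₁I.1.le) ht₁I.1
    · refine le_of_tendsto ((hfc t₁ ⟨ht₁I.1.le, ht₁I.2⟩).mono hsub).tendsto ?_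
      filter_upwards [self_mem_nhdsWithin] with s hs
      have hs' : s ∈ Ioo 0 r := ⟨hs.1, hs.2.trans_le ht₁I.2⟩
      have hlev : f s ∈ levels n ρ :=
        ⟨γ s, (hreg s (Ioo_subset_Icc_self hs')).1 (hbelow s hs).ne', rfl⟩
      exact (hlt s hs' hlev (hrad s (Ioo_subset_Ioc_self hs')
        (fun x hx => hbelow x ⟨hx.1, hx.2.trans hs.2⟩) hlev)).le
  have hregr : ¬ IsCriticalPoint n ρ (γ r) :=
    (hreg r (right_mem_Icc.2 hrpos.le)).1 (hpos r (right_mem_Ioc.2 hrpos)).ne'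
  have hlev : f r ∈ levels n ρ := ⟨γ r, hregr, rfl⟩
  have hRr := hrad r (right_mem_Ioc.2 hrpos) (fun s hs => hpos s (Ioo_subset_Ioc_self hs)) hlev
  exact ⟨hregr, h.radius_injOn hlev hc (hRr.trans hr)⟩

end FinslerStructure


/-! ### The level sets are geodesic hyperspheres -/

namespace FinslerStructure

variable {n : ℕ} {M : Type*} [TopologicalSpace M] [ChartedSpace (Coord n) M]
  [IsManifold (𝓡 n) ∞ M] {F : FinslerStructure n M} {ρ φ : M → ℝ} {o : M} {c : ℝ}

theorem dist_nonneg (p q : M) : 0 ≤ F.dist p q := by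
  refine Real.sInf_nonneg ?_
  rintro _ ⟨γ, a, b, h, -, -, rfl⟩
  exact length_nonneg h.le

theorem dist_self (p : M) : F.dist p p = 0 := by
  refine le_antisymm ?_ (dist_nonneg p p)
  have h : IsPiecewiseSmooth n (fun _ : ℝ => p) 0 0 :=
    isPiecewiseSmooth_of_contMDiffOn le_rfl contMDiffOn_const
  refine (dist_le_length h rfl rfl).trans_eq ?_
  rw [length, intervalIntegral.integral_same]

namespace RadialSolution

variable [T2Space M]

/-- A value strictly between `ρ o` and `c` would be a regular level, which contains no critical
point. A value at most `ρ o` would force the regular points near `z` to be near `o`, by `shrink`. -/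
theorem le_of_isCriticalPoint (h : F.RadialSolution ρ φ o) {z : M} (hz : IsCriticalPoint n ρ z)
    (hzo : z ≠ o) (hc : c ∈ levels n ρ) : c ≤ ρ z := by
  by_contra! hlt
  refine h.notMem_levels hz (h.mem_levels_of_le hc ?_ hlt.le)
  by_contra! hle
  obtain ⟨A, B, hA, hB, hzA, hoB, hAB⟩ := t2_separation hzo
  obtain ⟨ε, hε, hsh⟩ := h.flow.shrink B (hB.mem_nhds hoB)
  have h1 : A ∩ {x | ρ x < ρ o + ε} ∈ 𝓝 z := inter_mem (hA.mem_nhds hzA)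
    (h.smooth.continuous.continuousAt.eventually_lt_const (hle.trans_lt (lt_add_of_pos_right _ hε)))
  obtain ⟨x, ⟨hxA, hxε⟩, hx⟩ := mem_closure_iff_nhds.1 (h.dense z) _ h1
  exact disjoint_left.1 hAB hxA (hsh x hx hxε)

theorem dist_ne_radius (h : F.RadialSolution ρ φ o) {z : M} (hz : IsCriticalPoint n ρ z)
    (hc : c ∈ levels n ρ) : F.dist o z ≠ F.radius ρ o c := by
  have hpos := h.radius_pos hc
  by_cases hzo : z = o
  · rw [hzo, dist_self]
    exact hpos.ne
  -- If no curve joined `o` to `z`, the infimum would take the default value 0, which also differs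
  -- from the positive radius.
  rcases Set.eq_empty_or_nonempty {ℓ | ∃ (γ : ℝ → M) (a b : ℝ), IsPiecewiseSmooth n γ a b ∧
    γ a = o ∧ γ b = z ∧ ℓ = F.length γ a b} with hempty | hne
  · rw [dist, hempty, Real.sInf_empty]
    exact hpos.ne
  -- The levels form an open set, so there is a regular level `c'` above `c`. Since `z` lies at or
  -- above it, every curve to `z` has length at least the strictly larger radius of `c'`.
  obtain ⟨u, hcu, hu⟩ := exists_Ico_subset_of_mem_nhds (h.isOpen_levels.mem_nhds hc) ⟨c + 1, by simp⟩
  obtain ⟨c', hcc', hc'u⟩ := exists_between hcu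
  have hc' : c' ∈ levels n ρ := hu ⟨hcc'.le, hc'u⟩
  refine ((h.radius_lt hc' (h.lt_of_mem_levels hc).le hcc').trans_le (le_csInf hne ?_)).ne'
  rintro _ ⟨γ, a, b, hγ, ha, hb, rfl⟩
  exact h.radius_le_length hc' hγ ha (hb.symm ▸ h.le_of_isCriticalPoint hz hzo hc')

/-- The levels of `ρ` are geodesic hyperspheres. -/
theorem isGeodesicHypersphere (h : F.RadialSolution ρ φ o) (hc : c ∈ levels n ρ) :
    F.IsGeodesicHypersphere o (F.radius ρ o c) (regularHypersurface n ρ c) := by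
  constructor
  · ext q
    constructor
    · rintro ⟨rfl, hq⟩
      exact h.dist_eq hq
    · intro hq
      have hreg : ¬ IsCriticalPoint n ρ q := fun hcrit => h.dist_ne_radius hcrit hc hq
      exact ⟨h.radius_injOn ⟨q, hreg, rfl⟩ hc ((h.dist_eq hreg).symm.trans hq), hreg⟩
  · ext q
    constructor
    · rintro ⟨rfl, hq⟩
      obtain ⟨γ, -, hγ, h0, hr⟩ := h.exists_geodesic hq
      exact ⟨γ, hγ, h0, hr⟩
    · rintro ⟨γ, hγ, h0, rfl⟩
      obtain ⟨h1, h2⟩ := h.level_geodesic hγ h0 hc rfl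
      exact ⟨h2, h1⟩

/-- The regular hypersurface of each value is connected, so the component `C` is all of it. -/
theorem exists_isGeodesicHypersphere (h : F.RadialSolution ρ φ o) {C : Set M}
    (hC : IsLevelSet n ρ C) : ∃ r : ℝ, 0 < r ∧ F.IsGeodesicHypersphere o r C := by
  obtain ⟨c, p, hp, rfl⟩ := hC
  have hc : c ∈ levels n ρ := ⟨p, hp.2, hp.1⟩
  have hconn : IsPreconnected (regularHypersurface n ρ c) := by
    have h1 := h.flow.isPreconnected_level c
    have h2 : {p | p ∈ {p | ¬ IsCriticalPoint n ρ p} ∧ ρ p = c} = regularHypersurface n ρ c := by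
      ext q
      exact and_comm
    rwa [h2] at h1
  rw [hconn.connectedComponentIn hp]
  exact ⟨_, h.radius_pos hc, h.isGeodesicHypersphere hc⟩

end RadialSolution

theorem mem_closure_regular [ConnectedSpace M] (hn : 2 ≤ n)
    (hρ : ContMDiff (𝓡 n) 𝓘(ℝ, ℝ) ∞ ρ) (hsol : F.IsSolution ρ φ)
    (hnonconst : ∃ p q : M, ρ p ≠ ρ q) (z : M) : z ∈ closure {p | ¬ IsCriticalPoint n ρ p} := by
  by_cases hz : IsCriticalPoint n ρ z
  · rw [mem_closure_iff_nhds]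
    intro A hA
    obtain ⟨N, hNA, -, -, -, x, hxN, hxz⟩ := exists_punctured_nhds hn
      (inter_mem hA (eventually_not_isCriticalPoint hn hρ hsol hnonconst hz))
    exact ⟨x, (hNA hxN).1, (hNA hxN).2 hxz⟩
  · exact subset_closure hz

theorem radialSolution [T2Space M] [ConnectedSpace M] (hn : 2 ≤ n) (hF : F.IsComplete)
    (hρ : ContMDiff (𝓡 n) 𝓘(ℝ, ℝ) ∞ ρ) (hsol : F.IsSolution ρ φ)
    (hnonconst : ∃ p q : M, ρ p ≠ ρ q) (ho : IsCriticalPoint n ρ o) (hφ : 0 < φ o) :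
    F.RadialSolution ρ φ o where
  smooth := hρ
  sol := hsol
  crit := ho
  pos := hφ
  factor := continuous_factor hn hρ hsol
  flow := radialFlow hn hF hρ hsol hnonconst ho hφ
  dense := mem_closure_regular hn hρ hsol hnonconst

end FinslerStructure

theorem IsLevelSet.neg {n : ℕ} {M : Type*} [TopologicalSpace M] [ChartedSpace (Coord n) M]
    {ρ : M → ℝ} {C : Set M} (hC : IsLevelSet n ρ C) : IsLevelSet n (fun x => -ρ x) C := by
  obtain ⟨c, p, hp, rfl⟩ := hC
  have h : regularHypersurface n (fun x => -ρ x) (-c) = regularHypersurface n ρ c := by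
    ext q
    simp only [regularHypersurface, mem_ofPred_eq, isCriticalPoint_neg_iff, neg_inj]
  exact ⟨-c, p, h ▸ hp, by rw [h]⟩

end Finsler

theorem mainTheorem5 {n : ℕ} (hn : 2 ≤ n) {M : Type*} [TopologicalSpace M] [T2Space M]
    [ConnectedSpace M] [ChartedSpace (EuclideanSpace ℝ (Fin n)) M] [IsManifold (𝓡 n) ∞ M]
    (F : Finsler.FinslerStructure n M) (hF : F.IsComplete)
    (ρ φ : M → ℝ) (hρ : ContMDiff (𝓡 n) 𝓘(ℝ, ℝ) ∞ ρ) (hnonconst : ∃ p q : M, ρ p ≠ ρ q)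
    (hsol : F.IsSolution ρ φ) (o : M) (ho : Finsler.IsCriticalPoint n ρ o) :
    (∃ U ∈ 𝓝 o, ∀ q ∈ U, Finsler.IsCriticalPoint n ρ q → q = o) ∧
      ∀ C : Set M, Finsler.IsLevelSet n ρ C →
        ∃ r : ℝ, 0 < r ∧ F.IsGeodesicHypersphere o r C := by
  constructor
  · refine ⟨_, Finsler.FinslerStructure.eventually_not_isCriticalPoint hn hρ hsol hnonconst ho,
      fun q hq hcrit => ?_⟩
    by_contra hne
    exact hq hne hcrit
  · intro C hC
    rcases lt_or_gt_of_ne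
      (Finsler.FinslerStructure.factor_ne_zero hn hρ hsol hnonconst ho) with hφ | hφ
    -- A maximum of ρ is a minimum of -ρ, and both functions have the same level sets.
    · have hnonconst' : ∃ p q : M, -ρ p ≠ -ρ q := by
        obtain ⟨p, q, hpq⟩ := hnonconst
        exact ⟨p, q, neg_injective.ne hpq⟩
      exact (Finsler.FinslerStructure.radialSolution hn hF hρ.neg hsol.neg hnonconst'
        (Finsler.isCriticalPoint_neg_iff.2 ho)
        (neg_pos.2 hφ)).exists_isGeodesicHypersphere hC.neg
    · exact (Finsler.FinslerStructure.radialSolution hn hF hρ hsol hnonconst ho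
        hφ).exists_isGeodesicHypersphere hC
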